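/- There is a deterministic algorithm and there are constants $c,C,k$ such that the following holds. Let $G=(V,E)$ be an undirected simple graph with vertex set $V=\{0,\dots,n-1\}$, let the edges of $G$ have nonnegative real weights, and let $s,t\in V$ be joined by a path in $G$. Given the adjacency matrix and the weight matrix of $G$ and the vertices $s,t$, the algorithm halts after at most $C\,n^3(\lfloor\log_2 n\rfloor+1)^k$ steps, that is, in $\tilde O(n^3)$ time. It outputs (the vertex sequence of) a shortest path $\pi_G(s,t)$ from $s$ to $t$ in $G$, and, for all edges $d_1,d_2,d_3$ on $\pi_G(s,t)$, the length $|\pi_{G-\{d_1,d_2,d_3\}}(s,t)|$ of a shortest path from $s$ to $t$ in the graph obtained from $G$ by deleting the edges $d_1,d_2,d_3$; this length is $\infty$ if there is no such path. Here the length of a path is the sum of the weights of its edges. If $G$ has several shortest paths from $s$ to $t$, then $\pi_G(s,t)$ is the one that the algorithm outputs. The edges $d_1,d_2,d_3$ are arbitrary edges of $\pi_G(s,t)$; they need not be distinct. The machine is a random access machine with unit-cost operations. Its integer words are smaller than $(n+1)^c$ (so they have $O(\log n)$ bits) and can be added, subtracted, multiplied, divided with rounding, compared and used as addresses. Its real numbers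 can only be copied, added, subtracted and compared. -/

import Mathlib

/-! ## A deterministic word/real RAM with a step count

Programs are finite structured programs over finitely many named variables and arrays. There are two
sorts of data. *Words* are natural numbers below a bound `W`; they carry the usual word arithmetic
and are the only things that can be used as array indices. *Reals* can only be copied, added,
subtracted and compared (the comparison-addition model); a real can never be turned into a word. -/

namespace RealRAM

/-- A memory configuration: word variables, real variables, word arrays, real arrays. Arrays are
addressed by the name of the array (a fixed number in the program) and an index. -/
structure State where
  wvar : ℕ → ℕ
  rvar : ℕ → ℝ
  warr : ℕ → ℕ → ℕ
  rarr : ℕ → ℕ → ℝ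

/-- Word expressions. -/
inductive WExpr where
  | lit (m : ℕ)
  | var (x : ℕ)
  | add (e₁ e₂ : WExpr)
  | sub (e₁ e₂ : WExpr)
  | mul (e₁ e₂ : WExpr)
  | div (e₁ e₂ : WExpr)
  | get (a : ℕ) (i : WExpr)

/-- Real expressions. The only real constant is `0`. -/
inductive RExpr where
  | zero
  | var (x : ℕ)
  | add (e₁ e₂ : RExpr)
  | sub (e₁ e₂ : RExpr)
  | get (a : ℕ) (i : WExpr)

/-- Tests: comparisons of two words or of two reals. -/
inductive Cond where
  | wlt (e₁ e₂ : WExpr)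
  | weq (e₁ e₂ : WExpr)
  | rle (e₁ e₂ : RExpr)

/-- Programs. -/
inductive Cmd where
  | skip
  | setW (x : ℕ) (e : WExpr)
  | setR (x : ℕ) (e : RExpr)
  | putW (a : ℕ) (i e : WExpr)
  | putR (a : ℕ) (i : WExpr) (e : RExpr)
  | seq (p q : Cmd)
  | ite (b : Cond) (p q : Cmd)
  | while (b : Cond) (p : Cmd)

/-- A word that does not fit makes the computation undefined. -/
def fit (W v : ℕ) : Option ℕ := if v < W then some v else none

/-- Value of a word expression with word bound `W`; `none` on overflow. Subtraction is truncated at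
`0`, division rounds down, and division by `0` gives `0`. -/
def WExpr.eval (W : ℕ) (σ : State) : WExpr → Option ℕ
  | .lit m => fit W m
  | .var x => some (σ.wvar x)
  | .add e₁ e₂ => (e₁.eval W σ).bind fun u => (e₂.eval W σ).bind fun v => fit W (u + v)
  | .sub e₁ e₂ => (e₁.eval W σ).bind fun u => (e₂.eval W σ).bind fun v => fit W (u - v)
  | .mul e₁ e₂ => (e₁.eval W σ).bind fun u => (e₂.eval W σ).bind fun v => fit W (u * v)
  | .div e₁ e₂ => (e₁.eval W σ).bind fun u => (e₂.eval W σ).bind fun v => fit W (u / v)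
  | .get a i => (i.eval W σ).map fun m => σ.warr a m

/-- Value of a real expression; `none` if the computation of an index overflows. -/
noncomputable def RExpr.eval (W : ℕ) (σ : State) : RExpr → Option ℝ
  | .zero => some 0
  | .var x => some (σ.rvar x)
  | .add e₁ e₂ => (e₁.eval W σ).bind fun u => (e₂.eval W σ).map fun v => u + v
  | .sub e₁ e₂ => (e₁.eval W σ).bind fun u => (e₂.eval W σ).map fun v => u - v
  | .get a i => (i.eval W σ).map fun m => σ.rarr a m

/-- Truth value of a test. -/
noncomputable def Cond.eval (W : ℕ) (σ : State) : Cond → Option Bool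
  | .wlt e₁ e₂ => (e₁.eval W σ).bind fun u => (e₂.eval W σ).map fun v => decide (u < v)
  | .weq e₁ e₂ => (e₁.eval W σ).bind fun u => (e₂.eval W σ).map fun v => decide (u = v)
  | .rle e₁ e₂ => (e₁.eval W σ).bind fun u => (e₂.eval W σ).map fun v => decide (u ≤ v)

/-- Number of steps for evaluating an expression: one per operation, constant or memory access. -/
def WExpr.cost : WExpr → ℕ
  | .lit _ => 1
  | .var _ => 1
  | .add e₁ e₂ => e₁.cost + e₂.cost + 1
  | .sub e₁ e₂ => e₁.cost + e₂.cost + 1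
  | .mul e₁ e₂ => e₁.cost + e₂.cost + 1
  | .div e₁ e₂ => e₁.cost + e₂.cost + 1
  | .get _ i => i.cost + 1

def RExpr.cost : RExpr → ℕ
  | .zero => 1
  | .var _ => 1
  | .add e₁ e₂ => e₁.cost + e₂.cost + 1
  | .sub e₁ e₂ => e₁.cost + e₂.cost + 1
  | .get _ i => i.cost + 1

def Cond.cost : Cond → ℕ
  | .wlt e₁ e₂ => e₁.cost + e₂.cost + 1
  | .weq e₁ e₂ => e₁.cost + e₂.cost + 1
  | .rle e₁ e₂ => e₁.cost + e₂.cost + 1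

/-- `Exec W p σ T τ`: with word bound `W`, the program `p` started in configuration `σ` halts after
exactly `T` steps in configuration `τ`, and no word overflows on the way. There is at most one such
`T` and `τ`. -/
inductive Exec (W : ℕ) : Cmd → State → ℕ → State → Prop
  | skip (σ : State) : Exec W .skip σ 1 σ
  | setW {σ : State} {x : ℕ} {e : WExpr} {v : ℕ} (he : e.eval W σ = some v) :
      Exec W (.setW x e) σ (e.cost + 1) { σ with wvar := Function.update σ.wvar x v }
  | setR {σ : State} {x : ℕ} {e : RExpr} {r : ℝ} (he : e.eval W σ = some r) :
      Exec W (.setR x e) σ (e.cost + 1) { σ with rvar := Function.update σ.rvar x r }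
  | putW {σ : State} {a : ℕ} {i e : WExpr} {m v : ℕ}
      (hi : i.eval W σ = some m) (he : e.eval W σ = some v) :
      Exec W (.putW a i e) σ (i.cost + e.cost + 1)
        { σ with warr := Function.update σ.warr a (Function.update (σ.warr a) m v) }
  | putR {σ : State} {a : ℕ} {i : WExpr} {e : RExpr} {m : ℕ} {r : ℝ}
      (hi : i.eval W σ = some m) (he : e.eval W σ = some r) :
      Exec W (.putR a i e) σ (i.cost + e.cost + 1)
        { σ with rarr := Function.update σ.rarr a (Function.update (σ.rarr a) m r) }
  | seq {p q : Cmd} {σ τ υ : State} {T₁ T₂ : ℕ}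
      (hp : Exec W p σ T₁ τ) (hq : Exec W q τ T₂ υ) : Exec W (.seq p q) σ (T₁ + T₂) υ
  | iteTrue {b : Cond} {p q : Cmd} {σ τ : State} {T : ℕ}
      (hb : b.eval W σ = some true) (hp : Exec W p σ T τ) :
      Exec W (.ite b p q) σ (b.cost + T) τ
  | iteFalse {b : Cond} {p q : Cmd} {σ τ : State} {T : ℕ}
      (hb : b.eval W σ = some false) (hq : Exec W q σ T τ) :
      Exec W (.ite b p q) σ (b.cost + T) τ
  | whileFalse {b : Cond} {p : Cmd} {σ : State} (hb : b.eval W σ = some false) :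
      Exec W (.while b p) σ b.cost σ
  | whileTrue {b : Cond} {p : Cmd} {σ τ υ : State} {T₁ T₂ : ℕ}
      (hb : b.eval W σ = some true) (hp : Exec W p σ T₁ τ) (hw : Exec W (.while b p) τ T₂ υ) :
      Exec W (.while b p) σ (b.cost + T₁ + T₂) υ

end RealRAM

/-! ## Shortest paths in weighted undirected graphs -/

namespace WeightedGraph

/-- The length `|P|` of a walk: the sum of the weights of its edges. -/
def weight {V : Type*} {G : SimpleGraph V} (w : Sym2 V → ℝ) {u v : V} (p : G.Walk u v) : ℝ :=
  (p.edges.map w).sum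

/-- `p` is a shortest path between its endpoints in `G`. -/
def IsShortestPath {V : Type*} {G : SimpleGraph V} (w : Sym2 V → ℝ) {u v : V}
    (p : G.Walk u v) : Prop :=
  p.IsPath ∧ ∀ q : G.Walk u v, q.IsPath → weight w p ≤ weight w q

/-- `IsDist G w u v d`: the length of a shortest path from `u` to `v` in `G` is `d`, where `none`
stands for `∞` (there is no path). -/
def IsDist {V : Type*} (G : SimpleGraph V) (w : Sym2 V → ℝ) (u v : V) : Option ℝ → Prop
  | none => ¬ G.Reachable u v
  | some x => ∃ p : G.Walk u v, IsShortestPath w p ∧ weight w p = x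

/-- The edge joining the `i`-th and the `(i+1)`-st vertex of a walk (counted from `0`, for
`i < p.length`). -/
def stepEdge {V : Type*} {G : SimpleGraph V} {u v : V} (p : G.Walk u v) (i : ℕ) : Sym2 V :=
  s(p.getVert i, p.getVert (i + 1))

/-- Row-major layout of an `n × n` matrix: entry `(u, v)` is at index `u * n + v`, and the value is
`0` beyond the matrix. -/
def rowMajor {α : Type*} [Zero α] (n : ℕ) (A : Fin n → Fin n → α) (m : ℕ) : α :=
  if h : m < n * n then
    A ⟨m / n, Nat.div_lt_of_lt_mul h⟩ ⟨m % n, Nat.mod_lt m (Nat.pos_of_lt_mul_right h)⟩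
  else 0

open Classical in
/-- The input configuration: the word variables `0, 1, 2` hold `n, s, t`, word array `0` holds the
adjacency matrix and real array `0` the matrix of weights (with `0` for non-adjacent pairs).
Everything else is `0`. -/
noncomputable def inputState {n : ℕ} (G : SimpleGraph (Fin n)) (w : Sym2 (Fin n) → ℝ)
    (s t : Fin n) : RealRAM.State where
  wvar x := if x = 0 then n else if x = 1 then s else if x = 2 then t else 0
  rvar _ := 0
  warr a := if a = 0 then rowMajor n fun u v => if G.Adj u v then 1 else 0 else 0
  rarr a := if a = 0 then rowMajor n fun u v => if G.Adj u v then w s(u, v) else 0 else 0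

/-- The answer for the positions `(i, j, l)` in an output configuration of a program run on a graph
with `n` vertices, found at index `(i * n + j) * n + l`: `∞` if the entry of word array `2` is `0`,
and otherwise the entry of real array `2`. -/
noncomputable def answer (n : ℕ) (σ : RealRAM.State) (i j l : ℕ) : Option ℝ :=
  if σ.warr 2 ((i * n + j) * n + l) = 0 then none else some (σ.rarr 2 ((i * n + j) * n + l))

end WeightedGraph

/-! The number of triples of path edges may be cubic, so a triple can only afford polylogarithmic
time on average. This is achieved by divide and conquer over boxes of triples of positions.

A shortest path is found by Bellman–Ford distances (`hopDist`) in cubic time. All its edges are then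
deleted, and the distances between all pairs in the remaining graph are computed by repeated
squaring. From here on edges are only inserted. When an edge `ab` of length `c` is inserted, the new
distance from `u` to `v` is the least of the old one, `d(u,a) + c + d(b,v)` and `d(u,b) + c +
d(a,v)` (`min_le_wdist_sup_edge` is the nontrivial inequality). So the distances within any set of
vertices that contains `a` and `b` can be updated without knowledge of the others, in time quadratic
in the size of the set.

The positions on the path are padded to a power of two `N` with `n ≤ N < 2n` and cut into blocks of
length `m`. To a triple of blocks, a box, belongs the graph in which the path edges outside the
three blocks are present and those inside are absent (`switch` with `offBox`). Only the distances
between `O(m)` terminals are kept: `s`, `t` and the endpoints of the path edges in the three blocks.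
The top box, with `m = N`, is the graph without the path. A box with blocks of length `m` arises
from its parent, with blocks of length `2m`, by inserting those path edges of the parent's blocks
that lie outside its own. The endpoints of these `O(m)` edges are terminals of the parent, and the
terminals of the box are among those of the parent (`terminals_half_subset`). Hence one box costs
`O(m)` insertions of `O(m²)` updates. There are `(N/m)³` boxes, so each level costs `O(N³)`, and
there are `O(log n)` levels. At `m = 1` the box `(i, j, l)` is the graph without exactly the edges
`i`, `j`, `l`, and the answer is the entry for `s` and `t`.

The program logic `Runs` combines total correctness, a time bound and a bound on all stored words.
Overflow, costs of straight-line code and the absence of interference are reduced to computations on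
the syntax. -/

/-! ## Reasoning about programs of the RAM -/

namespace RealRAM

/-! ### Updates of the memory. -/

namespace State

/-- Assignment to a word variable. -/
def setW (σ : State) (x v : ℕ) : State := { σ with wvar := Function.update σ.wvar x v }

/-- Assignment to a real variable. -/
def setR (σ : State) (x : ℕ) (r : ℝ) : State := { σ with rvar := Function.update σ.rvar x r }

/-- Assignment to an entry of a word array. -/
def putW (σ : State) (a m v : ℕ) : State :=
  { σ with warr := Function.update σ.warr a (Function.update (σ.warr a) m v) }

/-- Assignment to an entry of a real array. -/
def putR (σ : State) (a m : ℕ) (r : ℝ) : State :=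
  { σ with rarr := Function.update σ.rarr a (Function.update (σ.rarr a) m r) }

variable (σ : State) (x y v a b m k : ℕ) (r : ℝ)

@[simp] theorem setW_wvar : (σ.setW x v).wvar y = if y = x then v else σ.wvar y := by
  simp [setW, Function.update_apply]
@[simp] theorem setW_rvar : (σ.setW x v).rvar = σ.rvar := rfl
@[simp] theorem setW_warr : (σ.setW x v).warr = σ.warr := rfl
@[simp] theorem setW_rarr : (σ.setW x v).rarr = σ.rarr := rfl
@[simp] theorem setR_wvar : (σ.setR x r).wvar = σ.wvar := rfl
@[simp] theorem setR_rvar : (σ.setR x r).rvar y = if y = x then r else σ.rvar y := by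
  simp [setR, Function.update_apply]
@[simp] theorem setR_warr : (σ.setR x r).warr = σ.warr := rfl
@[simp] theorem setR_rarr : (σ.setR x r).rarr = σ.rarr := rfl
@[simp] theorem putW_wvar : (σ.putW a m v).wvar = σ.wvar := rfl
@[simp] theorem putW_rvar : (σ.putW a m v).rvar = σ.rvar := rfl
@[simp] theorem putW_rarr : (σ.putW a m v).rarr = σ.rarr := rfl
@[simp] theorem putW_warr : (σ.putW a m v).warr b k =
    if b = a ∧ k = m then v else σ.warr b k := by
  by_cases h : b = a
  · subst h; simp [putW, Function.update_apply]
  · simp [putW, h]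
@[simp] theorem putR_wvar : (σ.putR a m r).wvar = σ.wvar := rfl
@[simp] theorem putR_rvar : (σ.putR a m r).rvar = σ.rvar := rfl
@[simp] theorem putR_warr : (σ.putR a m r).warr = σ.warr := rfl
@[simp] theorem putR_rarr : (σ.putR a m r).rarr b k =
    if b = a ∧ k = m then r else σ.rarr b k := by
  by_cases h : b = a
  · subst h; simp [putR, Function.update_apply]
  · simp [putR, h]

/-- All words in the configuration are at most `X`. -/
def Bounded (X : ℕ) (σ : State) : Prop := (∀ x, σ.wvar x ≤ X) ∧ ∀ a m, σ.warr a m ≤ X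

end State

open State

/-! ### Values of expressions when nothing overflows -/

/-- Value of a word expression in the absence of overflow. -/
def WExpr.den (σ : State) : WExpr → ℕ
  | .lit m => m
  | .var x => σ.wvar x
  | .add e₁ e₂ => e₁.den σ + e₂.den σ
  | .sub e₁ e₂ => e₁.den σ - e₂.den σ
  | .mul e₁ e₂ => e₁.den σ * e₂.den σ
  | .div e₁ e₂ => e₁.den σ / e₂.den σ
  | .get a i => σ.warr a (i.den σ)

/-- If all words in the memory are at most `X`, the value of the expression is at most
`X ^ vdeg`. -/
def WExpr.vdeg : WExpr → ℕ
  | .lit _ => 1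
  | .var _ => 1
  | .add e₁ e₂ => max e₁.vdeg e₂.vdeg + 1
  | .sub e₁ _ => e₁.vdeg
  | .mul e₁ e₂ => e₁.vdeg + e₂.vdeg
  | .div e₁ _ => e₁.vdeg
  | .get _ _ => 1

/-- The largest `vdeg` of a subexpression is at most `24`, and literals are at most `20`. -/
def WExpr.good : WExpr → Bool
  | .lit m => decide (m ≤ 20)
  | .var _ => true
  | .add e₁ e₂ => e₁.good && e₂.good && decide ((WExpr.add e₁ e₂).vdeg ≤ 24)
  | .sub e₁ e₂ => e₁.good && e₂.good && decide ((WExpr.sub e₁ e₂).vdeg ≤ 24)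
  | .mul e₁ e₂ => e₁.good && e₂.good && decide ((WExpr.mul e₁ e₂).vdeg ≤ 24)
  | .div e₁ e₂ => e₁.good && e₂.good && decide ((WExpr.div e₁ e₂).vdeg ≤ 24)
  | .get _ i => i.good

/-- The word size suffices for expressions of degree `24` in words that are at most `X`. -/
def Wide (W X : ℕ) : Prop := 20 ≤ X ∧ X ^ 24 < W

/-- A polynomial bound in `X` excludes overflow by a syntactic check. A sum costs one more degree
because `2 * X ^ d ≤ X ^ (d + 1)`, and a memory access starts again at degree one because stored
words are at most `X`. Subexpressions are checked too, since an intermediate overflow is already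
fatal. -/
theorem WExpr.eval_eq {W X : ℕ} (hX : Wide W X) {σ : State} (hσ : σ.Bounded X) (e : WExpr)
    (he : e.good = true) : e.eval W σ = some (e.den σ) ∧ e.den σ ≤ X ^ e.vdeg := by
  have h1 : 1 ≤ X := le_trans (by norm_num) hX.1
  have fits : ∀ {d v : ℕ}, d ≤ 24 → v ≤ X ^ d → fit W v = some v := fun {d v} hd hv => by
    have : v < W := lt_of_le_of_lt (hv.trans (Nat.pow_le_pow_right h1 hd)) hX.2
    simp [fit, this]
  induction e with
  | lit m =>
    simp only [WExpr.good, decide_eq_true_eq] at he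
    have hm : m ≤ X ^ 1 := by rw [pow_one]; exact he.trans hX.1
    exact ⟨fits (by norm_num) hm, hm⟩
  | var x => exact ⟨rfl, by simpa [WExpr.den, WExpr.vdeg] using hσ.1 x⟩
  | get a i ih =>
    refine ⟨by simp [WExpr.eval, (ih he).1, WExpr.den],
      by simpa [WExpr.den, WExpr.vdeg] using hσ.2 _ _⟩
  | add e₁ e₂ ih₁ ih₂ =>
    simp only [WExpr.good, Bool.and_eq_true, decide_eq_true_eq] at he
    obtain ⟨e1, b1⟩ := ih₁ he.1.1
    obtain ⟨e2, b2⟩ := ih₂ he.1.2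
    have b : e₁.den σ + e₂.den σ ≤ X ^ (max e₁.vdeg e₂.vdeg + 1) := by
      have h2 : 2 ≤ X := le_trans (by norm_num) hX.1
      have c1 := b1.trans (Nat.pow_le_pow_right h1 (le_max_left e₁.vdeg e₂.vdeg))
      have c2 := b2.trans (Nat.pow_le_pow_right h1 (le_max_right e₁.vdeg e₂.vdeg))
      rw [pow_succ]
      nlinarith
    exact ⟨by simp [WExpr.eval, e1, e2, fits he.2 b, WExpr.den], b⟩
  | sub e₁ e₂ ih₁ ih₂ =>
    simp only [WExpr.good, Bool.and_eq_true, decide_eq_true_eq] at he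
    obtain ⟨e1, b1⟩ := ih₁ he.1.1
    obtain ⟨e2, b2⟩ := ih₂ he.1.2
    have b : e₁.den σ - e₂.den σ ≤ X ^ e₁.vdeg := (Nat.sub_le _ _).trans b1
    exact ⟨by simp [WExpr.eval, e1, e2, fits he.2 b, WExpr.den], b⟩
  | mul e₁ e₂ ih₁ ih₂ =>
    simp only [WExpr.good, Bool.and_eq_true, decide_eq_true_eq] at he
    obtain ⟨e1, b1⟩ := ih₁ he.1.1
    obtain ⟨e2, b2⟩ := ih₂ he.1.2
    have b : e₁.den σ * e₂.den σ ≤ X ^ (e₁.vdeg + e₂.vdeg) := by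
      rw [pow_add]; exact Nat.mul_le_mul b1 b2
    exact ⟨by simp [WExpr.eval, e1, e2, fits he.2 b, WExpr.den], b⟩
  | div e₁ e₂ ih₁ ih₂ =>
    simp only [WExpr.good, Bool.and_eq_true, decide_eq_true_eq] at he
    obtain ⟨e1, b1⟩ := ih₁ he.1.1
    obtain ⟨e2, b2⟩ := ih₂ he.1.2
    have b : e₁.den σ / e₂.den σ ≤ X ^ e₁.vdeg := (Nat.div_le_self _ _).trans b1
    exact ⟨by simp [WExpr.eval, e1, e2, fits he.2 b, WExpr.den], b⟩

/-- Value of a real expression in the absence of overflow. -/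
noncomputable def RExpr.den (σ : State) : RExpr → ℝ
  | .zero => 0
  | .var x => σ.rvar x
  | .add e₁ e₂ => e₁.den σ + e₂.den σ
  | .sub e₁ e₂ => e₁.den σ - e₂.den σ
  | .get a i => σ.rarr a (i.den σ)

def RExpr.good : RExpr → Bool
  | .zero => true
  | .var _ => true
  | .add e₁ e₂ => e₁.good && e₂.good
  | .sub e₁ e₂ => e₁.good && e₂.good
  | .get _ i => i.good

theorem RExpr.eval_eq {W X : ℕ} (hX : Wide W X) {σ : State} (hσ : σ.Bounded X) (e : RExpr)
    (he : e.good = true) : e.eval W σ = some (e.den σ) := by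
  induction e with
  | zero => rfl
  | var x => rfl
  | get a i => simp [RExpr.eval, RExpr.den, (i.eval_eq hX hσ he).1]
  | add e₁ e₂ ih₁ ih₂ =>
    simp only [RExpr.good, Bool.and_eq_true] at he
    simp [RExpr.eval, RExpr.den, ih₁ he.1, ih₂ he.2]
  | sub e₁ e₂ ih₁ ih₂ =>
    simp only [RExpr.good, Bool.and_eq_true] at he
    simp [RExpr.eval, RExpr.den, ih₁ he.1, ih₂ he.2]

/-- Truth of a test in the absence of overflow. -/
def Cond.den (σ : State) : Cond → Prop
  | .wlt e₁ e₂ => e₁.den σ < e₂.den σ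
  | .weq e₁ e₂ => e₁.den σ = e₂.den σ
  | .rle e₁ e₂ => e₁.den σ ≤ e₂.den σ

def Cond.good : Cond → Bool
  | .wlt e₁ e₂ => e₁.good && e₂.good
  | .weq e₁ e₂ => e₁.good && e₂.good
  | .rle e₁ e₂ => e₁.good && e₂.good

open Classical in
theorem Cond.eval_eq {W X : ℕ} (hX : Wide W X) {σ : State} (hσ : σ.Bounded X) (b : Cond)
    (hb : b.good = true) : b.eval W σ = some (decide (b.den σ)) := by
  cases b with
  | wlt e₁ e₂ =>
    simp only [Cond.good, Bool.and_eq_true] at hb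
    simp only [Cond.eval, Cond.den, (e₁.eval_eq hX hσ hb.1).1, (e₂.eval_eq hX hσ hb.2).1,
      Option.bind_some, Option.map_some]
    congr 2
  | weq e₁ e₂ =>
    simp only [Cond.good, Bool.and_eq_true] at hb
    simp only [Cond.eval, Cond.den, (e₁.eval_eq hX hσ hb.1).1, (e₂.eval_eq hX hσ hb.2).1,
      Option.bind_some, Option.map_some]
    congr 2
  | rle e₁ e₂ =>
    simp only [Cond.good, Bool.and_eq_true] at hb
    simp only [Cond.eval, Cond.den, e₁.eval_eq hX hσ hb.1, e₂.eval_eq hX hσ hb.2,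
      Option.bind_some, Option.map_some]
    congr 2

/-! ### Frames -/

namespace Cmd

/-- The word variables that a program may change. -/
def wvs : Cmd → List ℕ
  | .setW x _ => [x]
  | .seq p q => p.wvs ++ q.wvs
  | .ite _ p q => p.wvs ++ q.wvs
  | .while _ p => p.wvs
  | _ => []

/-- The real variables that a program may change. -/
def rvs : Cmd → List ℕ
  | .setR x _ => [x]
  | .seq p q => p.rvs ++ q.rvs
  | .ite _ p q => p.rvs ++ q.rvs
  | .while _ p => p.rvs
  | _ => []

/-- The word arrays that a program may change. -/
def was : Cmd → List ℕ
  | .putW a _ _ => [a]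
  | .seq p q => p.was ++ q.was
  | .ite _ p q => p.was ++ q.was
  | .while _ p => p.was
  | _ => []

/-- The real arrays that a program may change. -/
def ras : Cmd → List ℕ
  | .putR a _ _ => [a]
  | .seq p q => p.ras ++ q.ras
  | .ite _ p q => p.ras ++ q.ras
  | .while _ p => p.ras
  | _ => []

end Cmd

/-- The two configurations agree on everything that `p` cannot change. -/
structure Agree (p : Cmd) (σ τ : State) : Prop where
  wv : ∀ x, x ∉ p.wvs → τ.wvar x = σ.wvar x
  rv : ∀ x, x ∉ p.rvs → τ.rvar x = σ.rvar x
  wa : ∀ a, a ∉ p.was → τ.warr a = σ.warr a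
  ra : ∀ a, a ∉ p.ras → τ.rarr a = σ.rarr a

namespace Agree

theorem refl (p : Cmd) (σ : State) : Agree p σ σ :=
  ⟨fun _ _ => rfl, fun _ _ => rfl, fun _ _ => rfl, fun _ _ => rfl⟩

theorem trans {p : Cmd} {σ τ υ : State} (h₁ : Agree p σ τ) (h₂ : Agree p τ υ) : Agree p σ υ :=
  ⟨fun x hx => (h₂.wv x hx).trans (h₁.wv x hx), fun x hx => (h₂.rv x hx).trans (h₁.rv x hx),
    fun x hx => (h₂.wa x hx).trans (h₁.wa x hx), fun x hx => (h₂.ra x hx).trans (h₁.ra x hx)⟩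

theorem mono {p q : Cmd} {σ τ : State} (h : Agree p σ τ) (h1 : p.wvs ⊆ q.wvs)
    (h2 : p.rvs ⊆ q.rvs) (h3 : p.was ⊆ q.was) (h4 : p.ras ⊆ q.ras) : Agree q σ τ :=
  ⟨fun x hx => h.wv x fun h' => hx (h1 h'), fun x hx => h.rv x fun h' => hx (h2 h'),
    fun x hx => h.wa x fun h' => hx (h3 h'), fun x hx => h.ra x fun h' => hx (h4 h')⟩

theorem left {p q : Cmd} {σ τ : State} (h : Agree p σ τ) : Agree (.seq p q) σ τ :=
  h.mono (List.subset_append_left _ _) (List.subset_append_left _ _)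
    (List.subset_append_left _ _) (List.subset_append_left _ _)

theorem right {p q : Cmd} {σ τ : State} (h : Agree q σ τ) : Agree (.seq p q) σ τ :=
  h.mono (List.subset_append_right _ _) (List.subset_append_right _ _)
    (List.subset_append_right _ _) (List.subset_append_right _ _)

end Agree

/-- This is the frame rule. The lists of names are computable, so facts about other parts of the
memory pass through a run by `decide`. -/
theorem Exec.agree {W : ℕ} {p : Cmd} {σ τ : State} {T : ℕ} (h : Exec W p σ T τ) :
    Agree p σ τ := by
  induction h with
  | skip σ => exact Agree.refl _ _
  | setW he =>
    refine ⟨fun x hx => ?_, fun _ _ => rfl, fun _ _ => rfl, fun _ _ => rfl⟩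
    exact Function.update_of_ne (by simpa [Cmd.wvs] using hx) _ _
  | setR he =>
    refine ⟨fun _ _ => rfl, fun x hx => ?_, fun _ _ => rfl, fun _ _ => rfl⟩
    exact Function.update_of_ne (by simpa [Cmd.rvs] using hx) _ _
  | putW hi he =>
    refine ⟨fun _ _ => rfl, fun _ _ => rfl, fun x hx => ?_, fun _ _ => rfl⟩
    exact Function.update_of_ne (by simpa [Cmd.was] using hx) _ _
  | putR hi he =>
    refine ⟨fun _ _ => rfl, fun _ _ => rfl, fun _ _ => rfl, fun x hx => ?_⟩
    exact Function.update_of_ne (by simpa [Cmd.ras] using hx) _ _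
  | seq _ _ ih₁ ih₂ => exact ih₁.left.trans ih₂.right
  | iteTrue _ _ ih =>
    exact (ih.left (q := _)).mono (fun _ h => h) (fun _ h => h) (fun _ h => h) (fun _ h => h)
  | iteFalse _ _ ih =>
    exact (ih.right (p := _)).mono (fun _ h => h) (fun _ h => h) (fun _ h => h) (fun _ h => h)
  | whileFalse _ => exact Agree.refl _ _
  | whileTrue _ _ _ ih₁ ih₂ =>
    exact Agree.trans (p := .while _ _)
      (ih₁.mono (fun _ h => h) (fun _ h => h) (fun _ h => h) (fun _ h => h)) ih₂

/-! ### Total correctness with a time bound -/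

/-- Started in `σ`, the program halts within `T` steps in a configuration that satisfies `Q`, and
all words in it are at most `X`. -/
def Runs (W X : ℕ) (p : Cmd) (σ : State) (T : ℕ) (Q : State → Prop) : Prop :=
  ∃ t τ, Exec W p σ t τ ∧ t ≤ T ∧ τ.Bounded X ∧ Q τ

namespace Runs

variable {W X : ℕ}

/-- The final configuration comes with its word bound and its agreement with the start, here and in
`seq`. Postconditions therefore need to mention only what changes. -/
theorem mono {p : Cmd} {σ : State} {T T' : ℕ} {Q Q' : State → Prop} (h : Runs W X p σ T Q)
    (hT : T ≤ T') (hQ : ∀ τ, τ.Bounded X → Agree p σ τ → Q τ → Q' τ) : Runs W X p σ T' Q' := by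
  obtain ⟨t, τ, h1, h2, h3, h4⟩ := h
  exact ⟨t, τ, h1, h2.trans hT, h3, hQ τ h3 h1.agree h4⟩

theorem seq {p q : Cmd} {σ : State} {T₁ T₂ : ℕ} {R Q : State → Prop} (hp : Runs W X p σ T₁ R)
    (hq : ∀ τ, τ.Bounded X → Agree p σ τ → R τ → Runs W X q τ T₂ Q) :
    Runs W X (.seq p q) σ (T₁ + T₂) Q := by
  obtain ⟨t, τ, h1, h2, h3, h4⟩ := hp
  obtain ⟨t', τ', h1', h2', h3', h4'⟩ := hq τ h3 h1.agree h4
  exact ⟨t + t', τ', .seq h1 h1', add_le_add h2 h2', h3', h4'⟩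

theorem ite (hX : Wide W X) {b : Cond} {p q : Cmd} {σ : State} {T T' : ℕ} {Q : State → Prop}
    (hσ : σ.Bounded X) (hb : b.good = true) (hT : b.cost + T ≤ T')
    (hp : b.den σ → Runs W X p σ T Q) (hq : ¬ b.den σ → Runs W X q σ T Q) :
    Runs W X (.ite b p q) σ T' Q := by
  have e := b.eval_eq hX hσ hb
  by_cases h : b.den σ
  · obtain ⟨t, τ, h1, h2, h3, h4⟩ := hp h
    exact ⟨_, τ, .iteTrue (by simpa [h] using e) h1, by omega, h3, h4⟩
  · obtain ⟨t, τ, h1, h2, h3, h4⟩ := hq h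
    exact ⟨_, τ, .iteFalse (by simpa [h] using e) h1, by omega, h3, h4⟩

end Runs

/-! ### Programs without loops -/

namespace Cmd

/-- There are no loops in the program, and no expression in it has a large degree. -/
def good : Cmd → Bool
  | .skip => true
  | .setW _ e => e.good
  | .setR _ e => e.good
  | .putW _ i e => i.good && e.good
  | .putR _ i e => i.good && e.good
  | .seq p q => p.good && q.good
  | .ite b p q => b.good && p.good && q.good
  | .while _ _ => false

/-- A bound for the number of steps of a program without loops. -/
def cost : Cmd → ℕ
  | .skip => 1
  | .setW _ e => e.cost + 1
  | .setR _ e => e.cost + 1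
  | .putW _ i e => i.cost + e.cost + 1
  | .putR _ i e => i.cost + e.cost + 1
  | .seq p q => p.cost + q.cost
  | .ite b p q => b.cost + max p.cost q.cost
  | .while _ _ => 0

open Classical in
/-- The final configuration of a program without loops. -/
noncomputable def sem : Cmd → State → State
  | .skip, σ => σ
  | .setW x e, σ => σ.setW x (e.den σ)
  | .setR x e, σ => σ.setR x (e.den σ)
  | .putW a i e, σ => σ.putW a (i.den σ) (e.den σ)
  | .putR a i e, σ => σ.putR a (i.den σ) (e.den σ)
  | .seq p q, σ => q.sem (p.sem σ)
  | .ite b p q, σ => if b.den σ then p.sem σ else q.sem σ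
  | .while _ _, σ => σ

theorem sem_ite_pos {b : Cond} {p q : Cmd} {σ : State} (h : b.den σ) :
    (Cmd.ite b p q).sem σ = p.sem σ := if_pos h

theorem sem_ite_neg {b : Cond} {p q : Cmd} {σ : State} (h : ¬ b.den σ) :
    (Cmd.ite b p q).sem σ = q.sem σ := if_neg h

/-- Every word that is stored by the program without loops is at most `X`. -/
def Safe (X : ℕ) : Cmd → State → Prop
  | .setW _ e, σ => e.den σ ≤ X
  | .putW _ _ e, σ => e.den σ ≤ X
  | .seq p q, σ => p.Safe X σ ∧ q.Safe X (p.sem σ)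
  | .ite b p q, σ => (b.den σ → p.Safe X σ) ∧ (¬ b.den σ → q.Safe X σ)
  | _, _ => True

end Cmd

namespace Runs

variable {W X : ℕ}

/-- Straight-line code is executed symbolically by `sem`. What remains to be shown for it is `Safe`
and the postcondition, because goodness and cost are evaluated. -/
theorem loopless (hX : Wide W X) {p : Cmd} {σ : State} (hσ : σ.Bounded X) (hp : p.good = true)
    (hs : p.Safe X σ) : Runs W X p σ p.cost (fun τ => τ = p.sem σ) := by
  induction p generalizing σ with
  | skip => exact ⟨_, _, .skip σ, le_rfl, hσ, rfl⟩
  | setW x e =>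
    refine ⟨_, _, .setW (e.eval_eq hX hσ hp).1, le_rfl, ⟨fun y => ?_, hσ.2⟩, rfl⟩
    change (σ.setW x (e.den σ)).wvar y ≤ X
    rw [setW_wvar]
    split_ifs
    exacts [hs, hσ.1 y]
  | setR x e => exact ⟨_, _, .setR (e.eval_eq hX hσ hp), le_rfl, hσ, rfl⟩
  | putW a i e =>
    simp only [Cmd.good, Bool.and_eq_true] at hp
    refine ⟨_, _, .putW (i.eval_eq hX hσ hp.1).1 (e.eval_eq hX hσ hp.2).1, le_rfl,
      ⟨hσ.1, fun b m => ?_⟩, rfl⟩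
    change (σ.putW a (i.den σ) (e.den σ)).warr b m ≤ X
    rw [putW_warr]
    split_ifs
    exacts [hs, hσ.2 b m]
  | putR a i e =>
    simp only [Cmd.good, Bool.and_eq_true] at hp
    exact ⟨_, _, .putR (i.eval_eq hX hσ hp.1).1 (e.eval_eq hX hσ hp.2), le_rfl, hσ, rfl⟩
  | seq p q ihp ihq =>
    simp only [Cmd.good, Bool.and_eq_true] at hp
    refine Runs.seq (ihp hσ hp.1 hs.1) fun τ hτ _ h => ?_
    subst h
    exact ihq hτ hp.2 hs.2
  | ite b p q ihp ihq =>
    simp only [Cmd.good, Bool.and_eq_true] at hp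
    refine Runs.ite hX hσ hp.1.1 le_rfl (fun h => ?_) (fun h => ?_)
    · refine (ihp hσ hp.1.2 (hs.1 h)).mono (le_max_left _ _) fun τ _ _ h' => ?_
      simp [Cmd.sem, h, h']
    · refine (ihq hσ hp.2 (hs.2 h)).mono (le_max_right _ _) fun τ _ _ h' => ?_
      simp [Cmd.sem, h, h']
  | _ => simp [Cmd.good] at hp

theorem of_loopless (hX : Wide W X) {p : Cmd} {σ : State} {T : ℕ} {Q : State → Prop}
    (hσ : σ.Bounded X) (hp : p.good = true) (hT : p.cost ≤ T) (hs : p.Safe X σ)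
    (hQ : Q (p.sem σ)) : Runs W X p σ T Q :=
  (loopless hX hσ hp hs).mono hT fun _ _ _ h => h ▸ hQ

end Runs

/-! ### Counting loops -/

/-- `for x < y do p`, where `x` and `y` are word variables. -/
def forLoop (x y : ℕ) (p : Cmd) : Cmd :=
  .seq (.setW x (.lit 0)) (.while (.wlt (.var x) (.var y))
    (.seq p (.setW x (.add (.var x) (.lit 1)))))

namespace Runs

variable {W X : ℕ}

/-- A round adds 3 steps for the test and 4 for the increment, and the loop adds 2 for the
initialization and 3 for the last test. The counter never exceeds the stored word `m`, so the
increment is safe. Each round is told that its configuration agrees with `σ` outside the loop's own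
names, which keeps such facts out of the invariant. -/
theorem forLoop (hX : Wide W X) {x y : ℕ} {p : Cmd} {σ : State} {m T : ℕ} (hσ : σ.Bounded X)
    (hm : σ.wvar y = m) (hxy : x ≠ y) (hx : x ∉ p.wvs) (hy : y ∉ p.wvs) (I : ℕ → State → Prop)
    (h0 : I 0 (σ.setW x 0))
    (hp : ∀ k < m, ∀ τ, τ.Bounded X → Agree (RealRAM.forLoop x y p) σ τ → τ.wvar x = k → I k τ →
      Runs W X p τ T fun υ => I (k + 1) (υ.setW x (k + 1))) :
    Runs W X (RealRAM.forLoop x y p) σ (m * (T + 7) + 5) (I m) := by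
  set A := Agree (RealRAM.forLoop x y p) with hA
  have hyA : y ∉ (RealRAM.forLoop x y p).wvs := by
    simp [RealRAM.forLoop, Cmd.wvs, hy, hxy.symm]
  have hmX : m ≤ X := hm ▸ hσ.1 y
  have key : ∀ d k τ, k + d = m → τ.Bounded X → A σ τ → τ.wvar x = k → I k τ →
      Runs W X (.while (.wlt (.var x) (.var y)) (.seq p (.setW x (.add (.var x) (.lit 1))))) τ
        (d * (T + 7) + 3) (I m) := by
    intro d
    induction d with
    | zero =>
      intro k τ hk hτ hτA hxk hI
      obtain rfl : k = m := by omega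
      refine ⟨_, τ, .whileFalse ?_, ?_, hτ, hI⟩
      · simp [Cond.eval, WExpr.eval, hxk, hτA.wv y hyA, hm]
      · simp [Cond.cost, WExpr.cost]
    | succ d ih =>
      intro k τ hk hτ hτA hxk hI
      have hkm : k < m := by omega
      obtain ⟨t₁, υ, e1, l1, b1, q1⟩ := hp k hkm τ hτ hτA hxk hI
      have hυx : υ.wvar x = k := (e1.agree.wv x hx).trans hxk
      have inc : Runs W X (.setW x (.add (.var x) (.lit 1))) υ 4
          (fun ρ => ρ = υ.setW x (k + 1)) := by
        refine Runs.of_loopless hX b1 rfl le_rfl ?_ ?_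
        · change υ.wvar x + 1 ≤ X
          omega
        · change υ.setW x (υ.wvar x + 1) = _
          rw [hυx]
      obtain ⟨t₂, ρ, e2, l2, b2, q2⟩ := inc
      have hAυ : A τ υ := e1.agree.mono
        (fun z hz => by simp [RealRAM.forLoop, Cmd.wvs, hz])
        (fun z hz => by simp [RealRAM.forLoop, Cmd.rvs, hz])
        (fun z hz => by simp [RealRAM.forLoop, Cmd.was, hz])
        (fun z hz => by simp [RealRAM.forLoop, Cmd.ras, hz])
      have hAρ : A υ ρ := e2.agree.mono
        (fun z hz => by simp [RealRAM.forLoop, Cmd.wvs] at hz ⊢; simp [hz])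
        (fun z hz => by simp [Cmd.rvs] at hz)
        (fun z hz => by simp [Cmd.was] at hz)
        (fun z hz => by simp [Cmd.ras] at hz)
      have hA' : A σ ρ := (hτA.trans hAυ).trans hAρ
      obtain ⟨t₃, π, e3, l3, b3, q3⟩ := ih (k + 1) ρ (by omega) b2 hA'
        (by rw [q2]; simp) (by rw [q2]; exact q1)
      refine ⟨_, π, .whileTrue ?_ (.seq e1 e2) e3, ?_, b3, q3⟩
      · simp [Cond.eval, WExpr.eval, hxk, hτA.wv y hyA, hm, hkm]
      · simp only [Cond.cost, WExpr.cost]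
        have : (d + 1) * (T + 7) = d * (T + 7) + (T + 7) := by ring
        omega
  have start : Runs W X (.setW x (.lit 0)) σ 2 (fun ρ => ρ = σ.setW x 0) :=
    Runs.of_loopless hX hσ rfl le_rfl (Nat.zero_le _) rfl
  refine (Runs.seq start fun τ hτ hAτ h => ?_).mono (T := 2 + (m * (T + 7) + 3)) (by omega)
    fun _ _ _ h => h
  refine key m 0 τ (by omega) hτ ?_ (by rw [h]; simp) (by rw [h]; exact h0)
  exact hAτ.left

/-- A loop whose `k`-th round achieves `P k`, where what has been achieved is preserved by
changes that satisfy the preorder `R`. -/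
theorem forLoop_achieve (hX : Wide W X) {x y : ℕ} {p : Cmd} {σ : State} {m T : ℕ}
    (hσ : σ.Bounded X) (hm : σ.wvar y = m) (hxy : x ≠ y) (hx : x ∉ p.wvs) (hy : y ∉ p.wvs)
    (R : State → State → Prop) (P : ℕ → State → Prop)
    (hR : ∀ τ υ ρ, R τ υ → R υ ρ → R τ ρ)
    (hRx : ∀ τ k, R τ (τ.setW x k)) (hP : ∀ k τ υ, R τ υ → P k τ → P k υ)
    (hp : ∀ k < m, ∀ τ, τ.Bounded X → Agree (RealRAM.forLoop x y p) σ τ → τ.wvar x = k →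
      R σ τ → Runs W X p τ T fun υ => R τ υ ∧ P k υ) :
    Runs W X (RealRAM.forLoop x y p) σ (m * (T + 7) + 5) (fun τ => R σ τ ∧ ∀ k < m, P k τ) := by
  refine Runs.forLoop hX hσ hm hxy hx hy (fun k τ => R σ τ ∧ ∀ i < k, P i τ)
    ⟨hRx _ _, fun i hi => absurd hi (Nat.not_lt_zero i)⟩ ?_
  intro k hk τ hτ hA hxk ⟨h1, h2⟩
  refine (hp k hk τ hτ hA hxk h1).mono le_rfl fun υ _ _ hυ => ?_
  have h3 : R τ (υ.setW x (k + 1)) := hR _ _ _ hυ.1 (hRx _ _)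
  refine ⟨hR _ _ _ h1 h3, fun i hi => ?_⟩
  rcases Nat.lt_succ_iff_lt_or_eq.1 hi with h | rfl
  · exact hP _ _ _ h3 (h2 i h)
  · exact hP _ _ _ (hRx _ _) hυ.2

end Runs

end RealRAM

/-! ## Distances in weighted graphs -/

namespace WeightedGraph

section Distance

variable {V : Type*} {G H : SimpleGraph V} {w : Sym2 V → ℝ}

@[simp] theorem weight_nil (u : V) : weight w (SimpleGraph.Walk.nil : G.Walk u u) = 0 := by
  simp [weight]

@[simp] theorem weight_cons {u v x : V} (h : G.Adj u v) (p : G.Walk v x) :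
    weight w (.cons h p) = w s(u, v) + weight w p := by
  simp [weight]

@[simp] theorem weight_append {u v x : V} (p : G.Walk u v) (q : G.Walk v x) :
    weight w (p.append q) = weight w p + weight w q := by
  simp [weight]

@[simp] theorem weight_concat {u v x : V} (p : G.Walk u v) (h : G.Adj v x) :
    weight w (p.concat h) = weight w p + w s(v, x) := by
  simp [weight]

theorem weight_mapLe (h : G ≤ H) {u v : V} (p : G.Walk u v) :
    weight w (p.mapLe h) = weight w p := by
  simp [weight]

theorem weight_nonneg (hw : ∀ e ∈ G.edgeSet, 0 ≤ w e) {u v : V} (p : G.Walk u v) :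
    0 ≤ weight w p := by
  refine List.sum_nonneg fun x hx => ?_
  obtain ⟨e, he, rfl⟩ := List.mem_map.1 hx
  exact hw e (p.edges_subset_edgeSet he)

theorem weight_bypass_le [DecidableEq V] (hw : ∀ e ∈ G.edgeSet, 0 ≤ w e) {u v : V}
    (p : G.Walk u v) : weight w p.bypass ≤ weight w p := by
  refine (p.edges_bypass_sublist_edges.map w).sum_le_sum fun x hx => ?_
  obtain ⟨e, he, rfl⟩ := List.mem_map.1 hx
  exact hw e (p.edges_subset_edgeSet he)

/-- There are finitely many paths, and with nonnegative weights cutting the cycles out of a walk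
does not increase its weight. So a lightest path is also a lightest walk. -/
theorem exists_isShortestPath [Fintype V] (hw : ∀ e ∈ G.edgeSet, 0 ≤ w e) {u v : V}
    (h : G.Reachable u v) :
    ∃ p : G.Walk u v, p.IsPath ∧ ∀ q : G.Walk u v, weight w p ≤ weight w q := by
  classical
  have hfin : {p : G.Walk u v | p.IsPath ∧ p.length < Fintype.card V}.Finite := Set.toFinite _
  obtain ⟨p₀⟩ := h
  obtain ⟨p, hp, hmin⟩ := Set.exists_min_image _ (weight w) hfin
    ⟨p₀.bypass, p₀.bypass_isPath, p₀.bypass_isPath.length_lt⟩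
  exact ⟨p, hp.1, fun q => (hmin q.bypass ⟨q.bypass_isPath, q.bypass_isPath.length_lt⟩).trans
    (weight_bypass_le hw q)⟩

open Classical in
/-- The distance from `u` to `v` in the weighted graph `G`, where `⊤` stands for `∞`. -/
noncomputable def wdist (G : SimpleGraph V) (w : Sym2 V → ℝ) (u v : V) : WithTop ℝ :=
  if h : ∃ p : G.Walk u v, p.IsPath ∧ ∀ q : G.Walk u v, weight w p ≤ weight w q then
    (weight w h.choose : ℝ) else ⊤

theorem wdist_eq_top_or (G : SimpleGraph V) (w : Sym2 V → ℝ) (u v : V) :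
    wdist G w u v = ⊤ ∨ ∃ p : G.Walk u v, p.IsPath ∧ wdist G w u v = (weight w p : ℝ) := by
  unfold wdist
  split_ifs with h
  · exact .inr ⟨_, h.choose_spec.1, rfl⟩
  · exact .inl rfl

variable [Fintype V]

theorem wdist_le (hw : ∀ e ∈ G.edgeSet, 0 ≤ w e) {u v : V} (p : G.Walk u v) :
    wdist G w u v ≤ (weight w p : ℝ) := by
  have h := exists_isShortestPath hw p.reachable
  rw [wdist, dif_pos h]
  exact WithTop.coe_le_coe.2 (h.choose_spec.2 p)

/-- The program computes `IsDist` when it computes `wdist`. -/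
theorem isDist_of_wdist (hw : ∀ e ∈ G.edgeSet, 0 ≤ w e) {u v : V} :
    (wdist G w u v = ⊤ → IsDist G w u v none) ∧
      ∀ x : ℝ, wdist G w u v = x → IsDist G w u v (some x) := by
  refine ⟨fun h ⟨p⟩ => ?_, fun x h => ?_⟩
  · have := wdist_le hw p
    rw [h, top_le_iff] at this
    exact WithTop.coe_ne_top this
  · rcases wdist_eq_top_or G w u v with h' | ⟨p, hp, hx⟩
    · rw [h'] at h
      exact absurd h.symm WithTop.coe_ne_top
    · have hx' : weight w p = x := WithTop.coe_injective (hx.symm.trans h)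
      refine ⟨p, ⟨hp, fun q _ => ?_⟩, hx'⟩
      have := wdist_le hw q
      rw [hx] at this
      exact WithTop.coe_le_coe.1 this

omit [Fintype V] in
theorem le_wdist {u v : V} {x : WithTop ℝ} (h : ∀ p : G.Walk u v, x ≤ (weight w p : ℝ)) :
    x ≤ wdist G w u v := by
  rcases wdist_eq_top_or G w u v with h' | ⟨p, -, hx⟩
  · rw [h']; exact le_top
  · rw [hx]; exact h p

omit [Fintype V] in
theorem wdist_nonneg (hw : ∀ e ∈ G.edgeSet, 0 ≤ w e) (u v : V) : 0 ≤ wdist G w u v :=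
  le_wdist fun p => WithTop.coe_le_coe.2 (weight_nonneg hw p)

theorem wdist_self (hw : ∀ e ∈ G.edgeSet, 0 ≤ w e) (u : V) : wdist G w u u = 0 :=
  le_antisymm (by simpa using wdist_le hw (.nil : G.Walk u u)) (wdist_nonneg hw u u)

theorem wdist_triangle (hw : ∀ e ∈ G.edgeSet, 0 ≤ w e) (u v x : V) :
    wdist G w u x ≤ wdist G w u v + wdist G w v x := by
  rcases wdist_eq_top_or G w u v with h | ⟨p, -, hp⟩
  · simp [h]
  rcases wdist_eq_top_or G w v x with h | ⟨q, -, hq⟩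
  · simp [h]
  rw [hp, hq, ← WithTop.coe_add, ← weight_append]
  exact wdist_le hw _

theorem wdist_le_of_adj (hw : ∀ e ∈ G.edgeSet, 0 ≤ w e) {u v : V} (h : G.Adj u v) :
    wdist G w u v ≤ (w s(u, v) : ℝ) := by
  simpa using wdist_le hw (.cons h .nil : G.Walk u v)

theorem wdist_anti (hw : ∀ e ∈ H.edgeSet, 0 ≤ w e) (h : G ≤ H) (u v : V) :
    wdist H w u v ≤ wdist G w u v :=
  le_wdist fun p => by
    rw [← weight_mapLe h]
    exact wdist_le hw _

omit [Fintype V] in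
/-- A potential that is consistent with the edges bounds the distance from below. -/
theorem le_wdist_of_potential {f : V → WithTop ℝ} {v : V} (h0 : f v ≤ 0)
    (hf : ∀ a b, G.Adj a b → f a ≤ (w s(a, b) : ℝ) + f b) (u : V) : f u ≤ wdist G w u v := by
  refine le_wdist fun p => ?_
  induction p with
  | nil => simpa using h0
  | cons h p ih =>
    rw [weight_cons, WithTop.coe_add]
    exact (hf _ _ h).trans (add_le_add le_rfl (ih h0))

/-- The distances after the insertion of an edge. -/
theorem min_le_wdist_sup_edge {a b : V}
    (hw : ∀ e ∈ (G ⊔ SimpleGraph.edge a b).edgeSet, 0 ≤ w e) (hab : a ≠ b) (u v : V) :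
    min (wdist G w u v) (min (wdist G w u a + wdist G w b v + (w s(a, b) : ℝ))
      (wdist G w u b + wdist G w a v + (w s(a, b) : ℝ))) ≤
    wdist (G ⊔ SimpleGraph.edge a b) w u v := by
  have hG : ∀ e ∈ G.edgeSet, 0 ≤ w e := fun e he =>
    hw e (SimpleGraph.edgeSet_mono le_sup_left he)
  have hc : (0 : WithTop ℝ) ≤ (w s(a, b) : ℝ) := by
    refine WithTop.coe_le_coe.2 (hw _ ?_)
    rw [SimpleGraph.mem_edgeSet, SimpleGraph.sup_adj]
    exact .inr ((SimpleGraph.edge_adj _ _ _ _).2 ⟨.inl ⟨rfl, rfl⟩, hab⟩)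
  set c : WithTop ℝ := ((w s(a, b) : ℝ) : WithTop ℝ) with hcdef
  have nn := wdist_nonneg hG
  -- The left-hand side, as a function of the starting vertex, is a potential that is consistent
  -- with every edge. This disposes at once of walks that use the new edge several times.
  refine le_wdist_of_potential (f := fun x => min (wdist G w x v)
    (min (wdist G w x a + wdist G w b v + c) (wdist G w x b + wdist G w a v + c)))
    ((min_le_left _ _).trans (wdist_self hG v).le) (fun x y hxy => ?_) u
  have tri : ∀ z, G.Adj x y → wdist G w x z ≤ (w s(x, y) : ℝ) + wdist G w y z := fun z h =>
    (wdist_triangle hG x y z).trans (add_le_add (wdist_le_of_adj hG h) le_rfl)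
  -- Consistency along the new edge, traversed from `x = a` to `y = b`, for each of the three terms
  -- that may attain the minimum at `y`. A term that crosses the edge again in the same direction
  -- only adds nonnegative detours. One that crosses back returns to `x`, where the plain distance
  -- is no larger. The other orientation is the same claim with `a` and `b` exchanged.
  have new : ∀ a b : V, w s(x, y) = w s(a, b) → x = a → y = b → c = ((w s(a, b) : ℝ) : WithTop ℝ) →
      ∀ m, (m = wdist G w y v ∨ m = wdist G w y a + wdist G w b v + c ∨
        m = wdist G w y b + wdist G w a v + c) →
      min (wdist G w x v) (wdist G w x a + wdist G w b v + c) ≤ (w s(x, y) : ℝ) + m := by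
    rintro a b hw' rfl rfl hc' m (rfl | rfl | rfl)
    · refine (min_le_right _ _).trans ?_
      rw [wdist_self hG, zero_add, hc', add_comm]
    · refine (min_le_right _ _).trans ?_
      rw [wdist_self hG, zero_add, ← hc']
      calc wdist G w y v + c ≤ (c + wdist G w y x) + (wdist G w y v + c) :=
            le_add_of_nonneg_left (add_nonneg hc (nn _ _))
        _ = _ := by ac_rfl
    · refine (min_le_left _ _).trans ?_
      rw [wdist_self hG, zero_add, ← hc']
      calc wdist G w x v ≤ (c + c) + wdist G w x v := le_add_of_nonneg_left (add_nonneg hc hc)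
        _ = _ := by ac_rfl
  rw [SimpleGraph.sup_adj, SimpleGraph.edge_adj] at hxy
  rcases hxy with hxy | ⟨⟨rfl, rfl⟩ | ⟨rfl, rfl⟩, -⟩
  · rcases min_choice (wdist G w y v) (min (wdist G w y a + wdist G w b v + c)
      (wdist G w y b + wdist G w a v + c)) with h | h
    · rw [h]
      exact (min_le_left _ _).trans (tri v hxy)
    · rw [h]
      refine (min_le_right _ _).trans ?_
      rcases min_choice (wdist G w y a + wdist G w b v + c)
        (wdist G w y b + wdist G w a v + c) with h | h
      · rw [h]
        refine (min_le_left _ _).trans ?_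
        rw [← add_assoc, ← add_assoc]
        exact add_le_add (add_le_add (tri a hxy) le_rfl) le_rfl
      · rw [h]
        refine (min_le_right _ _).trans ?_
        rw [← add_assoc, ← add_assoc]
        exact add_le_add (add_le_add (tri b hxy) le_rfl) le_rfl
  · refine le_trans (min_le_min le_rfl (min_le_left _ _)) (new x y rfl rfl rfl rfl _ ?_)
    rcases min_choice (wdist G w y v) (min (wdist G w y x + wdist G w y v + c)
      (wdist G w y y + wdist G w x v + c)) with h | h
    · exact .inl h
    · rw [h]
      rcases min_choice (wdist G w y x + wdist G w y v + c)
        (wdist G w y y + wdist G w x v + c) with h | h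
      · exact .inr (.inl h)
      · exact .inr (.inr h)
  · refine le_trans (min_le_min le_rfl (min_le_right _ _))
      (new x y rfl rfl rfl (by rw [hcdef, Sym2.eq_swap]) _ ?_)
    rcases min_choice (wdist G w y v) (min (wdist G w y y + wdist G w x v + c)
      (wdist G w y x + wdist G w y v + c)) with h | h
    · exact .inl h
    · rw [h]
      rcases min_choice (wdist G w y y + wdist G w x v + c)
        (wdist G w y x + wdist G w y v + c) with h | h
      · exact .inr (.inr h)
      · exact .inr (.inl h)

theorem wdist_sup_edge_le {a b : V}
    (hw : ∀ e ∈ (G ⊔ SimpleGraph.edge a b).edgeSet, 0 ≤ w e) (hab : a ≠ b) (u v : V) :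
    wdist (G ⊔ SimpleGraph.edge a b) w u v ≤ wdist (G ⊔ SimpleGraph.edge a b) w u a +
      wdist (G ⊔ SimpleGraph.edge a b) w b v + (w s(a, b) : ℝ) := by
  have h : (G ⊔ SimpleGraph.edge a b).Adj a b := by
    rw [SimpleGraph.sup_adj]
    exact .inr ((SimpleGraph.edge_adj _ _ _ _).2 ⟨.inl ⟨rfl, rfl⟩, hab⟩)
  refine (wdist_triangle hw u a v).trans ?_
  rw [add_assoc, add_comm (wdist _ w b v)]
  exact add_le_add le_rfl ((wdist_triangle hw a b v).trans
    (add_le_add (wdist_le_of_adj hw h) le_rfl))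

/-! ### Distances by squaring -/

/-- `x` is at most the weight of every walk from `u` to `v` with at most `k` edges. -/
def BelowWalks (G : SimpleGraph V) (w : Sym2 V → ℝ) (k : ℕ) (u v : V) (x : WithTop ℝ) : Prop :=
  ∀ p : G.Walk u v, p.length ≤ k → x ≤ (weight w p : ℝ)

omit [Fintype V] in
-- Cut the walk at its `k`-th vertex. If the walk is shorter, that vertex is its end and the second
-- piece is empty.
theorem BelowWalks.double {k : ℕ} {b : V → V → WithTop ℝ}
    (hb : ∀ u v, BelowWalks G w k u v (b u v)) {u v : V} {x : WithTop ℝ}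
    (hx : ∀ y, x ≤ b u y + b y v) : BelowWalks G w (2 * k) u v x := by
  intro p hp
  have h1 := hb _ _ (p.take k) (by simp)
  have h2 := hb _ _ (p.drop k) (by simp; omega)
  calc x ≤ _ := hx (p.getVert k)
    _ ≤ _ := add_le_add h1 h2
    _ = _ := by rw [← WithTop.coe_add, ← weight_append, SimpleGraph.Walk.append_take_drop_eq]

/-- The distance is attained by a path, and a path has fewer edges than there are vertices. -/
theorem BelowWalks.le_wdist {k : ℕ} (hk : Fintype.card V ≤ k) {u v : V} {x : WithTop ℝ}
    (hx : BelowWalks G w k u v x) : x ≤ wdist G w u v := by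
  rcases wdist_eq_top_or G w u v with h | ⟨p, hp, h⟩
  · rw [h]; exact le_top
  · rw [h]
    exact hx p (hp.length_lt.le.trans hk)

omit [Fintype V] in
theorem belowWalks_one {u v : V} {x : WithTop ℝ} (h0 : u = v → x ≤ 0)
    (h1 : G.Adj u v → x ≤ (w s(u, v) : ℝ)) : BelowWalks G w 1 u v x := by
  intro p hp
  cases p with
  | nil => simpa using h0 rfl
  | cons h q =>
    cases q with
    | nil => simpa using h1 h
    | cons h' q => simp at hp

/-! ### Distances by the number of edges -/

open Classical in
/-- The least weight of a walk from `u` to `t` with at most `h` edges. -/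
noncomputable def hopDist (G : SimpleGraph V) (w : Sym2 V → ℝ) (t : V) : ℕ → V → WithTop ℝ
  | 0, u => if u = t then 0 else ⊤
  | h + 1, u => hopDist G w t h u ⊓
      Finset.univ.inf fun v => if G.Adj u v then (w s(u, v) : ℝ) + hopDist G w t h v else ⊤

theorem hopDist_succ_le (t : V) (h : ℕ) (u : V) :
    hopDist G w t (h + 1) u ≤ hopDist G w t h u := inf_le_left

theorem hopDist_succ_le_of_adj (t : V) (h : ℕ) {u v : V} (huv : G.Adj u v) :
    hopDist G w t (h + 1) u ≤ (w s(u, v) : ℝ) + hopDist G w t h v := by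
  refine inf_le_right.trans ((Finset.inf_le (Finset.mem_univ v)).trans ?_)
  simp [huv]

/-- If allowing one more edge is a strict gain, the minimum in the recursion is attained at a
neighbour and not at the old value. This neighbour is the next vertex of the path. -/
theorem exists_adj_of_hopDist_lt {t : V} {h : ℕ} {u : V}
    (hu : hopDist G w t (h + 1) u < hopDist G w t h u) :
    ∃ v, G.Adj u v ∧ (w s(u, v) : ℝ) + hopDist G w t h v = hopDist G w t (h + 1) u := by
  classical
  obtain ⟨v, -, hv⟩ := Finset.exists_mem_eq_inf Finset.univ ⟨u, Finset.mem_univ u⟩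
    (fun v => if G.Adj u v then ((w s(u, v) : ℝ) + hopDist G w t h v : WithTop ℝ) else ⊤)
  have e : hopDist G w t (h + 1) u = hopDist G w t h u ⊓ Finset.univ.inf (fun v =>
      if G.Adj u v then ((w s(u, v) : ℝ) + hopDist G w t h v : WithTop ℝ) else ⊤) := by
    rw [hopDist]
  rw [hv] at e
  have e' : hopDist G w t (h + 1) u =
      if G.Adj u v then ((w s(u, v) : ℝ) + hopDist G w t h v : WithTop ℝ) else ⊤ := by
    rcases min_choice (hopDist G w t h u)
      (if G.Adj u v then ((w s(u, v) : ℝ) + hopDist G w t h v : WithTop ℝ) else ⊤) with h' | h'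
    · exact absurd (e.trans h') hu.ne
    · exact e.trans h'
  by_cases huv : G.Adj u v
  · exact ⟨v, huv, by rw [e', if_pos huv]⟩
  · rw [if_neg huv] at e'
    exact absurd (e' ▸ hu) (not_lt.2 le_top)

theorem hopDist_le {t u : V} (p : G.Walk u t) {h : ℕ} (hp : p.length ≤ h) :
    hopDist G w t h u ≤ (weight w p : ℝ) := by
  induction h generalizing u with
  | zero =>
    cases p with
    | nil => simp [hopDist]
    | cons _ _ => simp at hp
  | succ h ih =>
    cases p with
    | nil => exact (hopDist_succ_le _ _ _).trans (ih .nil (by simp))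
    | cons huv q =>
      rw [weight_cons, WithTop.coe_add]
      exact (hopDist_succ_le_of_adj _ _ huv).trans
        (add_le_add le_rfl (ih q (by simpa using hp)))

/-- A path from `s` that can be extended to a walk to `t` of weight `hopDist G w t m s` with at most
`h` further edges, and that does not meet any such extension again. -/
structure IsPartialPath (G : SimpleGraph V) (w : Sym2 V → ℝ) (t : V) (m h : ℕ) {s u : V}
    (q : G.Walk s u) : Prop where
  isPath : q.IsPath
  weight_add : (weight w q : ℝ) + hopDist G w t h u = hopDist G w t m s
  lt : ∀ x ∈ q.support, x ≠ u → hopDist G w t h u < hopDist G w t h x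

theorem IsPartialPath.nil (t : V) (m : ℕ) (s : V) :
    IsPartialPath G w t m m (.nil : G.Walk s s) :=
  ⟨by simp, by simp, by simp⟩

theorem IsPartialPath.stay {t s u : V} {m h : ℕ} {q : G.Walk s u}
    (hq : IsPartialPath G w t m (h + 1) q) (hu : hopDist G w t h u ≤ hopDist G w t (h + 1) u) :
    IsPartialPath G w t m h q := by
  have e := le_antisymm hu (hopDist_succ_le t h u)
  refine ⟨hq.isPath, e ▸ hq.weight_add, fun x hx hxu => ?_⟩
  rw [e]
  exact (hq.lt x hx hxu).trans_le (hopDist_succ_le t h x)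

/-- With edges of weight zero a decrease of the remaining distance would not rule out a return to an
earlier vertex. The number of edges left breaks the tie: the new end has value at most `hopDist G w
t (h + 1) u`, which is strictly below the value with `h` edges at `u` by `hu` and at every earlier
vertex by `lt`. So the new end is not on `q`. -/
theorem IsPartialPath.move (hw : ∀ e ∈ G.edgeSet, 0 ≤ w e) {t s u v : V} {m h : ℕ}
    {q : G.Walk s u} (hq : IsPartialPath G w t m (h + 1) q)
    (hu : hopDist G w t (h + 1) u < hopDist G w t h u) (huv : G.Adj u v)
    (hv : (w s(u, v) : ℝ) + hopDist G w t h v = hopDist G w t (h + 1) u) :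
    IsPartialPath G w t m h (q.concat huv) := by
  have hvu : hopDist G w t h v ≤ hopDist G w t (h + 1) u := by
    rw [← hv]
    exact le_add_of_nonneg_left (WithTop.coe_le_coe.2 (hw _ huv))
  have lt : ∀ x ∈ q.support, hopDist G w t h v < hopDist G w t h x := by
    intro x hx
    by_cases hxu : x = u
    · exact hxu ▸ hvu.trans_lt hu
    · exact hvu.trans_lt ((hq.lt x hx hxu).trans_le (hopDist_succ_le t h x))
  refine ⟨hq.isPath.concat (fun h' => (lt v h').ne rfl) huv, ?_, fun x hx hxv => ?_⟩
  · rw [weight_concat, WithTop.coe_add, add_assoc, hv, hq.weight_add]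
  · rw [SimpleGraph.Walk.support_concat, List.mem_append,
      List.mem_singleton] at hx
    exact lt x (hx.resolve_right hxv)

/-- With no edges left, `hopDist` is infinite except at `t`. Since the total is finite, the end is
`t`, and the total is at most the weight of any path because paths have at most `m` edges. -/
theorem IsPartialPath.isShortestPath {t s u : V} {m : ℕ} (hm : Fintype.card V ≤ m)
    {q : G.Walk s u} (hq : IsPartialPath G w t m 0 q) (hst : G.Reachable s t) :
    ∃ h : u = t, IsShortestPath w (q.copy rfl h) := by
  classical
  obtain ⟨p⟩ := hst
  have hp : ∀ p : G.Walk s t, p.IsPath → hopDist G w t m s ≤ (weight w p : ℝ) := fun p hp =>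
    hopDist_le p (hp.length_lt.le.trans hm)
  have hut : u = t := by
    by_contra hne
    have e := hq.weight_add
    have := hp p.bypass p.bypass_isPath
    rw [← e] at this
    simp [hopDist, hne] at this
  subst hut
  refine ⟨rfl, hq.isPath, fun p' hp' => ?_⟩
  have := hp p' hp'
  rw [← hq.weight_add] at this
  simpa [hopDist] using this

end Distance

/-! ### A path whose edges are switched on and off -/

section Switch

variable {V : Type*}

/-- The graph `G` without those of the first `L` edges of the vertex sequence `P` that are not in
`Y`. -/
def switch (G : SimpleGraph V) (P : ℕ → V) (L : ℕ) (Y : Set ℕ) : SimpleGraph V :=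
  G.deleteEdges {e | ∃ i < L, e = s(P i, P (i + 1))} ⊔
    SimpleGraph.fromEdgeSet {e | ∃ i < L, i ∈ Y ∧ e = s(P i, P (i + 1))}

variable {G : SimpleGraph V} {P : ℕ → V} {L : ℕ}

theorem switch_le (hP : ∀ i < L, G.Adj (P i) (P (i + 1))) (Y : Set ℕ) : switch G P L Y ≤ G := by
  refine sup_le (SimpleGraph.deleteEdges_le _) ?_
  intro a b h
  rw [SimpleGraph.fromEdgeSet_adj] at h
  obtain ⟨⟨i, hi, -, he⟩, -⟩ := h
  rw [← SimpleGraph.mem_edgeSet, he]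
  exact hP i hi

/-- Switching on one more position is an edge insertion, to which the update formula for distances
applies. -/
theorem switch_insert {i : ℕ} (hi : i < L) (Y : Set ℕ) :
    switch G P L (insert i Y) = switch G P L Y ⊔ SimpleGraph.edge (P i) (P (i + 1)) := by
  rw [switch, switch, sup_assoc, SimpleGraph.edge, ← SimpleGraph.fromEdgeSet_union]
  congr 2
  ext e
  simp only [Set.mem_ofPred_eq, Set.mem_insert_iff, Set.mem_union, Set.mem_singleton_iff]
  constructor
  · rintro ⟨j, hj, rfl | hY, rfl⟩
    exacts [.inr rfl, .inl ⟨j, hj, hY, rfl⟩]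
  · rintro (⟨j, hj, hY, rfl⟩ | rfl)
    exacts [⟨j, hj, .inr hY, rfl⟩, ⟨i, hi, .inl rfl, rfl⟩]

theorem switch_congr {Y Z : Set ℕ} (h : ∀ i < L, i ∈ Y ↔ i ∈ Z) :
    switch G P L Y = switch G P L Z := by
  have : {e | ∃ i < L, i ∈ Y ∧ e = s(P i, P (i + 1))} =
      {e | ∃ i < L, i ∈ Z ∧ e = s(P i, P (i + 1))} := by
    ext e
    exact exists_congr fun i => and_congr_right fun hi => and_congr_left fun _ => h i hi
  rw [switch, switch, this]

/-- Different positions on a path carry different edges, so switching on all positions outside `Z`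
restores no edge at a position in `Z`. -/
theorem switch_eq_deleteEdges {s t : V} (p : G.Walk s t) (hp : p.IsPath)
    (hP : ∀ i ≤ p.length, P i = p.getVert i) {Z : Set ℕ} (hZ : ∀ i ∈ Z, i < p.length) :
    switch G P p.length Zᶜ = G.deleteEdges (stepEdge p '' Z) := by
  have hstep : ∀ i < p.length, s(P i, P (i + 1)) = stepEdge p i := fun i hi => by
    rw [hP i hi.le, hP (i + 1) hi, stepEdge]
  have inj : ∀ i < p.length, ∀ j < p.length, stepEdge p i = stepEdge p j → i = j := by
    intro i hi j hj h
    have vi := hp.getVert_injOn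
    rw [stepEdge, stepEdge, Sym2.eq_iff] at h
    rcases h with ⟨h, -⟩ | ⟨h1, h2⟩
    · exact vi (by simpa using hi.le) (by simpa using hj.le) h
    -- Equal edges read in opposite directions would give `i = j + 1` and `i + 1 = j`.
    · have a1 := vi (by simpa using hi.le) (by simpa using hj) h1
      have a2 := vi (by simpa using hi) (by simpa using hj.le) h2
      omega
  ext a b
  simp only [switch, SimpleGraph.sup_adj, SimpleGraph.deleteEdges_adj, Set.mem_ofPred_eq,
    SimpleGraph.fromEdgeSet_adj, Set.mem_image, Set.mem_compl_iff]
  constructor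
  · rintro (⟨hab, h⟩ | ⟨⟨i, hi, hiZ, he⟩, hab⟩)
    · refine ⟨hab, ?_⟩
      rintro ⟨i, hi, he⟩
      exact h ⟨i, hZ i hi, by rw [hstep i (hZ i hi), he]⟩
    · rw [hstep i hi] at he
      refine ⟨?_, ?_⟩
      · rw [← SimpleGraph.mem_edgeSet, he]
        exact p.adj_getVert_succ hi
      · rintro ⟨j, hj, he'⟩
        exact hiZ (inj j (hZ j hj) i hi (he'.trans he) ▸ hj)
  · rintro ⟨hab, h⟩
    by_cases h' : ∃ i < p.length, s(a, b) = s(P i, P (i + 1))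
    · obtain ⟨i, hi, he⟩ := h'
      refine .inr ⟨⟨i, hi, fun hiZ => h ⟨i, hiZ, ?_⟩, he⟩, hab.ne⟩
      rw [he, hstep i hi]
    · exact .inl ⟨hab, h'⟩

end Switch

end WeightedGraph

/-! ## The program -/

/-! ### Extended reals in memory, as a flag word and a real. -/

namespace RealRAM

/-- Addresses depend on words only, so an index keeps its value between writing the real and writing
the flag of a cell. -/
theorem WExpr.den_congr {σ τ : State} (hw : τ.wvar = σ.wvar) (ha : τ.warr = σ.warr) (e : WExpr) :
    e.den τ = e.den σ := by
  induction e <;> simp_all [WExpr.den]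

/-- The extended real stored at index `m` of the arrays `a`: the word is `0` for `∞`, and otherwise
the value is the real. -/
noncomputable def State.val (σ : State) (a m : ℕ) : WithTop ℝ :=
  if σ.warr a m = 0 then ⊤ else (σ.rarr a m : ℝ)

/-- Copy an extended real. -/
def copyCell (a : ℕ) (i : WExpr) (b : ℕ) (j : WExpr) : Cmd :=
  .seq (.putR a i (.get b j)) (.putW a i (.get b j))

/-- Replace an extended real by its minimum with `r`, unless `f` is `0`. -/
def relax (a : ℕ) (i f : WExpr) (r : RExpr) : Cmd :=
  .ite (.weq f (.lit 0)) .skip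
    (.ite (.weq (.get a i) (.lit 0)) (.seq (.putR a i r) (.putW a i (.lit 1)))
      (.ite (.rle (.get a i) r) .skip (.seq (.putR a i r) (.putW a i (.lit 1)))))

namespace Runs

variable {W X : ℕ}

theorem copyCell (hX : Wide W X) {σ : State} (hσ : σ.Bounded X) {a b : ℕ} {i j : WExpr}
    (hi : i.good = true) (hj : j.good = true) {T : ℕ} (hT : (RealRAM.copyCell a i b j).cost ≤ T) :
    Runs W X (RealRAM.copyCell a i b j) σ T fun τ => ∀ c m,
      τ.val c m = if c = a ∧ m = i.den σ then σ.val b (j.den σ) else σ.val c m := by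
  refine of_loopless hX hσ (by simp [RealRAM.copyCell, Cmd.good, hi, hj, RExpr.good, WExpr.good]) hT
    ?_ fun c m => ?_
  · simp only [RealRAM.copyCell, Cmd.Safe, Cmd.sem, WExpr.den, State.putR_warr, true_and]
    exact hσ.2 _ _
  · have hi' : i.den (σ.putR a (i.den σ) (σ.rarr b (j.den σ))) = i.den σ :=
      WExpr.den_congr (σ := σ) (τ := σ.putR _ _ _) rfl rfl i
    have hj' : j.den (σ.putR a (i.den σ) (σ.rarr b (j.den σ))) = j.den σ :=
      WExpr.den_congr (σ := σ) (τ := σ.putR _ _ _) rfl rfl j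
    simp only [RealRAM.copyCell, Cmd.sem, WExpr.den, RExpr.den, State.val, State.putW_warr,
      State.putR_warr, State.putR_rarr, State.putW_rarr, hi', hj']
    split_ifs <;> rfl

open Classical in
theorem relax (hX : Wide W X) {σ : State} (hσ : σ.Bounded X) {a : ℕ} {i f : WExpr} {r : RExpr}
    (hi : i.good = true) (hf : f.good = true) (hr : r.good = true) {T : ℕ}
    (hT : (RealRAM.relax a i f r).cost ≤ T) :
    Runs W X (RealRAM.relax a i f r) σ T fun τ => ∀ c m,
      τ.val c m = if c = a ∧ m = i.den σ then
        min (σ.val c m) (if f.den σ = 0 then ⊤ else (r.den σ : ℝ)) else σ.val c m := by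
  have h1 : 1 ≤ X := le_trans (by norm_num) hX.1
  refine of_loopless hX hσ (by simp [RealRAM.relax, Cmd.good, hi, hf, hr, RExpr.good, WExpr.good,
    Cond.good]) hT ?_ fun c m => ?_
  · simp only [RealRAM.relax, Cmd.Safe, WExpr.den]
    simp [h1]
  · have hi' : i.den (σ.putR a (i.den σ) (r.den σ)) = i.den σ :=
      WExpr.den_congr (σ := σ) (τ := σ.putR _ _ _) rfl rfl i
    unfold RealRAM.relax
    by_cases hf0 : f.den σ = 0
    · rw [Cmd.sem_ite_pos (show Cond.den σ (.weq f (.lit 0)) from hf0)]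
      simp [hf0, Cmd.sem]
    rw [Cmd.sem_ite_neg (show ¬ Cond.den σ (.weq f (.lit 0)) from hf0), if_neg hf0]
    have new : (Cmd.sem (.seq (.putR a i r) (.putW a i (.lit 1))) σ).val c m =
        if c = a ∧ m = i.den σ then (r.den σ : WithTop ℝ) else σ.val c m := by
      simp only [Cmd.sem, WExpr.den, State.val, State.putW_warr, State.putR_warr, State.putR_rarr,
        State.putW_rarr, hi']
      split_ifs <;> simp_all
    by_cases h0 : σ.warr a (i.den σ) = 0
    · rw [Cmd.sem_ite_pos (show Cond.den σ (.weq (.get a i) (.lit 0)) from h0), new]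
      split_ifs with h
      · rw [h.1, h.2, State.val, if_pos h0, min_eq_right le_top]
      · rfl
    rw [Cmd.sem_ite_neg (show ¬ Cond.den σ (.weq (.get a i) (.lit 0)) from h0)]
    by_cases hle : σ.rarr a (i.den σ) ≤ r.den σ
    · rw [Cmd.sem_ite_pos (show Cond.den σ (.rle (.get a i) r) from hle)]
      change σ.val c m = _
      split_ifs with h
      · rw [h.1, h.2, State.val, if_neg h0, min_eq_left (WithTop.coe_le_coe.2 hle)]
      · rfl
    · rw [Cmd.sem_ite_neg (show ¬ Cond.den σ (.rle (.get a i) r) from hle), new]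
      split_ifs with h
      · rw [h.1, h.2, State.val, if_neg h0, min_eq_right (WithTop.coe_le_coe.2 (not_le.1 hle).le)]
      · rfl

end Runs

/-- The product of two flags vanishes exactly when a summand is infinite, so it serves `relax` as
the flag of the sum. -/
theorem State.val_add (σ : State) (a m b k : ℕ) :
    (if σ.warr a m * σ.warr b k = 0 then ⊤ else
      ((σ.rarr a m + σ.rarr b k : ℝ) : WithTop ℝ)) = σ.val a m + σ.val b k := by
  unfold State.val
  by_cases h1 : σ.warr a m = 0 <;> by_cases h2 : σ.warr b k = 0 <;> simp [h1, h2]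

theorem State.val_add_add (σ : State) (a m b k : ℕ) (c : ℝ) :
    (if σ.warr a m * σ.warr b k = 0 then ⊤ else
      ((σ.rarr a m + σ.rarr b k + c : ℝ) : WithTop ℝ)) = σ.val a m + σ.val b k + (c : ℝ) := by
  unfold State.val
  by_cases h1 : σ.warr a m = 0 <;> by_cases h2 : σ.warr b k = 0 <;> simp [h1, h2]

end RealRAM

/-! ### The subprograms of the algorithm. -/

namespace WeightedGraph

open RealRAM

/-- The expression `i * n + j`. -/
def pairE (i j : WExpr) : WExpr := .add (.mul i (.var 0)) j

/-- The index of the entry `(u, v)` of the matrix with the name `(r, x, y, z)`. -/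
def key (N r x y z u v : ℕ) : ℕ := ((((r * N + x) * N + y) * N + z) * N + u) * N + v

/-- The expression for the index `key`, where all arguments are variables. -/
def keyE (r x y z u v : ℕ) : WExpr :=
  let app (e : WExpr) (x : ℕ) : WExpr := .add (.mul e (.var 4)) (.var x)
  app (app (app (app (app (.var r) x) y) z) u) v

/-- Set variable `4` to a power of `2` that is at least `n`, and variable `5` to the exponent. -/
def sizeCmd : Cmd :=
  .seq (.setW 4 (.lit 1)) (forLoop 6 0 (.ite (.wlt (.var 4) (.var 0))
    (.seq (.setW 4 (.add (.var 4) (.var 4))) (.setW 5 (.add (.var 5) (.lit 1)))) .skip))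

/-- Compute the distances to `t` by the number of edges, in the arrays `4`. -/
def hopCmd : Cmd :=
  .seq (.putW 4 (.var 2) (.lit 1)) (forLoop 6 0 (forLoop 7 0
    (.seq (copyCell 4 (pairE (.add (.var 6) (.lit 1)) (.var 7)) 4 (pairE (.var 6) (.var 7)))
      (forLoop 8 0 (relax 4 (pairE (.add (.var 6) (.lit 1)) (.var 7))
        (.mul (.get 0 (pairE (.var 7) (.var 8))) (.get 4 (pairE (.var 6) (.var 8))))
        (.add (.get 0 (pairE (.var 7) (.var 8))) (.get 4 (pairE (.var 6) (.var 8)))))))))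

/-- Find the next vertex of the path. -/
def nextCmd : Cmd :=
  .seq (.setW 12 (.var 11)) (.seq (forLoop 8 0
    (.ite (.weq (.mul (.get 0 (pairE (.var 11) (.var 8))) (.get 4 (pairE (.var 10) (.var 8))))
      (.lit 0)) .skip
      (.ite (.rle
        (.add (.get 0 (pairE (.var 11) (.var 8))) (.get 4 (pairE (.var 10) (.var 8))))
        (.get 4 (pairE (.add (.var 10) (.lit 1)) (.var 11)))) (.setW 12 (.var 8)) .skip)))
    (.ite (.weq (.get 4 (pairE (.var 10) (.var 11))) (.lit 0)) .skip
      (.ite (.rle (.get 4 (pairE (.var 10) (.var 11)))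
        (.get 4 (pairE (.add (.var 10) (.lit 1)) (.var 11)))) (.setW 12 (.var 11)) .skip)))

/-- Write the vertex sequence of a shortest path into array `1` and its length into variable `3`. -/
def pathCmd : Cmd :=
  .seq (.seq (.setW 11 (.var 1)) (.seq (.putW 1 (.lit 0) (.var 1)) (.setW 10 (.var 0))))
    (forLoop 6 0 (.seq (.setW 10 (.sub (.var 10) (.lit 1))) (.seq nextCmd
      (.ite (.weq (.var 12) (.var 11)) .skip
        (.seq (.setW 3 (.add (.var 3) (.lit 1))) (.seq (.putW 1 (.var 3) (.var 12))
          (.setW 11 (.var 12))))))))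

/-- Remove the edges of the path from the adjacency matrix. -/
def cutCmd : Cmd :=
  forLoop 6 3 (.seq
    (.putW 0 (pairE (.get 1 (.var 6)) (.get 1 (.add (.var 6) (.lit 1)))) (.lit 0))
    (.putW 0 (pairE (.get 1 (.add (.var 6) (.lit 1))) (.get 1 (.var 6))) (.lit 0)))

/-- The distances by at most one edge, in the arrays `3`. -/
def edgeCmd : Cmd :=
  forLoop 7 0 (forLoop 8 0 (.ite (.weq (.var 7) (.var 8))
    (.seq (.putR 3 (keyE 13 14 15 16 7 8) .zero) (.putW 3 (keyE 13 14 15 16 7 8) (.lit 1)))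
    (copyCell 3 (keyE 13 14 15 16 7 8) 0 (pairE (.var 7) (.var 8)))))

/-- Compute all distances by squaring. -/
def squareCmd : Cmd :=
  forLoop 6 5 (forLoop 7 0 (forLoop 8 0 (forLoop 9 0
    (relax 3 (keyE 13 14 15 16 7 8)
      (.mul (.get 3 (keyE 13 14 15 16 7 9)) (.get 3 (keyE 13 14 15 16 9 8)))
      (.add (.get 3 (keyE 13 14 15 16 7 9)) (.get 3 (keyE 13 14 15 16 9 8)))))))

/-- List the positions (array `6`) and the vertices (array `5`) that belong to a box. -/
def listCmd : Cmd :=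
  .seq (forLoop 7 24 (.seq
      (.ite (.wlt (.var 7) (.var 21)) (.setW 26 (.add (.mul (.var 18) (.var 21)) (.var 7)))
        (.ite (.wlt (.var 7) (.add (.var 21) (.var 21)))
          (.setW 26 (.add (.mul (.var 19) (.var 21)) (.sub (.var 7) (.var 21))))
          (.setW 26 (.add (.mul (.var 20) (.var 21))
            (.sub (.var 7) (.add (.var 21) (.var 21)))))))
      (.seq (.putW 6 (.var 7) (.var 26))
        (.seq (.putW 5 (.add (.var 7) (.var 7)) (.get 1 (.var 26)))
          (.putW 5 (.add (.add (.var 7) (.var 7)) (.lit 1)) (.get 1 (.add (.var 26) (.lit 1))))))))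
    (.seq (.putW 5 (.add (.var 24) (.var 24)) (.var 1))
      (.putW 5 (.add (.add (.var 24) (.var 24)) (.lit 1)) (.var 2)))

/-- Load the terminals with the numbers in the variables `7` and `8`. -/
def loadCmd : Cmd := .seq (.setW 27 (.get 5 (.var 7))) (.setW 28 (.get 5 (.var 8)))

/-- Copy the distances of the terminals from the parent of a box. -/
def inheritCmd : Cmd :=
  forLoop 7 25 (forLoop 8 25 (.seq loadCmd
    (copyCell 3 (keyE 13 14 15 16 27 28) 3 (keyE 17 18 19 20 27 28))))

/-- Update the distances of the terminals after the insertion of the edge in the variables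
`30` and `31`. -/
def insertCmd : Cmd :=
  forLoop 7 25 (forLoop 8 25 (.seq loadCmd (.seq
    (relax 3 (keyE 13 14 15 16 27 28)
      (.mul (.get 3 (keyE 13 14 15 16 27 30)) (.get 3 (keyE 13 14 15 16 31 28)))
      (.add (.add (.get 3 (keyE 13 14 15 16 27 30)) (.get 3 (keyE 13 14 15 16 31 28))) (.var 1)))
    (relax 3 (keyE 13 14 15 16 27 28)
      (.mul (.get 3 (keyE 13 14 15 16 27 31)) (.get 3 (keyE 13 14 15 16 30 28)))
      (.add (.add (.get 3 (keyE 13 14 15 16 27 31)) (.get 3 (keyE 13 14 15 16 30 28)))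
        (.var 1))))))

/-- Insert the edges that belong to the parent of a box, but not to the box. -/
def growCmd : Cmd :=
  forLoop 9 24 (.seq (.setW 26 (.get 6 (.var 9)))
    (.ite (.wlt (.var 26) (.var 3))
      (.ite (.weq (.div (.var 26) (.var 23)) (.var 14)) .skip
        (.ite (.weq (.div (.var 26) (.var 23)) (.var 15)) .skip
          (.ite (.weq (.div (.var 26) (.var 23)) (.var 16)) .skip
            (.seq (.seq (.setW 30 (.get 1 (.var 26)))
              (.seq (.setW 31 (.get 1 (.add (.var 26) (.lit 1))))
                (.setR 1 (.get 0 (pairE (.var 30) (.var 31)))))) insertCmd))))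
      .skip))

/-- Compute the distances of the terminals of a box. -/
def boxCmd : Cmd :=
  .seq (.seq (.setW 18 (.div (.var 14) (.lit 2))) (.seq (.setW 19 (.div (.var 15) (.lit 2)))
    (.setW 20 (.div (.var 16) (.lit 2))))) (.seq listCmd (.seq inheritCmd growCmd))

/-- Descend one level. -/
def levelCmd : Cmd :=
  .seq (.seq (.setW 17 (.var 13)) (.seq (.setW 13 (.sub (.var 13) (.lit 1)))
      (.seq (.setW 23 (.div (.var 21) (.lit 2))) (.seq (.setW 22 (.add (.var 22) (.var 22)))
        (.seq (.setW 24 (.mul (.lit 3) (.var 21)))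
          (.setW 25 (.add (.add (.var 24) (.var 24)) (.lit 2))))))))
    (.seq (forLoop 14 22 (forLoop 15 22 (forLoop 16 22 boxCmd))) (.setW 21 (.var 23)))

/-- Write the answers. -/
def answerCmd : Cmd :=
  forLoop 14 3 (forLoop 15 3 (forLoop 16 3
    (copyCell 2 (pairE (pairE (.var 14) (.var 15)) (.var 16)) 3 (keyE 13 14 15 16 1 2))))

/-- What is to be done once the path is known. -/
def afterPathCmd : Cmd :=
  .seq cutCmd (.seq (.seq (.setW 13 (.var 5)) (.seq (.setW 14 (.lit 0)) (.seq (.setW 15 (.lit 0))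
      (.seq (.setW 16 (.lit 0)) (.seq (.setW 21 (.var 4)) (.setW 22 (.lit 1)))))))
    (.seq edgeCmd (.seq squareCmd (.seq (forLoop 6 5 levelCmd) answerCmd))))

/-- The algorithm. -/
def faultCmd : Cmd := .seq sizeCmd (.seq hopCmd (.seq pathCmd afterPathCmd))

end WeightedGraph

/-! ## The size and the distances by the number of edges -/

namespace WeightedGraph

open RealRAM

theorem pair_inj {n i j u v : ℕ} (hu : u < n) (hv : v < n) (h : i * n + u = j * n + v) :
    i = j ∧ u = v := by
  have hn : 0 < n := by omega
  have h1 := congrArg (· / n) h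
  have h2 := congrArg (· % n) h
  simp only [Nat.mul_comm _ n, Nat.mul_add_div hn, Nat.div_eq_of_lt hu, Nat.div_eq_of_lt hv,
    Nat.mul_add_mod, Nat.mod_eq_of_lt hu, Nat.mod_eq_of_lt hv, add_zero] at h1 h2
  exact ⟨h1, h2⟩

section Phases

variable {n : ℕ} {G H : SimpleGraph (Fin n)} {w : Sym2 (Fin n) → ℝ} {s t : Fin n} {W X : ℕ}

/-- The input is in place, with the graph `H` in the adjacency matrix and the weights of `G`. -/
structure Input (G H : SimpleGraph (Fin n)) (w : Sym2 (Fin n) → ℝ) (s t : Fin n) (σ : State) :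
    Prop where
  size : σ.wvar 0 = n
  source : σ.wvar 1 = s
  target : σ.wvar 2 = t
  adj : ∀ u v : Fin n, σ.warr 0 (u * n + v) = 0 ↔ ¬ H.Adj u v
  wt : ∀ u v : Fin n, G.Adj u v → σ.rarr 0 (u * n + v) = w s(u, v)

theorem Input.agree {p : Cmd} {σ τ : State} (h : Input G H w s t σ) (hA : Agree p σ τ)
    (hp : 0 ∉ p.wvs ∧ 1 ∉ p.wvs ∧ 2 ∉ p.wvs ∧ 0 ∉ p.was ∧ 0 ∉ p.ras) : Input G H w s t τ where
  size := (hA.wv 0 hp.1).trans h.size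
  source := (hA.wv 1 hp.2.1).trans h.source
  target := (hA.wv 2 hp.2.2.1).trans h.target
  adj u v := by rw [hA.wa 0 hp.2.2.2.1]; exact h.adj u v
  wt u v := by rw [hA.ra 0 hp.2.2.2.2]; exact h.wt u v

/-- The adjacency matrix doubles as the array of flags for the weights, so the arrays `0` can be
read as a matrix of extended reals. -/
theorem Input.val_of_adj {σ : State} (h : Input G H w s t σ) (hHG : H ≤ G) {u v : Fin n}
    (huv : H.Adj u v) : σ.val 0 (u * n + v) = (w s(u, v) : ℝ) := by
  rw [State.val, if_neg (fun h' => (h.adj u v).1 h' huv), h.wt u v (hHG huv)]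

theorem Input.val_of_not_adj {σ : State} (h : Input G H w s t σ) {u v : Fin n}
    (huv : ¬ H.Adj u v) : σ.val 0 (u * n + v) = ⊤ := by
  rw [State.val, if_pos ((h.adj u v).2 huv)]

theorem rowMajor_apply {α : Type*} [Zero α] (A : Fin n → Fin n → α) (u v : Fin n) :
    rowMajor n A (u * n + v) = A u v := by
  have hn : 0 < n := u.pos
  have h : (u : ℕ) * n + v < n * n := by
    have := u.isLt
    have := v.isLt
    calc (u : ℕ) * n + v < u * n + n := by omega
      _ = (u + 1) * n := by ring
      _ ≤ n * n := Nat.mul_le_mul_right n (by omega)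
  have h1 : ((u : ℕ) * n + v) / n = u := by
    rw [Nat.mul_comm, Nat.mul_add_div hn, Nat.div_eq_of_lt v.isLt, add_zero]
  have h2 : ((u : ℕ) * n + v) % n = v := by
    rw [Nat.mul_comm, Nat.mul_add_mod, Nat.mod_eq_of_lt v.isLt]
  rw [rowMajor, dif_pos h]
  congr 1 <;> exact Fin.ext (by assumption)

theorem input_inputState : Input G G w s t (inputState G w s t) where
  size := rfl
  source := rfl
  target := rfl
  adj u v := by
    simp only [inputState, if_true]
    rw [rowMajor_apply]
    by_cases h : G.Adj u v <;> simp [h]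
  wt u v h := by
    simp only [inputState, if_true]
    rw [rowMajor_apply, if_pos h]

/-- Each doubling increases the power of two by at least one, so `n` rounds reach `n`. A doubling
occurs only below `n`, so the result stays below `2 * n`. -/
theorem runs_sizeCmd (hX : Wide W X) (hnX : 2 * n ≤ X) (hn : 0 < n) {σ : State}
    (hσ : σ.Bounded X) (h0 : σ.wvar 0 = n) (h5 : σ.wvar 5 = 0) :
    Runs W X sizeCmd σ (2 + (n * (13 + 7) + 5)) fun τ =>
      τ.wvar 4 = 2 ^ τ.wvar 5 ∧ n ≤ τ.wvar 4 ∧ τ.wvar 4 < 2 * n := by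
  have h20 := hX.1
  refine Runs.seq (R := fun τ => τ = σ.setW 4 1)
    (Runs.of_loopless hX hσ rfl le_rfl (show 1 ≤ X by omega) rfl) fun τ hτ _ h => ?_
  subst h
  refine (Runs.forLoop hX hτ (m := n) (T := 13) (by simp [h0]) (by decide) (by decide) (by decide)
    (fun k τ => τ.wvar 4 = 2 ^ τ.wvar 5 ∧ (n ≤ τ.wvar 4 ∨ k + 1 ≤ τ.wvar 4) ∧ τ.wvar 4 < 2 * n)
    (by simp [h5]; omega) ?_).mono le_rfl fun τ _ _ h => ⟨h.1, by omega, h.2.2⟩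
  intro k hk τ hτ hA _ ⟨i1, i2, i3⟩
  have hn' : τ.wvar 0 = n := (hA.wv 0 (by decide)).trans (by simp [h0])
  refine Runs.ite (T := 9) hX hτ (by decide) (by decide) (fun h => ?_) (fun h => ?_)
  · have h' : τ.wvar 4 < n := hn' ▸ h
    have h5 : τ.wvar 5 < τ.wvar 4 := i1 ▸ Nat.lt_two_pow_self
    refine Runs.of_loopless hX hτ rfl (by decide) ?_ ?_
    · simp [Cmd.Safe, Cmd.sem, WExpr.den]
      omega
    · simp [Cmd.sem, WExpr.den, pow_succ]
      omega
  · have h' : n ≤ τ.wvar 4 := hn' ▸ not_lt.1 h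
    refine Runs.of_loopless hX hτ rfl (by decide) trivial ?_
    simp [Cmd.sem]
    omega

/-- Bellman–Ford with one row for each number of edges. All rows are kept, because the path is later
traced through them. -/
theorem runs_hopCmd (hX : Wide W X) {σ : State} (hσ : σ.Bounded X) (hI : Input G G w s t σ)
    (h4 : ∀ m, σ.warr 4 m = 0) (h4' : ∀ m, σ.rarr 4 m = 0) :
    Runs W X hopCmd σ (3 + (n * (n * (40 + (n * (100 + 7) + 5) + 7) + 5 + 7) + 5)) fun τ =>
      ∀ h ≤ n, ∀ u : Fin n, τ.val 4 (h * n + u) = hopDist G w t h u := by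
  classical
  have h20 := hX.1
  refine Runs.seq (R := fun τ => τ = σ.putW 4 t 1) (T₁ := 3)
    (Runs.of_loopless hX hσ rfl le_rfl (show 1 ≤ X by omega) ?_) fun τ hτ _ h => ?_
  · simp [Cmd.sem, WExpr.den, hI.target]
  have hIτ : Input G G w s t τ := by
    subst h
    exact ⟨hI.size, hI.source, hI.target, by simpa using hI.adj, hI.wt⟩
  refine Runs.forLoop hX hτ hIτ.size (by decide) (by decide) (by decide)
    (fun k τ => ∀ h ≤ k, ∀ u : Fin n, τ.val 4 (h * n + u) = hopDist G w t h u) ?_ ?_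
  · intro h' hh u
    obtain rfl : h' = 0 := by omega
    subst h
    change (σ.putW 4 t 1).val 4 _ = _
    by_cases hut : u = t
    -- Only the flag of this entry is written. Its real is the `0` of the initial memory.
    · subst hut; simp [State.val, hopDist, h4']
    · have : (u : ℕ) ≠ t := fun h => hut (Fin.ext h)
      simp [State.val, hopDist, h4, hut, this]
  intro k hk τ₁ hτ₁ hA₁ hk₁ hinv
  have hI₁ := hIτ.agree hA₁ (by decide)
  -- While row `k + 1` is being filled, the rows up to `k`, which are read, stay fixed, and finished
  -- entries of row `k + 1` stay finished.
  refine (Runs.forLoop_achieve hX hτ₁ hI₁.size (by decide) (by decide) (by decide)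
    (T := 40 + (n * (100 + 7) + 5))
    (fun τ υ => (∀ h ≤ k, ∀ u : Fin n, υ.val 4 (h * n + u) = τ.val 4 (h * n + u)) ∧
      ∀ u : Fin n, τ.val 4 ((k + 1) * n + u) = hopDist G w t (k + 1) u →
        υ.val 4 ((k + 1) * n + u) = hopDist G w t (k + 1) u)
    (fun u τ => ∀ hu : u < n, τ.val 4 ((k + 1) * n + u) = hopDist G w t (k + 1) ⟨u, hu⟩)
    (fun τ υ ρ h1 h2 => ⟨fun h hh u => (h2.1 h hh u).trans (h1.1 h hh u),
      fun u hu => h2.2 u (h1.2 u hu)⟩)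
    (fun τ k => ⟨fun _ _ _ => rfl, fun _ h => h⟩)
    (fun u τ υ h1 h2 hu => h1.2 ⟨u, hu⟩ (h2 hu)) ?_).mono (by omega) ?_
  swap
  · intro υ _ _ h h' hh' u
    rcases Nat.le_succ_iff.1 hh' with hh | rfl
    · exact (h.1.1 h' hh u).trans (hinv h' hh u)
    · exact h.2 u u.isLt u.isLt
  intro u₀ hu₀ τ₂ hτ₂ hA₂ hu₂ hR₂
  set u : Fin n := ⟨u₀, hu₀⟩ with hudef
  have hI₂ := hI₁.agree hA₂ (by decide)
  have hk₂ : τ₂.wvar 6 = k := (hA₂.wv 6 (by decide)).trans hk₁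
  have val₂ : ∀ h ≤ k, ∀ u : Fin n, τ₂.val 4 (h * n + u) = hopDist G w t h u := fun h hh u =>
    (hR₂.1 h hh u).trans (hinv h hh u)
  refine (Runs.seq (Runs.copyCell hX hτ₂ (by decide) (by decide) (T := 40) (by decide))
    fun τ₃ hτ₃ hA₃ h₃ => ?_ : Runs W X _ τ₂ _ (fun υ =>
      (∀ m, m ≠ (k + 1) * n + u → υ.val 4 m = τ₂.val 4 m) ∧
      υ.val 4 ((k + 1) * n + u) = hopDist G w t (k + 1) u)).mono le_rfl ?_
  swap
  · intro υ _ _ ⟨h1, h2⟩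
    refine ⟨⟨fun h hh v => h1 _ fun e => ?_, fun v hv => ?_⟩, fun _ => h2⟩
    · have := (pair_inj v.isLt u.isLt e).1
      omega
    · by_cases hvu : v = u
      · rw [hvu]; exact h2
      · rw [h1 _ fun e => hvu (Fin.ext (pair_inj v.isLt u.isLt e).2)]
        exact hv
  have hI₃ := hI₂.agree hA₃ (by decide)
  have hk₃ : τ₃.wvar 6 = k := (hA₃.wv 6 (by decide)).trans hk₂
  have hu₃ : τ₃.wvar 7 = u := (hA₃.wv 7 (by decide)).trans hu₂
  simp only [pairE, WExpr.den, hk₂, hu₂, hI₂.size] at h₃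
  set f : Fin n → WithTop ℝ := fun v =>
    if G.Adj u v then ((w s(u, v) : ℝ) : WithTop ℝ) + hopDist G w t k v else ⊤ with hf
  refine (Runs.forLoop hX hτ₃ hI₃.size (by decide) (by decide) (by decide) (T := 100)
    (fun j τ => (∀ m, m ≠ (k + 1) * n + u → τ.val 4 m = τ₂.val 4 m) ∧
      τ.val 4 ((k + 1) * n + u) =
        hopDist G w t k u ⊓ (Finset.univ.filter fun v : Fin n => (v : ℕ) < j).inf f)
    ⟨fun m hm => ?_, ?_⟩ ?_).mono le_rfl ?_
  · change τ₃.val 4 m = _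
    rw [h₃, if_neg (fun h => hm h.2)]
  · change τ₃.val 4 _ = _
    rw [h₃, if_pos ⟨rfl, rfl⟩, val₂ k le_rfl u]
    simp
  · intro v₀ hv₀ τ₄ hτ₄ hA₄ hv₄ ⟨i1, i2⟩
    set v : Fin n := ⟨v₀, hv₀⟩ with hvdef
    have hI₄ := hI₃.agree hA₄ (by decide)
    have hk₄ : τ₄.wvar 6 = k := (hA₄.wv 6 (by decide)).trans hk₃
    have hu₄ : τ₄.wvar 7 = u := (hA₄.wv 7 (by decide)).trans hu₃
    refine (Runs.relax hX hτ₄ (by decide) (by decide) (by decide) (by decide)).mono le_rfl ?_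
    intro υ _ _ h
    simp only [pairE, WExpr.den, RExpr.den, hk₄, hu₄, hv₄, hI₄.size, State.val_add] at h
    have e1 : τ₄.val 0 ((u : ℕ) * n + v₀) + τ₄.val 4 (k * n + v₀) = f v := by
      have e : τ₄.val 4 (k * n + v₀) = hopDist G w t k v := by
        rw [i1 _ fun e => by have := (pair_inj v.isLt u.isLt e).1; omega]
        exact val₂ k le_rfl v
      rw [e]
      by_cases huv : G.Adj u v
      · have := hI₄.val_of_adj le_rfl huv
        simp only [hf, huv, if_true]
        rw [← this]
      · have := hI₄.val_of_not_adj huv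
        simp only [hf, huv, if_false]
        rw [this, top_add]
    refine ⟨fun m hm => ?_, ?_⟩
    · change υ.val 4 m = _
      rw [h, if_neg (fun h' => hm h'.2), i1 m hm]
    · change υ.val 4 _ = _
      have e2 : (Finset.univ.filter fun v : Fin n => (v : ℕ) < v₀ + 1) =
          insert v (Finset.univ.filter fun v : Fin n => (v : ℕ) < v₀) := by
        ext x
        simp [Fin.ext_iff, hvdef]
        omega
      rw [h, if_pos ⟨rfl, rfl⟩, i2, e1, e2, Finset.inf_insert]
      simp only [← inf_assoc]
      rw [inf_right_comm]
  · intro υ _ _ ⟨h1, h2⟩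
    refine ⟨h1, h2.trans ?_⟩
    have : (Finset.univ.filter fun v : Fin n => (v : ℕ) < n) = Finset.univ := by
      ext x; simp
    rw [this, hopDist]

end Phases

end WeightedGraph

/-! ## The shortest path -/

namespace WeightedGraph

open RealRAM

section Path

variable {n : ℕ} {G H : SimpleGraph (Fin n)} {w : Sym2 (Fin n) → ℝ} {s t : Fin n} {W X : ℕ}

/-- The loop remembers a neighbour that attains the value with `g + 1` edges, if there is one. The
final test overrides it by `u` itself when the extra edge brings no gain, so a move is made only
when it is a strict improvement, as `IsPartialPath.move` requires. -/
theorem runs_nextCmd (hX : Wide W X) {σ : State} (hσ : σ.Bounded X) (hI : Input G G w s t σ)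
    {g : ℕ} {u : Fin n} (hg : σ.wvar 10 = g) (hu : σ.wvar 11 = u)
    (hv : ∀ h ≤ g + 1, ∀ u : Fin n, σ.val 4 (h * n + u) = hopDist G w t h u)
    (hfin : hopDist G w t (g + 1) u ≠ ⊤) :
    Runs W X nextCmd σ (2 + ((n * (100 + 7) + 5) + 60)) fun τ =>
      ∃ v : Fin n, τ.wvar 12 = v ∧ ((v = u ∧ hopDist G w t g u ≤ hopDist G w t (g + 1) u) ∨
        (hopDist G w t (g + 1) u < hopDist G w t g u ∧ G.Adj u v ∧
          (w s(u, v) : ℝ) + hopDist G w t g v = hopDist G w t (g + 1) u)) := by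
  have hr : (σ.rarr 4 ((g + 1) * n + u) : WithTop ℝ) = hopDist G w t (g + 1) u := by
    rw [← hv (g + 1) le_rfl u] at hfin ⊢
    unfold State.val at hfin ⊢
    split_ifs with h
    · simp [h] at hfin
    · rfl
  -- Testing for `≤` is enough, since the reverse inequality holds for every neighbour.
  set good : ℕ → Prop := fun v => ∃ hv : v < n, G.Adj u ⟨v, hv⟩ ∧
    (w s(u, ⟨v, hv⟩) : ℝ) + hopDist G w t g ⟨v, hv⟩ ≤ hopDist G w t (g + 1) u with hgood
  refine Runs.seq (R := fun τ => τ.wvar 12 = u) (T₁ := 2)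
    (Runs.of_loopless hX hσ rfl le_rfl (hσ.1 11) (by simp [Cmd.sem, WExpr.den, hu]))
    fun τ hτ hA h12 => ?_
  have hIτ := hI.agree hA (by decide)
  refine Runs.seq (R := fun τ => τ.wvar 12 < n ∧ ((∃ v < n, good v) → good (τ.wvar 12)))
    (Runs.forLoop hX hτ hIτ.size (by decide) (by decide) (by decide) (T := 100)
      (fun k τ => τ.wvar 12 < n ∧ ((∃ v < k, good v) → good (τ.wvar 12)))
      ⟨by simp [h12], fun ⟨v, hv, _⟩ => absurd hv (Nat.not_lt_zero v)⟩ ?_) ?_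
  · intro v hvn τ₁ hτ₁ hA₁ hv₁ ⟨i1, i2⟩
    have hI₁ := hIτ.agree hA₁ (by decide)
    have hg₁ : τ₁.wvar 10 = g :=
      (hA₁.wv 10 (by decide)).trans ((hA.wv 10 (by decide)).trans hg)
    have hu₁ : τ₁.wvar 11 = u :=
      (hA₁.wv 11 (by decide)).trans ((hA.wv 11 (by decide)).trans hu)
    have w4 : τ₁.warr 4 = σ.warr 4 :=
      (hA₁.wa 4 (by decide)).trans (hA.wa 4 (by decide))
    have r4 : τ₁.rarr 4 = σ.rarr 4 :=
      (hA₁.ra 4 (by decide)).trans (hA.ra 4 (by decide))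
    have val4 : ∀ m, τ₁.val 4 m = σ.val 4 m := fun m => by simp only [State.val, w4, r4]
    have sum := State.val_add τ₁ 0 ((u : ℕ) * n + v) 4 (g * n + v)
    have e4 : τ₁.val 4 (g * n + v) = hopDist G w t g ⟨v, hvn⟩ := by
      rw [val4]; exact hv g (Nat.le_succ g) ⟨v, hvn⟩
    have step : ∀ υ : State, (good v → υ.wvar 12 = v) →
        (¬ good v → υ.wvar 12 = τ₁.wvar 12) →
        υ.wvar 12 < n ∧ ((∃ x < v + 1, good x) → good (υ.wvar 12)) := by
      intro υ h1 h2
      by_cases hgv : good v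
      · rw [h1 hgv]; exact ⟨hvn, fun _ => hgv⟩
      · rw [h2 hgv]
        refine ⟨i1, fun ⟨x, hx, hgx⟩ => i2 ⟨x, ?_, hgx⟩⟩
        rcases Nat.lt_succ_iff_lt_or_eq.1 hx with h | rfl
        exacts [h, absurd hgx hgv]
    refine Runs.ite (T := 60) hX hτ₁ (by decide) (by decide) (fun h => ?_) (fun h => ?_)
    · refine Runs.of_loopless hX hτ₁ rfl (by decide) trivial (step _ (fun hgv => ?_) fun _ => ?_)
      · exfalso
        simp only [Cond.den, WExpr.den, pairE, hu₁, hg₁, hv₁, hI₁.size] at h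
        rw [if_pos h, e4] at sum
        obtain ⟨hvn', hadj, hle⟩ := hgv
        rw [hI₁.val_of_adj (v := ⟨v, hvn⟩) le_rfl hadj] at sum
        rw [← sum, top_le_iff] at hle
        exact hfin hle
      · simp [Cmd.sem]
    · simp only [Cond.den, WExpr.den, pairE, hu₁, hg₁, hv₁, hI₁.size] at h
      rw [if_neg h, e4] at sum
      have hadj : G.Adj u ⟨v, hvn⟩ := by
        by_contra hna
        exact h (by rw [(hI₁.adj u ⟨v, hvn⟩).2 hna, zero_mul])
      have iff : good v ↔ τ₁.rarr 0 (u * n + v) + τ₁.rarr 4 (g * n + v) ≤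
          τ₁.rarr 4 ((g + 1) * n + u) := by
        rw [← WithTop.coe_le_coe, r4, hr, ← r4, sum,
          hI₁.val_of_adj (v := ⟨v, hvn⟩) le_rfl hadj]
        exact ⟨fun ⟨_, _, h⟩ => h, fun h => ⟨hvn, hadj, h⟩⟩
      refine Runs.ite (T := 10) hX hτ₁ (by decide) (by decide) (fun h => ?_) (fun h => ?_)
      · simp only [Cond.den, WExpr.den, RExpr.den, pairE, hu₁, hg₁, hv₁, hI₁.size] at h
        refine Runs.of_loopless hX hτ₁ rfl (by decide) (hτ₁.1 8)
          (step _ (fun _ => ?_) fun hn => absurd (iff.2 h) hn)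
        simp [Cmd.sem, WExpr.den, hv₁]
      · simp only [Cond.den, WExpr.den, RExpr.den, pairE, hu₁, hg₁, hv₁, hI₁.size] at h
        exact Runs.of_loopless hX hτ₁ rfl (by decide) trivial
          (step _ (fun hgv => absurd (iff.1 hgv) h) fun _ => by simp [Cmd.sem])
  intro τ₁ hτ₁ hA₁ ⟨i1, i2⟩
  have hI₁ := hIτ.agree hA₁ (by decide)
  have hg₁ : τ₁.wvar 10 = g := (hA₁.wv 10 (by decide)).trans ((hA.wv 10 (by decide)).trans hg)
  have hu₁ : τ₁.wvar 11 = u := (hA₁.wv 11 (by decide)).trans ((hA.wv 11 (by decide)).trans hu)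
  have w4 : τ₁.warr 4 = σ.warr 4 := (hA₁.wa 4 (by decide)).trans (hA.wa 4 (by decide))
  have r4 : τ₁.rarr 4 = σ.rarr 4 := (hA₁.ra 4 (by decide)).trans (hA.ra 4 (by decide))
  have hvg := hv g (Nat.le_succ g) u
  -- A strict gain guarantees that some vertex is `good`, so the loop has recorded one.
  have move : ∀ υ : State, υ.wvar 12 = τ₁.wvar 12 →
      hopDist G w t (g + 1) u < hopDist G w t g u →
      ∃ v : Fin n, υ.wvar 12 = v ∧ ((v = u ∧ hopDist G w t g u ≤ hopDist G w t (g + 1) u) ∨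
        (hopDist G w t (g + 1) u < hopDist G w t g u ∧ G.Adj u v ∧
          (w s(u, v) : ℝ) + hopDist G w t g v = hopDist G w t (g + 1) u)) := by
    intro υ h1 h2
    obtain ⟨v, hadj, he⟩ := exists_adj_of_hopDist_lt h2
    obtain ⟨hn, hadj', hle⟩ := i2 ⟨v, v.isLt, v.isLt, hadj, he.le⟩
    exact ⟨⟨_, hn⟩, h1, .inr ⟨h2, hadj', le_antisymm hle (hopDist_succ_le_of_adj t g hadj')⟩⟩
  refine Runs.ite (T := 40) hX hτ₁ (by decide) (by decide) (fun h => ?_) (fun h => ?_)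
  · simp only [Cond.den, WExpr.den, pairE, hu₁, hg₁, hI₁.size] at h
    refine Runs.of_loopless hX hτ₁ rfl (by decide) trivial (move _ (by simp [Cmd.sem]) ?_)
    rw [← hvg, State.val, if_pos (w4 ▸ h)]
    exact lt_top_iff_ne_top.2 hfin
  · simp only [Cond.den, WExpr.den, pairE, hu₁, hg₁, hI₁.size] at h
    have hvg' : (σ.rarr 4 (g * n + u) : WithTop ℝ) = hopDist G w t g u := by
      rw [← hvg, State.val, if_neg (w4 ▸ h)]
    refine Runs.ite (T := 10) hX hτ₁ (by decide) (by decide) (fun h => ?_) (fun h => ?_)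
    · simp only [Cond.den, WExpr.den, RExpr.den, pairE, hu₁, hg₁, hI₁.size, r4] at h
      refine Runs.of_loopless hX hτ₁ rfl (by decide) (hτ₁.1 11) ⟨u, ?_, .inl ⟨rfl, ?_⟩⟩
      · simp [Cmd.sem, WExpr.den, hu₁]
      · rw [← hvg', ← hr]
        exact WithTop.coe_le_coe.2 h
    · simp only [Cond.den, WExpr.den, RExpr.den, pairE, hu₁, hg₁, hI₁.size, r4] at h
      refine Runs.of_loopless hX hτ₁ rfl (by decide) trivial (move _ (by simp [Cmd.sem]) ?_)
      rw [← hvg', ← hr]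
      exact WithTop.coe_lt_coe.2 (not_le.1 h)

/-- After `k` rounds `n - k` edges are left, and each round either stays or moves. Cells of array
`1` that are never written hold `0`, which is a vertex because `n > 0`. The last clause thus lets
the whole array be read as a sequence of vertices. -/
theorem runs_pathCmd (hX : Wide W X) (hnX : 2 * n ≤ X) (hw : ∀ e ∈ G.edgeSet, 0 ≤ w e)
    (hst : G.Reachable s t) {σ : State} (hσ : σ.Bounded X) (hI : Input G G w s t σ)
    (hv : ∀ h ≤ n, ∀ u : Fin n, σ.val 4 (h * n + u) = hopDist G w t h u)
    (h3 : σ.wvar 3 = 0) (h1 : ∀ m, σ.warr 1 m = 0) :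
    Runs W X pathCmd σ (7 + (n * ((4 + ((2 + ((n * (100 + 7) + 5) + 60)) + 20)) + 7) + 5))
      fun τ => ∃ p : G.Walk s t, IsShortestPath w p ∧ τ.wvar 3 = p.length ∧
        (∀ i ≤ p.length, τ.warr 1 i = p.getVert i) ∧ ∀ i, τ.warr 1 i < n := by
  have hn : 0 < n := s.pos
  have hfin : hopDist G w t n s ≠ ⊤ := by
    classical
    obtain ⟨p⟩ := hst
    have := hopDist_le (w := w) p.bypass (h := n) (by
      simpa using p.bypass_isPath.length_lt.le)
    exact (this.trans_lt (WithTop.coe_lt_top _)).ne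
  refine Runs.seq (R := fun τ => τ.wvar 11 = s ∧ τ.wvar 10 = n ∧ τ.warr 1 0 = s ∧
    (∀ i, τ.warr 1 i < n)) (T₁ := 7)
    (Runs.of_loopless hX hσ rfl (by decide) ⟨hσ.1 1, hσ.1 1, hσ.1 0⟩ ?_)
    fun τ hτ hA ⟨h11, h10, h1s, h1n⟩ => ?_
  · simp only [Cmd.sem, WExpr.den, State.setW_wvar, State.setW_warr, State.putW_warr,
      State.putW_wvar, h1]
    simp only [hI.source, hI.size]
    refine ⟨by simp, by simp, by simp, fun i => ?_⟩
    by_cases hi : i = 0 <;> simp [hi, hn]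
  have hIτ := hI.agree hA (by decide)
  refine (Runs.forLoop hX hτ hIτ.size (by decide) (by decide) (by decide)
    (fun k τ => τ.wvar 10 = n - k ∧ (∀ i, τ.warr 1 i < n) ∧ ∃ (u : Fin n) (q : G.Walk s u),
      IsPartialPath G w t n (n - k) q ∧ τ.wvar 11 = u ∧ τ.wvar 3 = q.length ∧
      ∀ i ≤ q.length, τ.warr 1 i = q.getVert i)
    ⟨by simpa using h10, h1n, s, .nil, .nil t n s, by simpa using h11,
      by simpa using (hA.wv 3 (by decide)).trans h3, ?_⟩ ?_).mono le_rfl ?_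
  · intro i hi
    obtain rfl : i = 0 := by simpa using hi
    simpa using h1s
  · intro k hk τ₁ hτ₁ hA₁ _ ⟨i10, i1, u, q, hq, i11, i3, iq⟩
    obtain ⟨g, hg⟩ : ∃ g, n - k = g + 1 := ⟨n - k - 1, by omega⟩
    have hI₁ := hIτ.agree hA₁ (by decide)
    have hu : hopDist G w t (g + 1) u ≠ ⊤ := by
      intro h
      have := hq.weight_add
      rw [hg, h, add_top] at this
      exact hfin this.symm
    refine Runs.seq (R := fun υ => υ.wvar 10 = g ∧ υ.warr = τ₁.warr) (T₁ := 4)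
      (Runs.of_loopless hX hτ₁ rfl le_rfl ?_ ?_) fun τ₂ hτ₂ hA₂ ⟨h10, hw2⟩ => ?_
    · exact (Nat.sub_le _ _).trans (hτ₁.1 10)
    · refine ⟨?_, rfl⟩
      simp [Cmd.sem, WExpr.den, i10, hg]
    have hI₂ := hI₁.agree hA₂ (by decide)
    have i11' : τ₂.wvar 11 = u := (hA₂.wv 11 (by decide)).trans i11
    have val4 : ∀ m, τ₂.val 4 m = σ.val 4 m := fun m => by
      have e1 : τ₂.warr 4 = σ.warr 4 := (hA₂.wa 4 (by decide)).trans
        ((hA₁.wa 4 (by decide)).trans (hA.wa 4 (by decide)))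
      have e2 : τ₂.rarr 4 = σ.rarr 4 := (hA₂.ra 4 (by decide)).trans
        ((hA₁.ra 4 (by decide)).trans (hA.ra 4 (by decide)))
      simp only [State.val, e1, e2]
    refine Runs.seq (runs_nextCmd hX hτ₂ hI₂ h10 i11'
      (fun h hh u => (val4 _).trans (hv h (by omega) u)) hu) fun τ₃ hτ₃ hA₃ ⟨v, hv12, hv⟩ => ?_
    have j10 : τ₃.wvar 10 = g := (hA₃.wv 10 (by decide)).trans h10
    have j11 : τ₃.wvar 11 = u := (hA₃.wv 11 (by decide)).trans i11'
    have j3 : τ₃.wvar 3 = q.length :=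
      (hA₃.wv 3 (by decide)).trans ((hA₂.wv 3 (by decide)).trans i3)
    have j1 : τ₃.warr 1 = τ₁.warr 1 := (hA₃.wa 1 (by decide)).trans (by rw [hw2])
    have hgk : n - (k + 1) = g := by omega
    rw [hg] at hq
    have hlen : q.length < n := by simpa using hq.isPath.length_lt
    have cond : Cond.den τ₃ (.weq (.var 12) (.var 11)) ↔ v = u := by
      simp only [Cond.den, WExpr.den, hv12, j11]
      exact Fin.ext_iff.symm
    refine Runs.ite (T := 15) hX hτ₃ (by decide) (by decide) (fun h => ?_) (fun h => ?_)
    -- Equality of the two variables means staying, since a move leads to an adjacent and hence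
    -- different vertex.
    · obtain ⟨-, hle⟩ := hv.resolve_right fun h' => h'.2.1.ne' (cond.1 h)
      refine Runs.of_loopless hX hτ₃ rfl (by decide) trivial ⟨?_, ?_, u, q, ?_, ?_, ?_, ?_⟩
      · simpa [Cmd.sem, hgk] using j10
      · simpa [Cmd.sem, j1] using i1
      · rw [hgk]; exact hq.stay hle
      · simpa [Cmd.sem] using j11
      · simpa [Cmd.sem] using j3
      · simpa [Cmd.sem, j1] using iq
    · obtain ⟨hlt, hadj, he⟩ := hv.resolve_left fun h' => h (cond.2 h'.1)
      refine Runs.of_loopless hX hτ₃ rfl (by decide) ⟨?_, ?_, ?_⟩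
        ⟨?_, ?_, v, q.concat hadj, ?_, ?_, ?_, ?_⟩
      · change τ₃.wvar 3 + 1 ≤ X
        omega
      · exact hτ₃.1 12
      · exact hτ₃.1 12
      · simpa [Cmd.sem, hgk] using j10
      · intro i
        simp only [Cmd.sem, WExpr.den, State.setW_warr, State.putW_warr, State.setW_wvar, j1]
        by_cases h' : i = q.length + 1 <;> simp [h', j3, hv12, i1]
      · rw [hgk]; exact hq.move hw hlt hadj he
      · simp [Cmd.sem, WExpr.den, hv12]
      · simp [Cmd.sem, WExpr.den, j3]
      · intro i hi
        rw [SimpleGraph.Walk.length_concat] at hi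
        rw [SimpleGraph.Walk.concat_eq_append, SimpleGraph.Walk.getVert_append']
        simp only [Cmd.sem, WExpr.den, State.setW_warr, State.putW_warr, State.setW_wvar, j1, j3,
          true_and]
        rcases Nat.le_succ_iff.1 hi with hi' | rfl
        · rw [if_pos hi', if_neg (by simp; omega), iq i hi']
        · rw [if_neg (Nat.not_succ_le_self _)]
          simp [hv12]
  · intro τ₁ _ _ ⟨_, i1, u, q, hq, _, i3, iq⟩
    rw [Nat.sub_self] at hq
    obtain ⟨rfl, hp⟩ := hq.isShortestPath (by simp) hst
    exact ⟨q, hp, i3, iq, i1⟩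

/-! ### Deletion of the path from the adjacency matrix. -/

/-- The path is in place. -/
structure PathAt (P : ℕ → Fin n) (L : ℕ) (σ : State) : Prop where
  length : σ.wvar 3 = L
  vert : ∀ i, σ.warr 1 i = P i

theorem PathAt.agree {P : ℕ → Fin n} {L : ℕ} {p : Cmd} {σ τ : State} (h : PathAt P L σ)
    (hA : Agree p σ τ) (hp : 3 ∉ p.wvs ∧ 1 ∉ p.was) : PathAt P L τ where
  length := (hA.wv 3 hp.1).trans h.length
  vert i := by rw [hA.wa 1 hp.2]; exact h.vert i

theorem switch_empty_adj {P : ℕ → Fin n} {L : ℕ} {u v : Fin n} :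
    (switch G P L ∅).Adj u v ↔ G.Adj u v ∧ ¬ ∃ i < L, s(u, v) = s(P i, P (i + 1)) := by
  simp [switch, SimpleGraph.deleteEdges_adj]

theorem runs_cutCmd (hX : Wide W X) {P : ℕ → Fin n} {L : ℕ} {σ : State} (hσ : σ.Bounded X)
    (hI : Input G G w s t σ) (hP : PathAt P L σ) :
    Runs W X cutCmd σ (L * (40 + 7) + 5) fun τ => Input G (switch G P L ∅) w s t τ := by
  refine (Runs.forLoop hX hσ hP.length (by decide) (by decide) (by decide)
    (fun k τ => ∀ u v : Fin n, τ.warr 0 (u * n + v) = 0 ↔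
      ¬ (G.Adj u v ∧ ¬ ∃ i < k, s(u, v) = s(P i, P (i + 1))))
    (fun u v => by simpa using hI.adj u v) ?_).mono le_rfl ?_
  · intro k hk τ hτ hA hk6 hinv
    have hPτ := hP.agree hA (by decide)
    have hn : τ.wvar 0 = n := (hA.wv 0 (by decide)).trans hI.size
    refine Runs.of_loopless hX hτ rfl (by decide) ⟨Nat.zero_le _, Nat.zero_le _⟩ fun u v => ?_
    simp only [Cmd.sem, WExpr.den, pairE, State.setW_warr, State.putW_warr, State.putW_wvar, hn,
      hk6, hPτ.vert, true_and]
    have e : ∀ a b : Fin n, (u : ℕ) * n + v = a * n + b ↔ u = a ∧ v = b := fun a b =>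
      ⟨fun h => by
        obtain ⟨h1, h2⟩ := pair_inj v.isLt b.isLt h
        exact ⟨Fin.ext h1, Fin.ext h2⟩, fun ⟨h1, h2⟩ => by rw [h1, h2]⟩
    have ex : (∃ i < k + 1, s(u, v) = s(P i, P (i + 1))) ↔
        s(u, v) = s(P k, P (k + 1)) ∨ ∃ i < k, s(u, v) = s(P i, P (i + 1)) := by
      constructor
      · rintro ⟨i, hi, h⟩
        rcases Nat.lt_succ_iff_lt_or_eq.1 hi with h' | rfl
        exacts [.inr ⟨i, h', h⟩, .inl h]
      · rintro (h | ⟨i, hi, h⟩)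
        exacts [⟨k, Nat.lt_succ_self k, h⟩, ⟨i, hi.trans (Nat.lt_succ_self k), h⟩]
    rw [ex, Sym2.eq_iff]
    simp only [e, show (1 : ℕ) ≠ 0 from one_ne_zero, false_and, if_false]
    split_ifs with h1 h2
    · simp [h1]
    · simp [h2]
    · rw [hinv u v]
      simp [h1, h2]
  · intro τ _ hA h
    exact ⟨(hA.wv 0 (by decide)).trans hI.size, (hA.wv 1 (by decide)).trans hI.source,
      (hA.wv 2 (by decide)).trans hI.target, fun u v => by rw [h, switch_empty_adj],
      -- The weights of the deleted edges remain in memory and are read again when these edges are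
      -- inserted.
      fun u v huv => by rw [hA.ra 0 (by decide)]; exact hI.wt u v huv⟩

end Path

end WeightedGraph

/-! ## Matrices of distances -/

namespace WeightedGraph

open RealRAM

theorem key_inj {N r x y z u v r' x' y' z' u' v' : ℕ} (hx : x < N) (hy : y < N) (hz : z < N)
    (hu : u < N) (hv : v < N) (hx' : x' < N) (hy' : y' < N) (hz' : z' < N) (hu' : u' < N)
    (hv' : v' < N) (h : key N r x y z u v = key N r' x' y' z' u' v') :
    r = r' ∧ x = x' ∧ y = y' ∧ z = z' ∧ u = u' ∧ v = v' := by
  unfold key at h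
  obtain ⟨h5, e5⟩ := pair_inj hv hv' h
  obtain ⟨h4, e4⟩ := pair_inj hu hu' h5
  obtain ⟨h3, e3⟩ := pair_inj hz hz' h4
  obtain ⟨h2, e2⟩ := pair_inj hy hy' h3
  obtain ⟨h1, e1⟩ := pair_inj hx hx' h2
  exact ⟨h1, e1, e2, e3, e4, e5⟩

section Matrices

variable {n : ℕ} {G H : SimpleGraph (Fin n)} {w : Sym2 (Fin n) → ℝ} {s t : Fin n} {W X : ℕ}
  {P : ℕ → Fin n} {L N : ℕ}

/-- Input, path and size are in place. -/
structure Ready (G H : SimpleGraph (Fin n)) (w : Sym2 (Fin n) → ℝ) (s t : Fin n) (P : ℕ → Fin n)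
    (L N : ℕ) (σ : State) : Prop where
  input : Input G H w s t σ
  path : PathAt P L σ
  base : σ.wvar 4 = N

theorem Ready.agree {p : Cmd} {σ τ : State} (h : Ready G H w s t P L N σ) (hA : Agree p σ τ)
    (hp : (0 ∉ p.wvs ∧ 1 ∉ p.wvs ∧ 2 ∉ p.wvs ∧ 0 ∉ p.was ∧ 0 ∉ p.ras) ∧
      (3 ∉ p.wvs ∧ 1 ∉ p.was) ∧ 4 ∉ p.wvs) : Ready G H w s t P L N τ :=
  ⟨h.input.agree hA hp.1, h.path.agree hA hp.2.1, (hA.wv 4 hp.2.2).trans h.base⟩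

/-- The variables `13` to `16` hold the name of a matrix. -/
structure NamedAt (r x y z : ℕ) (σ : State) : Prop where
  level : σ.wvar 13 = r
  fst : σ.wvar 14 = x
  snd : σ.wvar 15 = y
  trd : σ.wvar 16 = z

theorem NamedAt.agree {r x y z : ℕ} {p : Cmd} {σ τ : State} (h : NamedAt r x y z σ)
    (hA : Agree p σ τ) (hp : 13 ∉ p.wvs ∧ 14 ∉ p.wvs ∧ 15 ∉ p.wvs ∧ 16 ∉ p.wvs) :
    NamedAt r x y z τ :=
  ⟨(hA.wv 13 hp.1).trans h.level, (hA.wv 14 hp.2.1).trans h.fst, (hA.wv 15 hp.2.2.1).trans h.snd,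
    (hA.wv 16 hp.2.2.2).trans h.trd⟩

theorem NamedAt.den_keyE {r x y z a b : ℕ} {σ : State} (h : NamedAt r x y z σ)
    (hN : σ.wvar 4 = N) : (keyE 13 14 15 16 a b).den σ =
      key N r x y z (σ.wvar a) (σ.wvar b) := by
  simp [keyE, WExpr.den, key, h.level, h.fst, h.snd, h.trd, hN]

theorem key_fin_inj (hnN : n ≤ N) (r : ℕ) {x y z : ℕ} (hx : x < N) (hy : y < N) (hz : z < N)
    {u v u' v' : Fin n} (h : key N r x y z u v = key N r x y z u' v') : u = u' ∧ v = v' := by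
  obtain ⟨-, -, -, -, h1, h2⟩ := key_inj hx hy hz (by omega) (by omega) hx hy hz (by omega)
    (by omega) h
  exact ⟨Fin.ext h1, Fin.ext h2⟩

/-- Entries of the matrix at `adr` with indices in `T` were lowered, but not below `lo`. -/
def Lowers (adr : Fin n → Fin n → ℕ) (T : Set (Fin n)) (lo : Fin n → Fin n → WithTop ℝ)
    (σ τ : State) : Prop :=
  (∀ m, τ.val 3 m ≤ σ.val 3 m) ∧
  (∀ m, (∀ u ∈ T, ∀ v ∈ T, m ≠ adr u v) → τ.val 3 m = σ.val 3 m) ∧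
  ((∀ u ∈ T, ∀ v ∈ T, lo u v ≤ σ.val 3 (adr u v)) → ∀ u ∈ T, ∀ v ∈ T, lo u v ≤ τ.val 3 (adr u v))

theorem Lowers.refl {adr : Fin n → Fin n → ℕ} {T : Set (Fin n)}
    {lo : Fin n → Fin n → WithTop ℝ} (σ : State) : Lowers adr T lo σ σ :=
  ⟨fun _ => le_rfl, fun _ _ => rfl, fun h => h⟩

theorem Lowers.trans {adr : Fin n → Fin n → ℕ} {T : Set (Fin n)}
    {lo : Fin n → Fin n → WithTop ℝ} (σ τ υ : State) (h₁ : Lowers adr T lo σ τ)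
    (h₂ : Lowers adr T lo τ υ) : Lowers adr T lo σ υ :=
  ⟨fun m => (h₂.1 m).trans (h₁.1 m), fun m hm => (h₂.2.1 m hm).trans (h₁.2.1 m hm),
    fun h => h₂.2.2 (h₁.2.2 h)⟩

/-- The candidate `c` is computed from current entries, so `hc` may assume that these are still at
least `lo`. -/
theorem Lowers.of_relax {adr : Fin n → Fin n → ℕ} {T : Set (Fin n)}
    {lo : Fin n → Fin n → WithTop ℝ} {σ τ : State}
    (hadr : ∀ u v u' v', adr u v = adr u' v' → u = u' ∧ v = v') {u v : Fin n} (hu : u ∈ T)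
    (hv : v ∈ T) {c : WithTop ℝ}
    (hc : (∀ u ∈ T, ∀ v ∈ T, lo u v ≤ σ.val 3 (adr u v)) → lo u v ≤ c)
    (h : ∀ a m, τ.val a m = if a = 3 ∧ m = adr u v then min (σ.val a m) c else σ.val a m) :
    Lowers adr T lo σ τ := by
  refine ⟨fun m => ?_, fun m hm => ?_, fun hlo u' hu' v' hv' => ?_⟩
  · rw [h]
    split_ifs
    exacts [min_le_left _ _, le_rfl]
  · rw [h, if_neg fun h' => hm u hu v hv h'.2]
  · rw [h]
    split_ifs with h'
    · obtain ⟨rfl, rfl⟩ := hadr _ _ _ _ h'.2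
      exact le_min (hlo u' hu' v' hv') (hc hlo)
    · exact hlo u' hu' v' hv'

theorem runs_edgeCmd (hX : Wide W X) (hHG : H ≤ G) (hnN : n ≤ N) {σ : State} (hσ : σ.Bounded X)
    (hR : Ready G H w s t P L N σ) {r x y z : ℕ} (hx : x < N) (hy : y < N) (hz : z < N)
    (hM : NamedAt r x y z σ) :
    Runs W X edgeCmd σ (n * (n * (150 + 7) + 5 + 7) + 5) fun τ => ∀ u v : Fin n,
      (u = v → τ.val 3 (key N r x y z u v) = 0) ∧
      (u ≠ v → H.Adj u v → τ.val 3 (key N r x y z u v) = (w s(u, v) : ℝ)) ∧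
      (u ≠ v → ¬ H.Adj u v → τ.val 3 (key N r x y z u v) = ⊤) := by
  set Good : State → Fin n → Fin n → Prop := fun τ u v =>
      (u = v → τ.val 3 (key N r x y z u v) = 0) ∧
      (u ≠ v → H.Adj u v → τ.val 3 (key N r x y z u v) = (w s(u, v) : ℝ)) ∧
      (u ≠ v → ¬ H.Adj u v → τ.val 3 (key N r x y z u v) = ⊤) with hGood
  have h20 := hX.1
  refine (Runs.forLoop_achieve hX hσ hR.input.size (by decide) (by decide) (by decide)
    (fun τ υ => ∀ u v, Good τ u v → Good υ u v)
    (fun u τ => ∀ v < n, ∀ hu : u < n, ∀ hv : v < n, Good τ ⟨u, hu⟩ ⟨v, hv⟩)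
    (fun _ _ _ h1 h2 u v h => h2 u v (h1 u v h)) (fun _ _ _ _ h => h)
    (fun u τ υ h1 h2 v hv hu hv' => h1 _ _ (h2 v hv hu hv')) ?_).mono le_rfl
    fun τ _ _ h u v => h.2 u u.isLt v v.isLt u.isLt v.isLt
  intro u₀ hu₀ τ hτ hA hu7 _
  have hRτ := hR.agree hA (by decide)
  have hMτ := hM.agree hA (by decide)
  refine (Runs.forLoop_achieve hX hτ hRτ.input.size (by decide) (by decide) (by decide)
    (fun τ υ => ∀ u v, Good τ u v → Good υ u v)
    (fun v τ => ∀ hu : u₀ < n, ∀ hv : v < n, Good τ ⟨u₀, hu⟩ ⟨v, hv⟩)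
    (fun _ _ _ h1 h2 u v h => h2 u v (h1 u v h)) (fun _ _ _ _ h => h)
    (fun v τ υ h1 h2 hu hv => h1 _ _ (h2 hu hv)) ?_)
  intro v₀ hv₀ τ₁ hτ₁ hA₁ hv8 _
  have hR₁ := hRτ.agree hA₁ (by decide)
  have hM₁ := hMτ.agree hA₁ (by decide)
  have hu7' : τ₁.wvar 7 = u₀ := (hA₁.wv 7 (by decide)).trans hu7
  set u : Fin n := ⟨u₀, hu₀⟩ with hu
  set v : Fin n := ⟨v₀, hv₀⟩ with hv
  have fin : ∀ υ : State, Good υ u v → (∀ m, m ≠ key N r x y z u v → υ.val 3 m = τ₁.val 3 m) →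
      (∀ u' v', Good τ₁ u' v' → Good υ u' v') ∧
      (∀ hu : u₀ < n, ∀ hv : v₀ < n, Good υ ⟨u₀, hu⟩ ⟨v₀, hv⟩) := by
    intro υ h1 h2
    refine ⟨fun u' v' h => ?_, fun _ _ => h1⟩
    by_cases he : u' = u ∧ v' = v
    · rw [he.1, he.2]; exact h1
    · have := h2 (key N r x y z u' v') fun e => he (key_fin_inj hnN r hx hy hz e)
      simpa only [hGood, this] using h
  refine Runs.ite (T := 100) hX hτ₁ (by decide) (by decide) (fun h => ?_) (fun h => ?_)
  · have h' : u₀ = v₀ := by simpa [Cond.den, WExpr.den, hu7', hv8] using h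
    have huv : u = v := Fin.ext h'
    have dk : (keyE 13 14 15 16 7 8).den τ₁ = key N r x y z u v := by
      rw [hM₁.den_keyE hR₁.base, hu7', hv8]
    have dk' : (keyE 13 14 15 16 7 8).den (τ₁.putR 3 (key N r x y z u v) 0) =
        key N r x y z u v := by
      rw [WExpr.den_congr (σ := τ₁) (τ := τ₁.putR _ _ _) rfl rfl, dk]
    refine Runs.of_loopless hX hτ₁ (by decide) (by decide) ⟨trivial, show 1 ≤ X by omega⟩
      (fin _ ⟨fun _ => ?_, fun h => absurd huv h, fun h => absurd huv h⟩ fun m hm => ?_)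
    · simp only [Cmd.sem, RExpr.den]
      rw [dk, dk']
      simp [State.val, WExpr.den]
    · simp only [Cmd.sem, RExpr.den]
      rw [dk, dk']
      simp [State.val, hm]
  · have h' : u₀ ≠ v₀ := by simpa [Cond.den, WExpr.den, hu7', hv8] using h
    have huv : u ≠ v := fun e => h' (congrArg Fin.val e)
    refine (Runs.copyCell hX hτ₁ (by decide) (by decide) (by decide)).mono le_rfl
      fun υ _ _ hυ => ?_
    rw [hM₁.den_keyE hR₁.base, hu7', hv8] at hυ
    simp only [pairE, WExpr.den, hu7', hv8, hR₁.input.size] at hυ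
    refine fin υ ⟨fun e => absurd e huv, fun _ hadj => ?_, fun _ hadj => ?_⟩ fun m hm => ?_
    · rw [hυ, if_pos ⟨rfl, rfl⟩]
      exact hR₁.input.val_of_adj hHG hadj
    · rw [hυ, if_pos ⟨rfl, rfl⟩]
      exact hR₁.input.val_of_not_adj hadj
    · rw [hυ, if_neg fun h => hm h.2]

/-- Squaring is done in place. An entry that was lowered earlier in the same round only improves the
upper bounds, and by the triangle inequality no entry falls below the true distance. -/
theorem runs_squareCmd (hX : Wide W X) (hw : ∀ e ∈ H.edgeSet, 0 ≤ w e) (hnN : n ≤ N)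
    {σ : State} (hσ : σ.Bounded X) (hR : Ready G H w s t P L N σ) {r x y z : ℕ} (hx : x < N)
    (hy : y < N) (hz : z < N) (hM : NamedAt r x y z σ) {R : ℕ} (h5 : σ.wvar 5 = R)
    (hnR : n ≤ 2 ^ R)
    (hlo : ∀ u v : Fin n, wdist H w u v ≤ σ.val 3 (key N r x y z u v))
    (hup : ∀ u v : Fin n, BelowWalks H w 1 u v (σ.val 3 (key N r x y z u v))) :
    Runs W X squareCmd σ (R * (n * (n * (n * (300 + 7) + 5 + 7) + 5 + 7) + 5 + 7) + 5) fun τ =>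
      ∀ u v : Fin n, τ.val 3 (key N r x y z u v) = wdist H w u v := by
  set adr : Fin n → Fin n → ℕ := fun u v => key N r x y z u v with hadr
  have inj : ∀ u v u' v', adr u v = adr u' v' → u = u' ∧ v = v' := fun u v u' v' h =>
    key_fin_inj hnN r hx hy hz h
  refine (Runs.forLoop hX hσ h5 (by decide) (by decide) (by decide)
    (fun i τ => (∀ u v, wdist H w u v ≤ τ.val 3 (adr u v)) ∧
      ∀ u v, BelowWalks H w (2 ^ i) u v (τ.val 3 (adr u v))) ⟨hlo, hup⟩ ?_).mono le_rfl ?_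
  swap
  · intro τ _ _ ⟨h1, h2⟩ u v
    exact le_antisymm ((h2 u v).le_wdist (by simpa using hnR)) (h1 u v)
  intro i hi τ₀ hτ₀ hA₀ _ ⟨i1, i2⟩
  have hR₀ := hR.agree hA₀ (by decide)
  have hM₀ := hM.agree hA₀ (by decide)
  -- The matrix at the beginning of the round, to which the upper bounds refer. The program keeps no
  -- copy of it.
  set b : Fin n → Fin n → WithTop ℝ := fun u v => τ₀.val 3 (adr u v) with hb
  set Rel := Lowers adr Set.univ (wdist H w) with hRel
  refine (Runs.forLoop_achieve hX hτ₀ hR₀.input.size (by decide) (by decide) (by decide) Rel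
    (fun u τ => ∀ v < n, ∀ x < n, ∀ (hu : u < n) (hv : v < n) (hx : x < n),
      τ.val 3 (adr ⟨u, hu⟩ ⟨v, hv⟩) ≤ b ⟨u, hu⟩ ⟨x, hx⟩ + b ⟨x, hx⟩ ⟨v, hv⟩)
    Lowers.trans (fun τ _ => Lowers.refl τ)
    (fun u τ υ h1 h2 v hv x hx hu hv' hx' => (h1.1 _).trans (h2 v hv x hx hu hv' hx'))
    ?_).mono le_rfl ?_
  swap
  · intro υ _ _ ⟨h1, h2⟩
    refine ⟨fun u v => h1.2.2 (fun u _ v _ => i1 u v) u (Set.mem_univ u) v (Set.mem_univ v),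
      fun u v => ?_⟩
    rw [pow_succ, mul_comm]
    exact BelowWalks.double i2 fun x => h2 u u.isLt v v.isLt x x.isLt u.isLt v.isLt x.isLt
  intro u₀ hu₀ τ₁ hτ₁ hA₁ hu₁ hL₁
  have hR₁ := hR₀.agree hA₁ (by decide)
  have hM₁ := hM₀.agree hA₁ (by decide)
  refine Runs.forLoop_achieve hX hτ₁ hR₁.input.size (by decide) (by decide) (by decide) Rel
    (fun v τ => ∀ x < n, ∀ (hu : u₀ < n) (hv : v < n) (hx : x < n),
      τ.val 3 (adr ⟨u₀, hu⟩ ⟨v, hv⟩) ≤ b ⟨u₀, hu⟩ ⟨x, hx⟩ + b ⟨x, hx⟩ ⟨v, hv⟩)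
    Lowers.trans (fun τ _ => Lowers.refl τ)
    (fun v τ υ h1 h2 x hx hu hv' hx' => (h1.1 _).trans (h2 x hx hu hv' hx')) ?_
  intro v₀ hv₀ τ₂ hτ₂ hA₂ hv₂ hL₂
  have hR₂ := hR₁.agree hA₂ (by decide)
  have hM₂ := hM₁.agree hA₂ (by decide)
  refine Runs.forLoop_achieve hX hτ₂ hR₂.input.size (by decide) (by decide) (by decide) Rel
    (fun x τ => ∀ (hu : u₀ < n) (hv : v₀ < n) (hx : x < n),
      τ.val 3 (adr ⟨u₀, hu⟩ ⟨v₀, hv⟩) ≤ b ⟨u₀, hu⟩ ⟨x, hx⟩ + b ⟨x, hx⟩ ⟨v₀, hv⟩)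
    Lowers.trans (fun τ _ => Lowers.refl τ)
    (fun x τ υ h1 h2 hu hv' hx' => (h1.1 _).trans (h2 hu hv' hx')) ?_
  intro x₀ hx₀ τ₃ hτ₃ hA₃ hx₃ hL₃
  have hR₃ := hR₂.agree hA₃ (by decide)
  have hM₃ := hM₂.agree hA₃ (by decide)
  have hv₃ : τ₃.wvar 8 = v₀ := (hA₃.wv 8 (by decide)).trans hv₂
  have hu₃ : τ₃.wvar 7 = u₀ := (hA₃.wv 7 (by decide)).trans ((hA₂.wv 7 (by decide)).trans hu₁)
  set u : Fin n := ⟨u₀, hu₀⟩ with hu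
  set v : Fin n := ⟨v₀, hv₀⟩ with hv
  set x' : Fin n := ⟨x₀, hx₀⟩ with hx'
  have hL : Rel τ₀ τ₃ := hL₁.trans _ _ _ (hL₂.trans _ _ _ hL₃)
  have lo₃ := hL.2.2 fun u _ v _ => i1 u v
  refine (Runs.relax hX hτ₃ (by decide) (by decide) (by decide) (by decide)).mono le_rfl
    fun υ _ _ hυ => ?_
  simp only [WExpr.den, RExpr.den, hM₃.den_keyE hR₃.base, hu₃, hv₃, hx₃, State.val_add] at hυ
  refine ⟨Lowers.of_relax inj (Set.mem_univ u) (Set.mem_univ v) (fun _ => ?_) hυ, fun _ _ _ => ?_⟩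
  · exact (wdist_triangle hw u x' v).trans (add_le_add (lo₃ u trivial x' trivial)
      (lo₃ x' trivial v trivial))
  · rw [hυ, if_pos ⟨rfl, rfl⟩]
    exact (min_le_right _ _).trans (add_le_add (hL.1 _) (hL.1 _))

/-! ### Inserting one edge into the distances of the terminals. -/

/-- The terminals are listed in array `5`. -/
structure ListedAt (S : ℕ) (tv : ℕ → Fin n) (σ : State) : Prop where
  card : σ.wvar 25 = S
  vert : ∀ q < S, σ.warr 5 q = tv q

theorem ListedAt.agree {S : ℕ} {tv : ℕ → Fin n} {p : Cmd} {σ τ : State} (h : ListedAt S tv σ)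
    (hA : Agree p σ τ) (hp : 25 ∉ p.wvs ∧ 5 ∉ p.was) : ListedAt S tv τ :=
  ⟨(hA.wv 25 hp.1).trans h.card, fun q hq => by rw [hA.wa 5 hp.2]; exact h.vert q hq⟩

theorem runs_loadCmd (hX : Wide W X) {σ : State} (hσ : σ.Bounded X) {S : ℕ} {tv : ℕ → Fin n}
    (hS : ListedAt S tv σ) {q₁ q₂ : ℕ} (h₁ : q₁ < S) (h₂ : q₂ < S) (h7 : σ.wvar 7 = q₁)
    (h8 : σ.wvar 8 = q₂) :
    Runs W X loadCmd σ 6 fun τ => τ.wvar 27 = tv q₁ ∧ τ.wvar 28 = tv q₂ ∧ τ.val = σ.val := by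
  refine Runs.of_loopless hX hσ (by decide) (by decide) ⟨hσ.2 _ _, ?_⟩ ⟨?_, ?_, rfl⟩
  · exact hσ.2 _ _
  · simp [loadCmd, Cmd.sem, WExpr.den, h7, hS.vert q₁ h₁]
  · simp [loadCmd, Cmd.sem, WExpr.den, h8, hS.vert q₂ h₂]

/-- Since `a` and `b` are terminals, all entries that are read belong to terminals. During the
updates in place they stay between the new and the old distances, so every candidate is at most the
one formed from old distances and at least the new distance. The graph `H` described by the stored
distances is independent of `H'`, the graph in the adjacency matrix. -/
theorem runs_insertCmd (hX : Wide W X) {a b : Fin n} (hab : a ≠ b)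
    (hw : ∀ e ∈ (H ⊔ SimpleGraph.edge a b).edgeSet, 0 ≤ w e) (hnN : n ≤ N)
    {G' H' : SimpleGraph (Fin n)}
    {σ : State} (hσ : σ.Bounded X) (hR : Ready G' H' w s t P L N σ) {r x y z : ℕ} (hx : x < N)
    (hy : y < N) (hz : z < N) (hM : NamedAt r x y z σ) {S : ℕ} {tv : ℕ → Fin n}
    (hS : ListedAt S tv σ) (ha : ∃ q < S, tv q = a) (hb : ∃ q < S, tv q = b)
    (h30 : σ.wvar 30 = a) (h31 : σ.wvar 31 = b) (h1 : σ.rvar 1 = w s(a, b))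
    (hd : ∀ u v, (∃ q < S, tv q = u) → (∃ q < S, tv q = v) →
      σ.val 3 (key N r x y z u v) = wdist H w u v) :
    Runs W X insertCmd σ (S * (S * (800 + 7) + 5 + 7) + 5) fun τ =>
      (∀ u v, (∃ q < S, tv q = u) → (∃ q < S, tv q = v) →
        τ.val 3 (key N r x y z u v) = wdist (H ⊔ SimpleGraph.edge a b) w u v) ∧
      ∀ m, (∀ u v : Fin n, m ≠ key N r x y z u v) → τ.val 3 m = σ.val 3 m := by
  set adr : Fin n → Fin n → ℕ := fun u v => key N r x y z u v with hadr
  have inj : ∀ u v u' v', adr u v = adr u' v' → u = u' ∧ v = v' := fun u v u' v' h =>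
    key_fin_inj hnN r hx hy hz h
  set T : Set (Fin n) := {u | ∃ q < S, tv q = u} with hT
  set H₂ := H ⊔ SimpleGraph.edge a b with hH₂
  have hanti : ∀ u v, wdist H₂ w u v ≤ wdist H w u v := wdist_anti hw le_sup_left
  set Rel := Lowers adr T (wdist H₂ w) with hRel
  set bd : Fin n → Fin n → WithTop ℝ := fun u v =>
    min (wdist H w u a + wdist H w b v + (w s(a, b) : ℝ))
      (wdist H w u b + wdist H w a v + (w s(a, b) : ℝ)) with hbd
  refine (Runs.forLoop_achieve hX hσ hS.card (by decide) (by decide) (by decide) Rel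
    (fun q₁ τ => ∀ q₂ < S, τ.val 3 (adr (tv q₁) (tv q₂)) ≤ bd (tv q₁) (tv q₂))
    Lowers.trans (fun τ _ => Lowers.refl τ)
    (fun q₁ τ υ h1 h2 q₂ hq₂ => (h1.1 _).trans (h2 q₂ hq₂)) ?_).mono le_rfl ?_
  swap
  · intro τ _ _ ⟨h1, h2⟩
    refine ⟨?_, fun m hm => h1.2.1 m fun u _ v _ => hm u v⟩
    rintro u v ⟨q₁, hq₁, rfl⟩ ⟨q₂, hq₂, rfl⟩
    refine le_antisymm (le_trans (le_min ?_ (h2 q₁ hq₁ q₂ hq₂))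
      (min_le_wdist_sup_edge hw hab _ _)) ?_
    · exact (h1.1 _).trans (hd _ _ ⟨q₁, hq₁, rfl⟩ ⟨q₂, hq₂, rfl⟩).le
    · refine h1.2.2 (fun u hu v hv => ?_) _ ⟨q₁, hq₁, rfl⟩ _ ⟨q₂, hq₂, rfl⟩
      exact (hanti u v).trans (hd u v hu hv).ge
  intro q₁ hq₁ τ₁ hτ₁ hA₁ h7₁ hL₁
  have hS₁ := hS.agree hA₁ (by decide)
  refine Runs.forLoop_achieve hX hτ₁ hS₁.card (by decide) (by decide) (by decide) Rel
    (fun q₂ τ => τ.val 3 (adr (tv q₁) (tv q₂)) ≤ bd (tv q₁) (tv q₂))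
    Lowers.trans (fun τ _ => Lowers.refl τ)
    (fun q₂ τ υ h1 h2 => (h1.1 _).trans h2) ?_
  intro q₂ hq₂ τ₂ hτ₂ hA₂ h8₂ hL₂
  have hS₂ := hS₁.agree hA₂ (by decide)
  have h7₂ : τ₂.wvar 7 = q₁ := (hA₂.wv 7 (by decide)).trans h7₁
  refine (Runs.seq (runs_loadCmd hX hτ₂ hS₂ hq₁ hq₂ h7₂ h8₂) (T₂ := 400 + 390)
    fun τ₃ hτ₃ hA₃ ⟨h27, h28, hv₃⟩ => ?_).mono (by norm_num) fun _ _ _ h => h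
  have hR₃ := ((hR.agree hA₁ (by decide)).agree hA₂ (by decide)).agree hA₃ (by decide)
  have hM₃ := ((hM.agree hA₁ (by decide)).agree hA₂ (by decide)).agree hA₃ (by decide)
  have h30₃ : τ₃.wvar 30 = a := (hA₃.wv 30 (by decide)).trans
    ((hA₂.wv 30 (by decide)).trans ((hA₁.wv 30 (by decide)).trans h30))
  have h31₃ : τ₃.wvar 31 = b := (hA₃.wv 31 (by decide)).trans
    ((hA₂.wv 31 (by decide)).trans ((hA₁.wv 31 (by decide)).trans h31))
  have h1₃ : τ₃.rvar 1 = w s(a, b) := (hA₃.rv 1 (by decide)).trans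
    ((hA₂.rv 1 (by decide)).trans ((hA₁.rv 1 (by decide)).trans h1))
  have hL₃ : Rel σ τ₃ := by
    have : Rel τ₂ τ₃ := by simp [hRel, Lowers, hv₃]
    exact hL₁.trans _ _ _ (hL₂.trans _ _ _ this)
  have hu : tv q₁ ∈ T := ⟨q₁, hq₁, rfl⟩
  have hv : tv q₂ ∈ T := ⟨q₂, hq₂, rfl⟩
  have lo : ∀ τ, Rel σ τ → ∀ u ∈ T, ∀ v ∈ T, wdist H₂ w u v ≤ τ.val 3 (adr u v) := fun τ hτ =>
    hτ.2.2 fun u hu v hv => (hanti u v).trans (hd u v hu hv).ge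
  have up : ∀ τ, Rel σ τ → ∀ u ∈ T, ∀ v ∈ T, τ.val 3 (adr u v) ≤ wdist H w u v :=
    fun τ hτ u hu v hv => (hτ.1 _).trans (hd u v hu hv).le
  refine Runs.seq (Runs.relax hX hτ₃ (by decide) (by decide) (by decide) (by decide))
    fun τ₄ hτ₄ hA₄ h₄ => ?_
  simp only [WExpr.den, RExpr.den, hM₃.den_keyE hR₃.base, h27, h28, h30₃, h31₃, h1₃,
    State.val_add_add] at h₄
  have hR₄ := hR₃.agree hA₄ (by decide)
  have hM₄ := hM₃.agree hA₄ (by decide)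
  have h27₄ := (hA₄.wv 27 (by decide)).trans h27
  have h28₄ := (hA₄.wv 28 (by decide)).trans h28
  have h30₄ := (hA₄.wv 30 (by decide)).trans h30₃
  have h31₄ := (hA₄.wv 31 (by decide)).trans h31₃
  have h1₄ := (hA₄.rv 1 (by decide)).trans h1₃
  have step₄ : Rel τ₃ τ₄ := Lowers.of_relax inj hu hv (fun _ =>
    (wdist_sup_edge_le hw hab _ _).trans (add_le_add (add_le_add (lo τ₃ hL₃ _ hu a ha)
      (lo τ₃ hL₃ b hb _ hv)) le_rfl)) h₄
  have hL₄ : Rel σ τ₄ := hL₃.trans _ _ _ step₄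
  have bd₄ : τ₄.val 3 (adr (tv q₁) (tv q₂)) ≤
      wdist H w (tv q₁) a + wdist H w b (tv q₂) + (w s(a, b) : ℝ) := by
    rw [h₄, if_pos ⟨rfl, rfl⟩]
    exact (min_le_right _ _).trans (add_le_add (add_le_add (up τ₃ hL₃ _ hu a ha)
      (up τ₃ hL₃ b hb _ hv)) le_rfl)
  refine (Runs.relax hX hτ₄ (by decide) (by decide) (by decide) (by decide)).mono le_rfl
    fun υ _ _ hυ => ?_
  simp only [WExpr.den, RExpr.den, hM₄.den_keyE hR₄.base, h27₄, h28₄, h30₄, h31₄, h1₄,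
    State.val_add_add] at hυ
  have swap : wdist H₂ w (tv q₁) (tv q₂) ≤ wdist H₂ w (tv q₁) b + wdist H₂ w a (tv q₂) +
      (w s(a, b) : ℝ) := by
    have hsym : SimpleGraph.edge a b = SimpleGraph.edge b a := SimpleGraph.edge_comm a b
    rw [hH₂, hsym, Sym2.eq_swap]
    exact wdist_sup_edge_le (by rw [← hsym]; exact hw) hab.symm _ _
  have step : Rel τ₄ υ := Lowers.of_relax inj hu hv (fun _ =>
    swap.trans (add_le_add (add_le_add (lo τ₄ hL₄ _ hu b hb) (lo τ₄ hL₄ a ha _ hv)) le_rfl)) hυ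
  refine ⟨?_, le_min ((step.1 _).trans bd₄) ?_⟩
  · have : Rel τ₂ τ₃ := by simp [hRel, Lowers, hv₃]
    exact this.trans _ _ _ (step₄.trans _ _ _ step)
  · rw [hυ, if_pos ⟨rfl, rfl⟩]
    exact (min_le_right _ _).trans (add_le_add (add_le_add (up τ₄ hL₄ _ hu b hb)
      (up τ₄ hL₄ a ha _ hv)) le_rfl)

end Matrices

end WeightedGraph

/-! ## Boxes of triples of faults -/

namespace WeightedGraph

open RealRAM

/-- The `q`-th of the positions in the blocks `x`, `y`, `z` of length `M`. -/
def boxPos (M x y z q : ℕ) : ℕ :=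
  if q < M then x * M + q else if q < M + M then y * M + (q - M) else z * M + (q - (M + M))

/-- The positions outside the blocks `x`, `y`, `z` of length `M`. -/
def offBox (M x y z : ℕ) : Set ℕ := {e | e / M ≠ x ∧ e / M ≠ y ∧ e / M ≠ z}

theorem boxPos_notMem_offBox {M x y z q : ℕ} (hq : q < 3 * M) :
    boxPos M x y z q ∉ offBox M x y z := by
  have hM : 0 < M := by omega
  have div : ∀ a d, d < M → (a * M + d) / M = a := fun a d hd => by
    rw [Nat.mul_comm, Nat.mul_add_div hM, Nat.div_eq_of_lt hd, add_zero]
  rintro ⟨h1, h2, h3⟩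
  unfold boxPos at h1 h2 h3
  split_ifs at h1 h2 h3 with h h'
  · exact h1 (div _ _ h)
  · exact h2 (div _ _ (by omega))
  · exact h3 (div _ _ (by omega))

theorem exists_boxPos {M x y z e : ℕ} (hM : 0 < M) (he : e ∉ offBox M x y z) :
    ∃ q < 3 * M, boxPos M x y z q = e := by
  have hmod := Nat.mod_lt e hM
  have hdiv := Nat.div_add_mod' e M
  have : e / M = x ∨ e / M = y ∨ e / M = z := by
    simp only [offBox, Set.mem_ofPred_eq] at he
    tauto
  rcases this with h | h | h
  · refine ⟨e % M, by omega, ?_⟩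
    rw [boxPos, if_pos hmod, ← h, hdiv]
  · refine ⟨M + e % M, by omega, ?_⟩
    rw [boxPos, if_neg (by omega), if_pos (by omega), Nat.add_sub_cancel_left, ← h, hdiv]
  · refine ⟨M + M + e % M, by omega, ?_⟩
    rw [boxPos, if_neg (by omega), if_neg (by omega), Nat.add_sub_cancel_left, ← h, hdiv]

theorem boxPos_lt {M x y z q B : ℕ} (hq : q < 3 * M) (hx : x * M + M ≤ B) (hy : y * M + M ≤ B)
    (hz : z * M + M ≤ B) : boxPos M x y z q < B := by
  unfold boxPos
  split_ifs <;> omega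

/-- A position in block `x` of length `m` lies in block `x / 2` of length `2 * m`. Edges present for
the parent are therefore present for the box, and the descent only inserts edges. -/
theorem offBox_half_subset {m x y z : ℕ} :
    offBox (2 * m) (x / 2) (y / 2) (z / 2) ⊆ offBox m x y z := by
  rintro e ⟨h1, h2, h3⟩
  rw [Nat.mul_comm, ← Nat.div_div_eq_div_mul] at h1 h2 h3
  exact ⟨fun h => h1 (by rw [h]), fun h => h2 (by rw [h]), fun h => h3 (by rw [h])⟩

section Boxes

variable {n : ℕ} {G H : SimpleGraph (Fin n)} {w : Sym2 (Fin n) → ℝ} {s t : Fin n} {W X : ℕ}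
  {P : ℕ → Fin n} {L N : ℕ}

/-! ### Terminals of a box and their enumeration. -/

/-- The endpoints of the path and of its edges in the blocks `x`, `y`, `z` of length `M`. -/
def terminals (P : ℕ → Fin n) (s t : Fin n) (M x y z : ℕ) : Set (Fin n) :=
  {u | u = s ∨ u = t ∨ ∃ e, e ∉ offBox M x y z ∧ (u = P e ∨ u = P (e + 1))}

theorem terminals_half_subset {m x y z : ℕ} :
    terminals P s t m x y z ⊆ terminals P s t (2 * m) (x / 2) (y / 2) (z / 2) := by
  rintro u (h | h | ⟨e, he, h⟩)
  exacts [.inl h, .inr (.inl h), .inr (.inr ⟨e, fun h' => he (offBox_half_subset h'), h⟩)]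

/-- The list of the terminals. -/
def boxVert (P : ℕ → Fin n) (s t : Fin n) (M x y z q : ℕ) : Fin n :=
  if q < 3 * M + 3 * M then P (boxPos M x y z (q / 2) + q % 2)
  else if q = 3 * M + 3 * M then s else t

theorem boxVert_even {M x y z q : ℕ} (hq : q < 3 * M) :
    boxVert P s t M x y z (q + q) = P (boxPos M x y z q) := by
  rw [boxVert, if_pos (by omega), show (q + q) / 2 = q by omega, show (q + q) % 2 = 0 by omega,
    add_zero]

theorem boxVert_odd {M x y z q : ℕ} (hq : q < 3 * M) :
    boxVert P s t M x y z (q + q + 1) = P (boxPos M x y z q + 1) := by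
  rw [boxVert, if_pos (by omega), show (q + q + 1) / 2 = q by omega,
    show (q + q + 1) % 2 = 1 by omega]

theorem mem_terminals_iff {M x y z : ℕ} (hM : 0 < M) {u : Fin n} :
    u ∈ terminals P s t M x y z ↔ ∃ q < 3 * M + 3 * M + 2, boxVert P s t M x y z q = u := by
  constructor
  · rintro (rfl | rfl | ⟨e, he, h⟩)
    · exact ⟨3 * M + 3 * M, by omega, by simp [boxVert]⟩
    · exact ⟨3 * M + 3 * M + 1, by omega, by simp [boxVert]⟩
    · obtain ⟨q, hq, rfl⟩ := exists_boxPos hM he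
      rcases h with rfl | rfl
      exacts [⟨q + q, by omega, boxVert_even hq⟩, ⟨q + q + 1, by omega, boxVert_odd hq⟩]
  · rintro ⟨q, hq, rfl⟩
    unfold boxVert
    split_ifs with h h'
    · refine .inr (.inr ⟨_, boxPos_notMem_offBox (q := q / 2) (by omega), ?_⟩)
      rcases Nat.mod_two_eq_zero_or_one q with h | h <;> simp [h]
    · exact .inl rfl
    · exact .inr (.inl rfl)

/-- The numbers that describe a level and the parent `(x, y, z)` of a box are in place. -/
structure BoxAt (m x y z : ℕ) (σ : State) : Prop where
  fst : σ.wvar 18 = x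
  snd : σ.wvar 19 = y
  trd : σ.wvar 20 = z
  double : σ.wvar 21 = 2 * m
  half : σ.wvar 23 = m
  edges : σ.wvar 24 = 3 * (2 * m)
  verts : σ.wvar 25 = 3 * (2 * m) + 3 * (2 * m) + 2

theorem BoxAt.agree {m x y z : ℕ} {p : Cmd} {σ τ : State} (h : BoxAt m x y z σ)
    (hA : Agree p σ τ) (hp : 18 ∉ p.wvs ∧ 19 ∉ p.wvs ∧ 20 ∉ p.wvs ∧ 21 ∉ p.wvs ∧ 23 ∉ p.wvs ∧
      24 ∉ p.wvs ∧ 25 ∉ p.wvs) : BoxAt m x y z τ :=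
  ⟨(hA.wv 18 hp.1).trans h.fst, (hA.wv 19 hp.2.1).trans h.snd, (hA.wv 20 hp.2.2.1).trans h.trd,
    (hA.wv 21 hp.2.2.2.1).trans h.double, (hA.wv 23 hp.2.2.2.2.1).trans h.half,
    (hA.wv 24 hp.2.2.2.2.2.1).trans h.edges, (hA.wv 25 hp.2.2.2.2.2.2).trans h.verts⟩

theorem runs_listCmd (hX : Wide W X) {σ : State} (hσ : σ.Bounded X)
    (hR : Ready G H w s t P L N σ) {m x y z : ℕ} (hB : BoxAt m x y z σ)
    (hx : x * (2 * m) + 2 * m ≤ X) (hy : y * (2 * m) + 2 * m ≤ X)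
    (hz : z * (2 * m) + 2 * m ≤ X) :
    Runs W X listCmd σ (((3 * (2 * m)) * (70 + 7) + 5) + 12) fun τ =>
      ListedAt (3 * (2 * m) + 3 * (2 * m) + 2) (boxVert P s t (2 * m) x y z) τ ∧
      ∀ q < 3 * (2 * m), τ.warr 6 q = boxPos (2 * m) x y z q := by
  have hdbl := hB.double
  have hedg := hB.edges
  have hver := hB.verts
  generalize 2 * m = M at hx hy hz hdbl hedg hver ⊢
  refine Runs.seq (Runs.forLoop hX hσ hedg (by decide) (by decide) (by decide) (T := 70)
    (fun k τ => (∀ q < k, τ.warr 6 q = boxPos M x y z q) ∧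
      ∀ q < k + k, τ.warr 5 q = boxVert P s t M x y z q)
    ⟨fun q hq => absurd hq (Nat.not_lt_zero q), fun q hq => absurd hq (Nat.not_lt_zero q)⟩ ?_) ?_
  · intro k hk τ hτ hA hk7 ⟨i1, i2⟩
    have hBτ := hB.agree hA (by decide)
    have hRτ := hR.agree hA (by decide)
    have hdbl' : τ.wvar 21 = M := (hA.wv 21 (by decide)).trans hdbl
    have hbd := boxPos_lt hk hx hy hz
    refine (Runs.seq (R := fun υ => υ.wvar 26 = boxPos M x y z k ∧ υ.warr = τ.warr) (T₁ := 30)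
      (T₂ := 40) ?_ ?_).mono (by norm_num) fun _ _ _ h => h
    · refine Runs.ite (T := 25) hX hτ (by decide) (by decide) (fun h => ?_) (fun h => ?_)
      · simp only [Cond.den, WExpr.den, hk7, hdbl'] at h
        have e : boxPos M x y z k = x * M + k := by rw [boxPos, if_pos h]
        refine Runs.of_loopless hX hτ (by decide) (by decide) ?_ ⟨?_, rfl⟩
        · simp only [Cmd.Safe, WExpr.den, hk7, hdbl', hBτ.fst]
          omega
        · simp [Cmd.sem, WExpr.den, hk7, hdbl', hBτ.fst, e]
      simp only [Cond.den, WExpr.den, hk7, hdbl'] at h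
      refine Runs.ite (T := 15) hX hτ (by decide) (by decide) (fun h' => ?_) (fun h' => ?_)
      · simp only [Cond.den, WExpr.den, hk7, hdbl'] at h'
        have e : boxPos M x y z k = y * M + (k - M) := by rw [boxPos, if_neg h, if_pos h']
        refine Runs.of_loopless hX hτ (by decide) (by decide) ?_ ⟨?_, rfl⟩
        · simp only [Cmd.Safe, WExpr.den, hk7, hdbl', hBτ.snd]
          omega
        · simp [Cmd.sem, WExpr.den, hk7, hdbl', hBτ.snd, e]
      · simp only [Cond.den, WExpr.den, hk7, hdbl'] at h'
        have e : boxPos M x y z k = z * M + (k - (M + M)) := by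
          rw [boxPos, if_neg h, if_neg h']
        refine Runs.of_loopless hX hτ (by decide) (by decide) ?_ ⟨?_, rfl⟩
        · simp only [Cmd.Safe, WExpr.den, hk7, hdbl', hBτ.trd]
          omega
        · simp [Cmd.sem, WExpr.den, hk7, hdbl', hBτ.trd, e]
    intro τ₁ hτ₁ hA₁ ⟨h26, hw₁⟩
    have hR₁ := hRτ.agree hA₁ (by decide)
    have hk7' : τ₁.wvar 7 = k := (hA₁.wv 7 (by decide)).trans hk7
    refine Runs.of_loopless hX hτ₁ (by decide) (by decide) ⟨hτ₁.1 26, hτ₁.2 _ _, ?_⟩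
      ⟨fun q hq => ?_, fun q hq => ?_⟩
    · simp only [WExpr.den, Cmd.sem, State.putW_warr, State.putW_wvar]
      split_ifs <;> exact hτ₁.2 _ _
    · simp only [Cmd.sem, WExpr.den, State.setW_warr, State.putW_warr, State.putW_wvar, hk7', h26,
        hw₁]
      by_cases hqk : q = k
      · simp [hqk]
      · simpa [hqk] using i1 q (by omega)
    · simp only [Cmd.sem, WExpr.den, State.setW_warr, State.putW_warr, State.putW_wvar, hk7', h26,
        hR₁.path.vert]
      by_cases h1 : q = k + k + 1
      · simp [h1, boxVert_odd hk]
      · by_cases h2 : q = k + k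
        · simp [h2, boxVert_even hk]
        · simpa [h1, h2, hw₁] using i2 q (by omega)
  · intro τ hτ hA ⟨i1, i2⟩
    have hedg' : τ.wvar 24 = 3 * M := (hA.wv 24 (by decide)).trans hedg
    have hRτ := hR.agree hA (by decide)
    refine Runs.of_loopless hX hτ (by decide) (by decide) ⟨hτ.1 1, hτ.1 2⟩
      ⟨⟨(hA.wv 25 (by decide)).trans hver, fun q hq => ?_⟩, i1⟩
    simp only [Cmd.sem, WExpr.den, State.putW_warr, State.putW_wvar, hedg',
      hRτ.input.source, hRτ.input.target, true_and]
    by_cases h1 : q = 3 * M + 3 * M + 1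
    · simp [h1, boxVert]
    · by_cases h2 : q = 3 * M + 3 * M
      · simp [h2, boxVert]
      · rw [if_neg h1, if_neg h2]
        exact i2 q (by omega)

theorem runs_inheritCmd (hX : Wide W X) (hnN : n ≤ N) {σ : State} (hσ : σ.Bounded X)
    (hR : Ready G H w s t P L N σ) {r x y z m a b c : ℕ} (hx : x < N) (hy : y < N) (hz : z < N)
    (hM : NamedAt r x y z σ) (hB : BoxAt m a b c σ) (ha : a < N) (hb : b < N) (hc : c < N)
    (h17 : σ.wvar 17 = r + 1) {S : ℕ} {tv : ℕ → Fin n} (hS : ListedAt S tv σ) :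
    Runs W X inheritCmd σ (S * (S * (150 + 7) + 5 + 7) + 5) fun τ =>
      (∀ u v, (∃ q < S, tv q = u) → (∃ q < S, tv q = v) →
        τ.val 3 (key N r x y z u v) = σ.val 3 (key N (r + 1) a b c u v)) ∧
      ∀ m, (∀ u v : Fin n, m ≠ key N r x y z u v) → τ.val 3 m = σ.val 3 m := by
  set D : Fin n → Fin n → WithTop ℝ := fun u v => σ.val 3 (key N (r + 1) a b c u v) with hD
  set Rel : State → State → Prop := fun τ υ =>
    (∀ u v : Fin n, τ.val 3 (key N r x y z u v) = D u v → υ.val 3 (key N r x y z u v) = D u v) ∧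
    ∀ m, (∀ u v : Fin n, m ≠ key N r x y z u v) → υ.val 3 m = τ.val 3 m with hRel
  have rtrans : ∀ τ υ ρ, Rel τ υ → Rel υ ρ → Rel τ ρ := fun τ υ ρ h1 h2 =>
    ⟨fun u v h => h2.1 u v (h1.1 u v h), fun m hm => (h2.2 m hm).trans (h1.2 m hm)⟩
  refine (Runs.forLoop_achieve hX hσ hS.card (by decide) (by decide) (by decide) Rel
    (fun q₁ τ => ∀ q₂ < S, τ.val 3 (key N r x y z (tv q₁) (tv q₂)) = D (tv q₁) (tv q₂))
    rtrans (fun _ _ => ⟨fun _ _ h => h, fun _ _ => rfl⟩)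
    (fun q₁ τ υ h1 h2 q₂ hq₂ => h1.1 _ _ (h2 q₂ hq₂)) ?_).mono
    le_rfl ?_
  swap
  · rintro τ _ _ ⟨h1, h2⟩
    refine ⟨?_, h1.2⟩
    rintro u v ⟨q₁, hq₁, rfl⟩ ⟨q₂, hq₂, rfl⟩
    exact h2 q₁ hq₁ q₂ hq₂
  intro q₁ hq₁ τ₁ hτ₁ hA₁ h7₁ hL₁
  have hS₁ := hS.agree hA₁ (by decide)
  refine Runs.forLoop_achieve hX hτ₁ hS₁.card (by decide) (by decide) (by decide) Rel
    (fun q₂ τ => τ.val 3 (key N r x y z (tv q₁) (tv q₂)) = D (tv q₁) (tv q₂))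
    rtrans (fun _ _ => ⟨fun _ _ h => h, fun _ _ => rfl⟩) (fun q₂ τ υ h1 h2 => h1.1 _ _ h2) ?_
  intro q₂ hq₂ τ₂ hτ₂ hA₂ h8₂ hL₂
  have hS₂ := hS₁.agree hA₂ (by decide)
  have h7₂ : τ₂.wvar 7 = q₁ := (hA₂.wv 7 (by decide)).trans h7₁
  refine (Runs.seq (runs_loadCmd hX hτ₂ hS₂ hq₁ hq₂ h7₂ h8₂) (T₂ := 140)
    fun τ₃ hτ₃ hA₃ ⟨h27, h28, hv₃⟩ => ?_).mono (by norm_num) fun _ _ _ h => h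
  have hR₃ := ((hR.agree hA₁ (by decide)).agree hA₂ (by decide)).agree hA₃ (by decide)
  have hM₃ := ((hM.agree hA₁ (by decide)).agree hA₂ (by decide)).agree hA₃ (by decide)
  have hB₃ := ((hB.agree hA₁ (by decide)).agree hA₂ (by decide)).agree hA₃ (by decide)
  have h17₃ : τ₃.wvar 17 = r + 1 := (hA₃.wv 17 (by decide)).trans
    ((hA₂.wv 17 (by decide)).trans ((hA₁.wv 17 (by decide)).trans h17))
  refine (Runs.copyCell hX hτ₃ (by decide) (by decide) (by decide)).mono le_rfl fun υ _ _ hυ => ?_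
  have den : (keyE 17 18 19 20 27 28).den τ₃ = key N (r + 1) a b c (tv q₁) (tv q₂) := by
    simp [keyE, WExpr.den, key, h17₃, hB₃.fst, hB₃.snd, hB₃.trd, hR₃.base, h27, h28]
  rw [den, hM₃.den_keyE hR₃.base, h27, h28, hv₃] at hυ
  -- Writing takes place at level `r` only, so the parent's entries at level `r + 1` are still
  -- intact.
  have same : τ₂.val 3 (key N (r + 1) a b c (tv q₁) (tv q₂)) = D (tv q₁) (tv q₂) :=
    (rtrans _ _ _ hL₁ hL₂).2 _ fun u v h => by
      have := (key_inj ha hb hc (by omega) (by omega) hx hy hz (by omega) (by omega) h).1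
      omega
  rw [same] at hυ
  refine ⟨⟨fun u v h => ?_, fun m hm => ?_⟩, ?_⟩
  · rw [hυ]
    split_ifs with h'
    · obtain ⟨rfl, rfl⟩ := key_fin_inj hnN r hx hy hz h'.2
      rfl
    · exact h
  · rw [hυ, if_neg fun h' => hm _ _ h'.2]
  · rw [hυ, if_pos ⟨rfl, rfl⟩]

/-- The `k`-th listed edge has the terminals numbered `2k` and `2k + 1` as endpoints, which makes
`runs_insertCmd` applicable. If blocks coincide, an edge is listed repeatedly. This does no harm,
because the update formula does not require the edge to be new. -/
theorem runs_growCmd (hX : Wide W X) (hw : ∀ e ∈ G.edgeSet, 0 ≤ w e)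
    (hP : ∀ i < L, G.Adj (P i) (P (i + 1))) (hnN : n ≤ N)
    {σ : State} (hσ : σ.Bounded X) (hR : Ready G H w s t P L N σ) {r x y z m a b c : ℕ}
    (hx : x < N) (hy : y < N) (hz : z < N) (hM : NamedAt r x y z σ) (hB : BoxAt m a b c σ)
    (hS : ListedAt (3 * (2 * m) + 3 * (2 * m) + 2) (boxVert P s t (2 * m) a b c) σ)
    (h6 : ∀ q < 3 * (2 * m), σ.warr 6 q = boxPos (2 * m) a b c q) (Y : Set ℕ)
    (hd : ∀ u v, (∃ q < 3 * (2 * m) + 3 * (2 * m) + 2, boxVert P s t (2 * m) a b c q = u) →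
      (∃ q < 3 * (2 * m) + 3 * (2 * m) + 2, boxVert P s t (2 * m) a b c q = v) →
      σ.val 3 (key N r x y z u v) = wdist (switch G P L Y) w u v) :
    Runs W X growCmd σ ((3 * (2 * m)) * ((3 + (((3 * (2 * m) + 3 * (2 * m) + 2) *
      ((3 * (2 * m) + 3 * (2 * m) + 2) * (800 + 7) + 5 + 7) + 5) + 50)) + 7) + 5) fun τ =>
      (∀ u v, (∃ q < 3 * (2 * m) + 3 * (2 * m) + 2, boxVert P s t (2 * m) a b c q = u) →
        (∃ q < 3 * (2 * m) + 3 * (2 * m) + 2, boxVert P s t (2 * m) a b c q = v) →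
        τ.val 3 (key N r x y z u v) = wdist (switch G P L (Y ∪ {e | e ∈ offBox m x y z ∧
          ∃ q < 3 * (2 * m), boxPos (2 * m) a b c q = e})) w u v) ∧
      ∀ m, (∀ u v : Fin n, m ≠ key N r x y z u v) → τ.val 3 m = σ.val 3 m := by
  set S := 3 * (2 * m) + 3 * (2 * m) + 2 with hSdef
  set tv := boxVert P s t (2 * m) a b c with htv
  set Z : ℕ → Set ℕ := fun k => Y ∪ {e | e ∈ offBox m x y z ∧
    ∃ q < k, boxPos (2 * m) a b c q = e} with hZ
  refine Runs.forLoop hX hσ hB.edges (by decide) (by decide) (by decide)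
    (fun k τ => (∀ u v, (∃ q < S, tv q = u) → (∃ q < S, tv q = v) →
        τ.val 3 (key N r x y z u v) = wdist (switch G P L (Z k)) w u v) ∧
      ∀ m, (∀ u v : Fin n, m ≠ key N r x y z u v) → τ.val 3 m = σ.val 3 m)
    ⟨?_, fun _ _ => rfl⟩ ?_
  · have : Z 0 = Y := by ext e; simp [hZ]
    rw [this]
    exact hd
  intro k hk τ hτ hA hk9 ⟨i1, i2⟩
  set e := boxPos (2 * m) a b c k with he
  have hS' := hS.agree hA (by decide)
  have hZs : ∀ i, i ∈ Z (k + 1) ↔ i ∈ Z k ∨ (i = e ∧ e ∈ offBox m x y z) := by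
    intro i
    simp only [hZ, Set.mem_union, Set.mem_ofPred_eq]
    constructor
    · rintro (h | ⟨h, q, hq, hqe⟩)
      · exact .inl (.inl h)
      · rcases Nat.lt_succ_iff_lt_or_eq.1 hq with hq | rfl
        · exact .inl (.inr ⟨h, q, hq, hqe⟩)
        · exact .inr ⟨hqe.symm, he ▸ hqe ▸ h⟩
    · rintro ((h | ⟨h, q, hq, hqe⟩) | ⟨rfl, h⟩)
      · exact .inl h
      · exact .inr ⟨h, q, by omega, hqe⟩
      · exact .inr ⟨h, k, by omega, rfl⟩
  refine Runs.seq (R := fun υ => υ.wvar 26 = e ∧ υ.val = τ.val) (T₁ := 3)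
    (Runs.of_loopless hX hτ (by decide) (by decide) (hτ.2 _ _) ⟨?_, rfl⟩) ?_
  · simp only [Cmd.sem, WExpr.den, State.setW_wvar, if_true, hk9]
    rw [hA.wa 6 (by decide)]
    exact h6 k hk
  intro τ₁ hτ₁ hA₁ ⟨h26, hv₁⟩
  have hR₁ := (hR.agree hA (by decide)).agree hA₁ (by decide)
  have hM₁ := (hM.agree hA (by decide)).agree hA₁ (by decide)
  have hB₁ := (hB.agree hA (by decide)).agree hA₁ (by decide)
  have hS₁ := hS'.agree hA₁ (by decide)
  -- Nothing is inserted for padding positions beyond the path and for positions in the blocks of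
  -- the box itself.
  have skip : ∀ {T}, 1 ≤ T → (e < L → e ∉ offBox m x y z) → Runs W X .skip τ₁ T fun υ =>
      (∀ u v, (∃ q < S, tv q = u) → (∃ q < S, tv q = v) →
        (υ.setW 9 (k + 1)).val 3 (key N r x y z u v) = wdist (switch G P L (Z (k + 1))) w u v) ∧
      ∀ m, (∀ u v : Fin n, m ≠ key N r x y z u v) →
        (υ.setW 9 (k + 1)).val 3 m = σ.val 3 m := by
    intro T hT h
    have hc : switch G P L (Z (k + 1)) = switch G P L (Z k) := switch_congr fun i hi => by
      rw [hZs]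
      exact ⟨fun h' => h'.elim id fun h' => absurd h'.2 (h (h'.1 ▸ hi)), .inl⟩
    rw [hc]
    refine Runs.of_loopless hX hτ₁ rfl hT trivial ⟨fun u v hu hv => ?_, fun m hm => ?_⟩
    · exact (congrFun (congrFun hv₁ 3) _).trans (i1 u v hu hv)
    · exact (congrFun (congrFun hv₁ 3) _).trans (i2 m hm)
  refine Runs.ite (T := (S * (S * (800 + 7) + 5 + 7) + 5) + 45) hX hτ₁ (by decide)
    (by simp only [Cond.cost, WExpr.cost]; omega) (fun hL => ?_) (fun hL => skip (by omega) ?_)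
  swap
  · simp only [Cond.den, WExpr.den, h26, hR₁.path.length] at hL
    exact fun h => absurd h hL
  simp only [Cond.den, WExpr.den, h26, hR₁.path.length] at hL
  refine Runs.ite (T := (S * (S * (800 + 7) + 5 + 7) + 5) + 38) hX hτ₁ (by decide)
    (by simp only [Cond.cost, WExpr.cost]; omega) (fun h1 => skip (by omega) ?_) (fun h1 => ?_)
  · simp only [Cond.den, WExpr.den, h26, hB₁.half, hM₁.fst] at h1
    exact fun _ h => h.1 h1
  simp only [Cond.den, WExpr.den, h26, hB₁.half, hM₁.fst] at h1
  refine Runs.ite (T := (S * (S * (800 + 7) + 5 + 7) + 5) + 31) hX hτ₁ (by decide)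
    (by simp only [Cond.cost, WExpr.cost]; omega) (fun h2 => skip (by omega) ?_) (fun h2 => ?_)
  · simp only [Cond.den, WExpr.den, h26, hB₁.half, hM₁.snd] at h2
    exact fun _ h => h.2.1 h2
  simp only [Cond.den, WExpr.den, h26, hB₁.half, hM₁.snd] at h2
  refine Runs.ite (T := 20 + (S * (S * (800 + 7) + 5 + 7) + 5)) hX hτ₁ (by decide)
    (by simp only [Cond.cost, WExpr.cost]; omega) (fun h3 => skip (by omega) ?_) (fun h3 => ?_)
  · simp only [Cond.den, WExpr.den, h26, hB₁.half, hM₁.trd] at h3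
    exact fun _ h => h.2.2 h3
  simp only [Cond.den, WExpr.den, h26, hB₁.half, hM₁.trd] at h3
  have hoff : e ∈ offBox m x y z := ⟨h1, h2, h3⟩
  have hadj := hP e hL
  have hsw : switch G P L (Z (k + 1)) =
      switch G P L (Z k) ⊔ SimpleGraph.edge (P e) (P (e + 1)) := by
    rw [← switch_insert hL]
    refine switch_congr fun i _ => ?_
    rw [hZs, Set.mem_insert_iff, or_comm]
    simp [hoff]
  refine Runs.seq (R := fun υ => υ.wvar 30 = P e ∧ υ.wvar 31 = P (e + 1) ∧
      υ.rvar 1 = w s(P e, P (e + 1)) ∧ υ.val = τ₁.val) (T₁ := 20)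
    (Runs.of_loopless hX hτ₁ (by decide) (by decide) ⟨hτ₁.2 _ _, ?_, trivial⟩ ⟨?_, ?_, ?_, rfl⟩)
    fun τ₂ hτ₂ hA₂ ⟨h30, h31, hr1, hv₂⟩ => ?_
  · exact hτ₁.2 _ _
  · simp [Cmd.sem, WExpr.den, h26, hR₁.path.vert]
  · simp [Cmd.sem, WExpr.den, h26, hR₁.path.vert]
  · simp [Cmd.sem, WExpr.den, RExpr.den, pairE, h26, hR₁.path.vert, hR₁.input.size]
    exact hR₁.input.wt _ _ hadj
  have hv : τ₂.val = τ.val := hv₂.trans hv₁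
  refine (runs_insertCmd (H := switch G P L (Z k)) hX hadj.ne ?_ hnN hτ₂
    (hR₁.agree hA₂ (by decide)) hx hy hz (hM₁.agree hA₂ (by decide)) (hS₁.agree hA₂ (by decide))
    ⟨k + k, by omega, boxVert_even hk⟩ ⟨k + k + 1, by omega, boxVert_odd hk⟩ h30 h31 hr1
    (fun u v hu hv' => by rw [hv]; exact i1 u v hu hv')).mono le_rfl ?_
  · rw [← hsw]
    exact fun e he => hw e (SimpleGraph.edgeSet_mono (switch_le hP _) he)
  · intro υ _ _ ⟨h1, h2⟩
    rw [hsw]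
    exact ⟨h1, fun m hm => (h2 m hm).trans (by rw [hv]; exact i2 m hm)⟩

end Boxes

end WeightedGraph

/-! ## The levels -/

namespace WeightedGraph

open RealRAM

section Levels

variable {n : ℕ} {G H : SimpleGraph (Fin n)} {w : Sym2 (Fin n) → ℝ} {s t : Fin n} {W X : ℕ}
  {P : ℕ → Fin n} {L N : ℕ}

/-- The distances of the terminals of the box `(x, y, z)` with blocks of length `m` are stored at
level `r`. -/
def BoxSolved (G : SimpleGraph (Fin n)) (w : Sym2 (Fin n) → ℝ) (s t : Fin n) (P : ℕ → Fin n)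
    (L N r m x y z : ℕ) (σ : State) : Prop :=
  ∀ u ∈ terminals P s t m x y z, ∀ v ∈ terminals P s t m x y z,
    σ.val 3 (key N r x y z u v) = wdist (switch G P L (offBox m x y z)) w u v

/-- The distances are stored for all boxes of level `r`, which have `K` blocks of length `m`. -/
def LevelSolved (G : SimpleGraph (Fin n)) (w : Sym2 (Fin n) → ℝ) (s t : Fin n) (P : ℕ → Fin n)
    (L N r m K : ℕ) (σ : State) : Prop :=
  ∀ x < K, ∀ y < K, ∀ z < K, BoxSolved G w s t P L N r m x y z σ

/-- The numbers that describe a level are in place. -/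
structure LevelAt (r m : ℕ) (σ : State) : Prop where
  level : σ.wvar 13 = r
  parent : σ.wvar 17 = r + 1
  double : σ.wvar 21 = 2 * m
  half : σ.wvar 23 = m
  edges : σ.wvar 24 = 3 * (2 * m)
  verts : σ.wvar 25 = 3 * (2 * m) + 3 * (2 * m) + 2

theorem LevelAt.agree {r m : ℕ} {p : Cmd} {σ τ : State} (h : LevelAt r m σ) (hA : Agree p σ τ)
    (hp : 13 ∉ p.wvs ∧ 17 ∉ p.wvs ∧ 21 ∉ p.wvs ∧ 23 ∉ p.wvs ∧ 24 ∉ p.wvs ∧ 25 ∉ p.wvs) :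
    LevelAt r m τ :=
  ⟨(hA.wv 13 hp.1).trans h.level, (hA.wv 17 hp.2.1).trans h.parent,
    (hA.wv 21 hp.2.2.1).trans h.double, (hA.wv 23 hp.2.2.2.1).trans h.half,
    (hA.wv 24 hp.2.2.2.2.1).trans h.edges, (hA.wv 25 hp.2.2.2.2.2).trans h.verts⟩

/-- There are at most `6m` insertions, each updating the pairs of at most `14m` terminals. Lower
powers of `m` are absorbed into `m ^ 3` because `m` is positive. -/
theorem box_cost_le {m S : ℕ} (hm : 0 < m) (hS : S = 3 * (2 * m) + 3 * (2 * m) + 2) :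
    12 + ((((3 * (2 * m)) * (70 + 7) + 5) + 12) + ((S * (S * (150 + 7) + 5 + 7) + 5) +
      ((3 * (2 * m)) * ((3 + ((S * (S * (800 + 7) + 5 + 7) + 5) + 50)) + 7) + 5))) ≤
      1000000 * m ^ 3 := by
  have hS' : S ≤ 14 * m := by omega
  have h1 : m ≤ m ^ 3 := Nat.le_self_pow (by norm_num) m
  have h2 : m ^ 2 ≤ m ^ 3 := Nat.pow_le_pow_right hm (by norm_num)
  calc _ ≤ 12 + ((((3 * (2 * m)) * (70 + 7) + 5) + 12) +
        (((14 * m) * ((14 * m) * (150 + 7) + 5 + 7) + 5) + ((3 * (2 * m)) *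
          ((3 + (((14 * m) * ((14 * m) * (800 + 7) + 5 + 7) + 5) + 50)) + 7) + 5))) := by gcongr
    _ = 949032 * m ^ 3 + 31780 * m ^ 2 + 1020 * m + 39 := by ring
    _ ≤ _ := by omega

theorem runs_boxCmd (hX : Wide W X) (hw : ∀ e ∈ G.edgeSet, 0 ≤ w e)
    (hP : ∀ i < L, G.Adj (P i) (P (i + 1))) (hnN : n ≤ N) (hNX : N ≤ X)
    {σ : State} (hσ : σ.Bounded X) (hR : Ready G H w s t P L N σ) {r x y z m K : ℕ} (hm : 0 < m)
    (hK : K * (2 * m) = N) (hx : x < 2 * K) (hy : y < 2 * K) (hz : z < 2 * K)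
    (hM : NamedAt r x y z σ) (hL : LevelAt r m σ)
    (hs : LevelSolved G w s t P L N (r + 1) (2 * m) K σ) :
    Runs W X boxCmd σ (1000000 * m ^ 3) fun τ => BoxSolved G w s t P L N r m x y z τ ∧
      ∀ i, (∀ u v : Fin n, i ≠ key N r x y z u v) → τ.val 3 i = σ.val 3 i := by
  have hKN : 2 * K ≤ N := by nlinarith
  set a := x / 2 with ha
  set b := y / 2 with hb
  set c := z / 2 with hc
  have bound : ∀ a < K, a * (2 * m) + 2 * m ≤ X := fun a h => by
    calc a * (2 * m) + 2 * m = (a + 1) * (2 * m) := by ring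
      _ ≤ K * (2 * m) := Nat.mul_le_mul_right _ h
      _ ≤ X := hK ▸ hNX
  have haK : a < K := by omega
  have hbK : b < K := by omega
  have hcK : c < K := by omega
  set S := 3 * (2 * m) + 3 * (2 * m) + 2 with hS
  have xX : x ≤ X := by omega
  have yX : y ≤ X := by omega
  have zX : z ≤ X := by omega
  refine (Runs.seq (R := fun τ => τ.wvar 18 = a ∧ τ.wvar 19 = b ∧ τ.wvar 20 = c ∧ τ.val = σ.val)
    (T₁ := 12) (Runs.of_loopless hX hσ (by decide) (by decide) ?_ ?_)
    fun τ hτ hA ⟨h18, h19, h20, hv⟩ => ?_).mono (box_cost_le hm hS) fun _ _ _ h => h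
  · simp only [Cmd.Safe, Cmd.sem, WExpr.den, State.setW_wvar, hM.fst, hM.snd, hM.trd]
    simp only [show (15 : ℕ) ≠ 18 by decide, show (16 : ℕ) ≠ 18 by decide,
      show (16 : ℕ) ≠ 19 by decide, if_false]
    omega
  · simp [Cmd.sem, WExpr.den, hM.fst, hM.snd, hM.trd, ha, hb, hc]
    rfl
  have hL₁ := hL.agree hA (by decide)
  have hB₁ : BoxAt m a b c τ := ⟨h18, h19, h20, hL₁.double, hL₁.half, hL₁.edges, hL₁.verts⟩
  have hR₁ := hR.agree hA (by decide)
  have hM₁ := hM.agree hA (by decide)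
  refine Runs.seq (runs_listCmd hX hτ hR₁ hB₁ (bound a haK) (bound b hbK) (bound c hcK))
    fun τ₂ hτ₂ hA₂ ⟨hS₂, h6₂⟩ => ?_
  have hB₂ := hB₁.agree hA₂ (by decide)
  have hR₂ := hR₁.agree hA₂ (by decide)
  have hM₂ := hM₁.agree hA₂ (by decide)
  have hv₂ : ∀ i, τ₂.val 3 i = σ.val 3 i := fun i => by
    rw [← hv]
    simp only [State.val, hA₂.wa 3 (by decide), hA₂.ra 3 (by decide)]
  refine Runs.seq (runs_inheritCmd hX hnN hτ₂ hR₂ (by omega) (by omega) (by omega) hM₂ hB₂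
    (by omega) (by omega) (by omega) ((hA₂.wv 17 (by decide)).trans hL₁.parent) hS₂)
    fun τ₃ hτ₃ hA₃ ⟨h₃, h₃'⟩ => ?_
  have hd : ∀ u v, (∃ q < S, boxVert P s t (2 * m) a b c q = u) →
      (∃ q < S, boxVert P s t (2 * m) a b c q = v) →
      τ₃.val 3 (key N r x y z u v) = wdist (switch G P L (offBox (2 * m) a b c)) w u v :=
    fun u v hu hv => by
      rw [h₃ u v hu hv, hv₂]
      exact hs a haK b hbK c hcK u ((mem_terminals_iff (by omega)).2 hu) v
        ((mem_terminals_iff (by omega)).2 hv)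
  refine (runs_growCmd hX hw hP hnN hτ₃ (hR₂.agree hA₃ (by decide)) (by omega) (by omega)
    (by omega) (hM₂.agree hA₃ (by decide)) (hB₂.agree hA₃ (by decide))
    (hS₂.agree hA₃ (by decide))
    (fun q hq => by rw [hA₃.wa 6 (by decide)]; exact h6₂ q hq) _ hd).mono le_rfl
    fun υ _ _ ⟨h1, h2⟩ => ⟨fun u hu v hv => ?_, fun i hi => ?_⟩
  · rw [h1 u v ((mem_terminals_iff (by omega)).1 (terminals_half_subset hu))
      ((mem_terminals_iff (by omega)).1 (terminals_half_subset hv))]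
    congr 1
    -- What is absent for the parent lies in its blocks and hence in its list. Adding the listed
    -- positions outside the box's own blocks therefore gives all positions outside these blocks.
    refine switch_congr fun i _ => ⟨?_, fun hi => ?_⟩
    · rintro (h | h)
      exacts [offBox_half_subset h, h.1]
    · by_cases h : i ∈ offBox (2 * m) a b c
      · exact .inl h
      · exact .inr ⟨hi, exists_boxPos (by omega) h⟩
  · rw [h2 i hi, h₃' i hi, hv₂]

theorem runs_levelCmd (hX : Wide W X) (hw : ∀ e ∈ G.edgeSet, 0 ≤ w e)
    (hP : ∀ i < L, G.Adj (P i) (P (i + 1))) (hn : 0 < n) (hnN : n ≤ N) (hNX : 6 * N + 2 ≤ X)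
    {σ : State} (hσ : σ.Bounded X) (hR : Ready G H w s t P L N σ) {r m K : ℕ} (hm : 0 < m)
    (hK : K * (2 * m) = N) (h13 : σ.wvar 13 = r + 1) (h21 : σ.wvar 21 = 2 * m)
    (h22 : σ.wvar 22 = K) (hs : LevelSolved G w s t P L N (r + 1) (2 * m) K σ) :
    Runs W X levelCmd σ (1000200 * N ^ 3) fun τ => τ.wvar 13 = r ∧ τ.wvar 21 = m ∧
      τ.wvar 22 = 2 * K ∧ LevelSolved G w s t P L N r m (2 * K) τ := by
  have hKN : 2 * K ≤ N := by nlinarith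
  have hK0 : 0 < K := Nat.pos_of_ne_zero fun h => by subst h; omega
  have hmN : 2 * m ≤ N := by nlinarith
  -- The `(2 * K) ^ 3` boxes at `m ^ 3` each give `(K * (2 * m)) ^ 3 = N ^ 3`, whatever the level.
  have hcost : 40 + (((2 * K) * ((2 * K) * ((2 * K) * (1000000 * m ^ 3 + 7) + 5 + 7) + 5 + 7) +
      5) + 2) ≤ 1000200 * N ^ 3 := by
    have e : (2 * K) * ((2 * K) * ((2 * K) * (1000000 * m ^ 3 + 7) + 5 + 7) + 5 + 7) =
        1000000 * (K * (2 * m)) ^ 3 + 7 * (2 * K) ^ 3 + 12 * (2 * K) ^ 2 + 12 * (2 * K) := by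
      ring
    rw [e, hK]
    have h3 : (2 * K) ^ 3 ≤ N ^ 3 := Nat.pow_le_pow_left hKN 3
    have h2 : (2 * K) ^ 2 ≤ (2 * K) ^ 3 := Nat.pow_le_pow_right (by omega) (by norm_num)
    have h1 : 2 * K ≤ (2 * K) ^ 3 := Nat.le_self_pow (by norm_num) _
    have h0 : 1 ≤ (2 * K) ^ 3 := Nat.one_le_pow _ _ (by omega)
    omega
  have h2m : 2 * m / 2 = m := by omega
  refine (Runs.seq (R := fun τ => LevelAt r m τ ∧ τ.wvar 22 = 2 * K ∧ τ.val = σ.val)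
    (T₁ := 40) (Runs.of_loopless hX hσ (by decide) (by decide) ?_ ?_)
    fun τ hτ hA ⟨hL, h22', hv⟩ => ?_).mono hcost fun _ _ _ h => h
  · simp [Cmd.Safe, Cmd.sem, WExpr.den, h13, h21, h22]
    have := hσ.1 13
    omega
  · refine ⟨⟨?_, ?_, ?_, ?_, ?_, ?_⟩, ?_, rfl⟩ <;>
      simp [Cmd.sem, WExpr.den, h13, h21, h22, h2m]
    omega
  have hR₁ := hR.agree hA (by decide)
  -- Boxes of one level occupy disjoint cells, so solving one preserves the solved ones and
  -- everything outside the level.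
  set Rel : State → State → Prop := fun τ υ =>
    (∀ i, (∀ x < 2 * K, ∀ y < 2 * K, ∀ z < 2 * K, ∀ u v : Fin n, i ≠ key N r x y z u v) →
      υ.val 3 i = τ.val 3 i) ∧
    ∀ x < 2 * K, ∀ y < 2 * K, ∀ z < 2 * K, BoxSolved G w s t P L N r m x y z τ →
      BoxSolved G w s t P L N r m x y z υ with hRel
  have rtrans : ∀ τ υ ρ, Rel τ υ → Rel υ ρ → Rel τ ρ := fun τ υ ρ h1 h2 =>
    ⟨fun i hi => (h2.1 i hi).trans (h1.1 i hi),
      fun x hx y hy z hz h => h2.2 x hx y hy z hz (h1.2 x hx y hy z hz h)⟩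
  refine Runs.seq (Runs.forLoop_achieve hX hτ h22' (by decide) (by decide) (by decide) Rel
    (fun x τ => ∀ y < 2 * K, ∀ z < 2 * K, x < 2 * K → BoxSolved G w s t P L N r m x y z τ)
    rtrans (fun _ _ => ⟨fun _ _ => rfl, fun _ _ _ _ _ _ h => h⟩)
    (fun x τ υ h1 h2 y hy z hz hx => h1.2 x hx y hy z hz (h2 y hy z hz hx)) ?_) ?_
  swap
  · intro τ₁ hτ₁ hA₁ ⟨_, h⟩
    have hL₁ := hL.agree hA₁ (by decide)
    have h22₁ := (hA₁.wv 22 (by decide)).trans h22'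
    refine Runs.of_loopless hX hτ₁ (by decide) (by decide) (hτ₁.1 23) ⟨?_, ?_, ?_, ?_⟩
    · simpa [Cmd.sem] using hL₁.level
    · simpa [Cmd.sem, WExpr.den] using hL₁.half
    · simpa [Cmd.sem] using h22₁
    · exact fun x hx y hy z hz => h x hx y hy z hz hx
  intro x hx τ₁ hτ₁ hA₁ h14 hr₁
  have hR₁ := hR₁.agree hA₁ (by decide)
  have hL₁ := hL.agree hA₁ (by decide)
  have h22₁ := (hA₁.wv 22 (by decide)).trans h22'
  refine Runs.forLoop_achieve hX hτ₁ h22₁ (by decide) (by decide) (by decide) Rel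
    (fun y τ => ∀ z < 2 * K, y < 2 * K → x < 2 * K → BoxSolved G w s t P L N r m x y z τ)
    rtrans (fun _ _ => ⟨fun _ _ => rfl, fun _ _ _ _ _ _ h => h⟩)
    (fun y τ υ h1 h2 z hz hy hx => h1.2 x hx y hy z hz (h2 z hz hy hx)) ?_ |>.mono le_rfl
    fun _ _ _ h => ⟨h.1, fun y hy z hz hx => h.2 y hy z hz hy hx⟩
  intro y hy τ₂ hτ₂ hA₂ h15 hr₂
  have hR₂ := hR₁.agree hA₂ (by decide)
  have hL₂ := hL₁.agree hA₂ (by decide)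
  have h22₂ := (hA₂.wv 22 (by decide)).trans h22₁
  refine Runs.forLoop_achieve hX hτ₂ h22₂ (by decide) (by decide) (by decide) Rel
    (fun z τ => z < 2 * K → y < 2 * K → x < 2 * K → BoxSolved G w s t P L N r m x y z τ)
    rtrans (fun _ _ => ⟨fun _ _ => rfl, fun _ _ _ _ _ _ h => h⟩)
    (fun z τ υ h1 h2 hz hy hx => h1.2 x hx y hy z hz (h2 hz hy hx)) ?_ |>.mono le_rfl
    fun _ _ _ h => ⟨h.1, fun z hz hy hx => h.2 z hz hz hy hx⟩
  intro z hz τ₃ hτ₃ hA₃ h16 hr₃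
  have hR₃ := hR₂.agree hA₃ (by decide)
  have hL₃ := hL₂.agree hA₃ (by decide)
  have hM₃ : NamedAt r x y z τ₃ := ⟨hL₃.level,
    (hA₃.wv 14 (by decide)).trans ((hA₂.wv 14 (by decide)).trans h14),
    (hA₃.wv 15 (by decide)).trans h15, h16⟩
  have hs₃ : LevelSolved G w s t P L N (r + 1) (2 * m) K τ₃ := by
    intro a ha b hb c hc u hu v hv'
    rw [(rtrans _ _ _ hr₁ (rtrans _ _ _ hr₂ hr₃)).1, hv]
    · exact hs a ha b hb c hc u hu v hv'
    · intro x' hx' y' hy' z' hz' u' v' h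
      have := (key_inj (by omega) (by omega) (by omega) (by omega) (by omega) (by omega)
        (by omega) (by omega) (by omega) (by omega) h).1
      omega
  refine (runs_boxCmd hX hw hP hnN (by omega) hτ₃ hR₃ hm hK hx hy hz hM₃ hL₃ hs₃).mono le_rfl
    fun υ _ _ ⟨h1, h2⟩ => ⟨⟨fun i hi => h2 i (hi x hx y hy z hz), ?_⟩, fun _ _ _ => h1⟩
  intro x' hx' y' hy' z' hz' h
  by_cases he : x' = x ∧ y' = y ∧ z' = z
  · obtain ⟨rfl, rfl, rfl⟩ := he
    exact h1
  · intro u hu v hv'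
    rw [h2]
    · exact h u hu v hv'
    · intro u' v' h'
      obtain ⟨-, e1, e2, e3, -⟩ := key_inj (by omega) (by omega) (by omega) (by omega) (by omega)
        (by omega) (by omega) (by omega) (by omega) (by omega) h'
      exact he ⟨e1, e2, e3⟩

/-! ### Reading off the answers. -/

theorem runs_answerCmd (hX : Wide W X) (hLn : L ≤ n) {σ : State} (hσ : σ.Bounded X)
    (hR : Ready G H w s t P L N σ) (h13 : σ.wvar 13 = 0) :
    Runs W X answerCmd σ (L * (L * (L * (150 + 7) + 5 + 7) + 5 + 7) + 5) fun τ =>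
      ∀ i < L, ∀ j < L, ∀ l < L,
        τ.val 2 ((i * n + j) * n + l) = σ.val 3 (key N 0 i j l s t) := by
  set Good : State → ℕ → ℕ → ℕ → Prop := fun τ i j l =>
    τ.val 2 ((i * n + j) * n + l) = σ.val 3 (key N 0 i j l s t) with hGood
  set Rel : State → State → Prop := fun τ υ =>
    ∀ i < L, ∀ j < L, ∀ l < L, Good τ i j l → Good υ i j l with hRel
  have rtrans : ∀ τ υ ρ, Rel τ υ → Rel υ ρ → Rel τ ρ := fun τ υ ρ h1 h2 i hi j hj l hl h =>
    h2 i hi j hj l hl (h1 i hi j hj l hl h)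
  refine (Runs.forLoop_achieve hX hσ hR.path.length (by decide) (by decide) (by decide) Rel
    (fun i τ => ∀ j < L, ∀ l < L, i < L → Good τ i j l) rtrans (fun _ _ _ _ _ _ _ _ h => h)
    (fun i τ υ h1 h2 j hj l hl hi => h1 i hi j hj l hl (h2 j hj l hl hi)) ?_).mono le_rfl
    fun _ _ _ h i hi j hj l hl => h.2 i hi j hj l hl hi
  intro i hi τ₁ hτ₁ hA₁ h14 _
  have hR₁ := hR.agree hA₁ (by decide)
  refine (Runs.forLoop_achieve hX hτ₁ hR₁.path.length (by decide) (by decide) (by decide) Rel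
    (fun j τ => ∀ l < L, j < L → i < L → Good τ i j l) rtrans (fun _ _ _ _ _ _ _ _ h => h)
    (fun j τ υ h1 h2 l hl hj hi => h1 i hi j hj l hl (h2 l hl hj hi)) ?_).mono le_rfl
    fun _ _ _ h => ⟨h.1, fun j hj l hl hi => h.2 j hj l hl hj hi⟩
  intro j hj τ₂ hτ₂ hA₂ h15 _
  have hR₂ := hR₁.agree hA₂ (by decide)
  refine (Runs.forLoop_achieve hX hτ₂ hR₂.path.length (by decide) (by decide) (by decide) Rel
    (fun l τ => l < L → j < L → i < L → Good τ i j l) rtrans (fun _ _ _ _ _ _ _ _ h => h)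
    (fun l τ υ h1 h2 hl hj hi => h1 i hi j hj l hl (h2 hl hj hi)) ?_).mono le_rfl
    fun _ _ _ h => ⟨h.1, fun l hl hj hi => h.2 l hl hl hj hi⟩
  intro l hl τ₃ hτ₃ hA₃ h16 _
  have hR₃ := hR₂.agree hA₃ (by decide)
  have hM₃ : NamedAt 0 i j l τ₃ := ⟨(hA₃.wv 13 (by decide)).trans
      ((hA₂.wv 13 (by decide)).trans ((hA₁.wv 13 (by decide)).trans h13)),
    (hA₃.wv 14 (by decide)).trans ((hA₂.wv 14 (by decide)).trans h14),
    (hA₃.wv 15 (by decide)).trans h15, h16⟩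
  have hv : ∀ k, τ₃.val 3 k = σ.val 3 k := fun k => by
    simp only [State.val, hA₃.wa 3 (by decide), hA₂.wa 3 (by decide), hA₁.wa 3 (by decide),
      hA₃.ra 3 (by decide), hA₂.ra 3 (by decide), hA₁.ra 3 (by decide)]
  refine (Runs.copyCell hX hτ₃ (by decide) (by decide) (by decide)).mono le_rfl fun υ _ _ hυ => ?_
  have den : (pairE (pairE (.var 14) (.var 15)) (.var 16)).den τ₃ = (i * n + j) * n + l := by
    simp [pairE, WExpr.den, hM₃.fst, hM₃.snd, hM₃.trd, hR₃.input.size]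
  rw [den, hM₃.den_keyE hR₃.base, hR₃.input.source, hR₃.input.target, hv] at hυ
  have good : Good υ i j l := by
    rw [hGood]
    exact (hυ _ _).trans (if_pos ⟨rfl, rfl⟩)
  refine ⟨fun i' hi' j' hj' l' hl' h => ?_, fun _ _ _ => good⟩
  by_cases he : i' = i ∧ j' = j ∧ l' = l
  · obtain ⟨rfl, rfl, rfl⟩ := he
    exact good
  · refine (hυ _ _).trans ((if_neg fun h' => he ?_).trans h)
    obtain ⟨h1, h2⟩ := pair_inj (by omega) (by omega) h'.2
    obtain ⟨h3, h4⟩ := pair_inj (by omega) (by omega) h1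
    exact ⟨h3, h4, h2⟩

end Levels

end WeightedGraph

/-! ## The algorithm -/

namespace WeightedGraph

open RealRAM

section Algorithm

variable {n : ℕ} {G H : SimpleGraph (Fin n)} {w : Sym2 (Fin n) → ℝ} {s t : Fin n} {W X : ℕ}
  {P : ℕ → Fin n} {L N : ℕ}

theorem runs_levels (hX : Wide W X) (hw : ∀ e ∈ G.edgeSet, 0 ≤ w e)
    (hP : ∀ i < L, G.Adj (P i) (P (i + 1))) (hn : 0 < n) (hnN : n ≤ N) (hNX : 6 * N + 2 ≤ X)
    {σ : State} (hσ : σ.Bounded X) (hR : Ready G H w s t P L N σ) {R : ℕ} (hN : 2 ^ R = N)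
    (h5 : σ.wvar 5 = R) (h13 : σ.wvar 13 = R) (h21 : σ.wvar 21 = N) (h22 : σ.wvar 22 = 1)
    (hs : LevelSolved G w s t P L N R N 1 σ) :
    Runs W X (forLoop 6 5 levelCmd) σ (R * (1000200 * N ^ 3 + 7) + 5) fun τ =>
      τ.wvar 13 = 0 ∧ LevelSolved G w s t P L N 0 1 N τ := by
  refine (Runs.forLoop hX hσ h5 (by decide) (by decide) (by decide)
    (fun k τ => τ.wvar 13 = R - k ∧ τ.wvar 21 = 2 ^ (R - k) ∧ τ.wvar 22 = 2 ^ k ∧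
      LevelSolved G w s t P L N (R - k) (2 ^ (R - k)) (2 ^ k) τ)
    (by rw [Nat.sub_zero, hN]; exact ⟨h13, h21, h22, hs⟩) ?_).mono le_rfl ?_
  · intro k hk τ hτ hA _ ⟨i13, i21, i22, is⟩
    obtain ⟨r, hr⟩ : ∃ r, R = k + 1 + r := ⟨R - (k + 1), by omega⟩
    have e1 : R - k = r + 1 := by omega
    have e2 : R - (k + 1) = r := by omega
    rw [e1, pow_succ'] at i21 is
    rw [e1] at i13
    have hK : 2 ^ k * (2 * 2 ^ r) = N := by rw [← hN, hr]; ring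
    refine (runs_levelCmd hX hw hP hn hnN hNX hτ (hR.agree hA (by decide)) (by positivity) hK i13
      i21 i22 is).mono le_rfl fun υ _ _ ⟨j13, j21, j22, js⟩ => ?_
    rw [e2, pow_succ']
    exact ⟨j13, j21, j22, js⟩
  · rintro τ - - ⟨h, -, -, h'⟩
    rw [Nat.sub_self] at h h'
    rw [hN] at h'
    exact ⟨h, h'⟩

theorem runs_afterPathCmd (hX : Wide W X) (hw : ∀ e ∈ G.edgeSet, 0 ≤ w e)
    (hP : ∀ i < L, G.Adj (P i) (P (i + 1))) (hL : L < n) (hnN : n ≤ N) (hNX : 6 * N + 2 ≤ X)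
    {σ : State} (hσ : σ.Bounded X) (hI : Input G G w s t σ) (hp : PathAt P L σ) {R : ℕ}
    (hN : 2 ^ R = N) (h4 : σ.wvar 4 = N) (h5 : σ.wvar 5 = R) :
    Runs W X afterPathCmd σ ((L * (40 + 7) + 5) + (14 + ((n * (n * (150 + 7) + 5 + 7) + 5) +
      ((R * (n * (n * (n * (300 + 7) + 5 + 7) + 5 + 7) + 5 + 7) + 5) +
      ((R * (1000200 * N ^ 3 + 7) + 5) +
      (L * (L * (L * (150 + 7) + 5 + 7) + 5 + 7) + 5)))))) fun τ =>
      ∀ i < L, ∀ j < L, ∀ l < L,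
        τ.val 2 ((i * n + j) * n + l) = wdist (switch G P L {i, j, l}ᶜ) w s t := by
  have hn : 0 < n := by omega
  have hN0 : 0 < N := by omega
  have hHG : switch G P L ∅ ≤ G := switch_le hP ∅
  have hwH : ∀ e ∈ (switch G P L ∅).edgeSet, 0 ≤ w e := fun e he =>
    hw e (SimpleGraph.edgeSet_mono hHG he)
  refine Runs.seq (runs_cutCmd hX hσ hI hp) fun τ₁ b₁ A₁ I₁ => ?_
  have R₁ : Ready G (switch G P L ∅) w s t P L N τ₁ :=
    ⟨I₁, hp.agree A₁ (by decide), (A₁.wv 4 (by decide)).trans h4⟩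
  have v5₁ := (A₁.wv 5 (by decide)).trans h5
  refine Runs.seq (R := fun τ => NamedAt R 0 0 0 τ ∧ τ.wvar 21 = N ∧ τ.wvar 22 = 1)
    (Runs.of_loopless hX b₁ (by decide) (by decide) ?_ ?_) fun τ₂ b₂ A₂ ⟨M₂, v21, v22⟩ => ?_
  · have h1X : 1 ≤ X := le_trans (by norm_num) hX.1
    simp [Cmd.Safe, Cmd.sem, WExpr.den, b₁.1 5, b₁.1 4, h1X]
  · refine ⟨⟨?_, ?_, ?_, ?_⟩, ?_, ?_⟩ <;> simp [Cmd.sem, WExpr.den, v5₁, R₁.base]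
  have R₂ := R₁.agree A₂ (by decide)
  have v5₂ := (A₂.wv 5 (by decide)).trans v5₁
  refine Runs.seq (runs_edgeCmd hX hHG hnN b₂ R₂ hN0 hN0 hN0 M₂) fun τ₃ b₃ A₃ D₃ => ?_
  have R₃ := R₂.agree A₃ (by decide)
  have v5₃ := (A₃.wv 5 (by decide)).trans v5₂
  refine Runs.seq (runs_squareCmd hX hwH hnN b₃ R₃ hN0 hN0 hN0 (M₂.agree A₃ (by decide)) v5₃
    (hN.symm ▸ hnN) (fun u v => ?_) (fun u v => ?_)) fun τ₄ b₄ A₄ D₄ => ?_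
  · by_cases huv : u = v
    · rw [(D₃ u v).1 huv, huv, wdist_self hwH]
    · by_cases ha : (switch G P L ∅).Adj u v
      · rw [(D₃ u v).2.1 huv ha]
        exact wdist_le_of_adj hwH ha
      · rw [(D₃ u v).2.2 huv ha]
        exact le_top
  · exact belowWalks_one (fun h => ((D₃ u v).1 h).le) fun h => ((D₃ u v).2.1 h.ne h).le
  have R₄ := R₃.agree A₄ (by decide)
  -- A single block of length `N` contains all positions of the path, because `L < n ≤ N`. So the
  -- top box has no path edge at all, and its graph is the one whose distances were computed by
  -- squaring.
  have base : LevelSolved G w s t P L N R N 1 τ₄ := by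
    intro x hx y hy z hz u _ v _
    obtain rfl : x = 0 := by omega
    obtain rfl : y = 0 := by omega
    obtain rfl : z = 0 := by omega
    rw [D₄]
    congr 1
    refine switch_congr fun i hi => ?_
    simpa [offBox] using fun _ => hi.trans (hL.trans_le hnN)
  refine Runs.seq (runs_levels hX hw hP hn hnN hNX b₄ R₄ hN ((A₄.wv 5 (by decide)).trans v5₃)
    ((A₄.wv 13 (by decide)).trans ((A₃.wv 13 (by decide)).trans M₂.level))
    ((A₄.wv 21 (by decide)).trans ((A₃.wv 21 (by decide)).trans v21))
    ((A₄.wv 22 (by decide)).trans ((A₃.wv 22 (by decide)).trans v22)) base)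
    fun τ₅ b₅ A₅ ⟨h13, hs⟩ => ?_
  refine (runs_answerCmd hX hL.le b₅ (R₄.agree A₅ (by decide)) h13).mono le_rfl
    fun τ _ _ h i hi j hj l hl => ?_
  rw [h i hi j hj l hl, hs i (by omega) j (by omega) l (by omega) s (.inl rfl) t
    (.inr (.inl rfl))]
  congr 2
  -- Blocks of length one are single positions, so the edges off the box are all but `i`, `j`, `l`.
  ext e
  simp [offBox]

/-! ### Assembly and the total cost. -/

/-- The output is correct. -/
def IsOutput (G : SimpleGraph (Fin n)) (w : Sym2 (Fin n) → ℝ) (s t : Fin n) (σ : State) : Prop :=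
  ∃ p : G.Walk s t, IsShortestPath w p ∧ σ.wvar 3 = p.length ∧
    (∀ i ≤ p.length, σ.warr 1 i = p.getVert i) ∧
    ∀ i < p.length, ∀ j < p.length, ∀ l < p.length,
      IsDist (G.deleteEdges {stepEdge p i, stepEdge p j, stepEdge p l}) w s t (answer n σ i j l)

theorem isDist_answer (hw : ∀ e ∈ H.edgeSet, 0 ≤ w e) {σ : State} {i j l : ℕ}
    (h : σ.val 2 ((i * n + j) * n + l) = wdist H w s t) : IsDist H w s t (answer n σ i j l) := by
  unfold State.val at h
  unfold answer
  split_ifs at h ⊢ with h0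
  · exact (isDist_of_wdist hw).1 h.symm
  · exact (isDist_of_wdist hw).2 _ h.symm

/-- Only the squarings and the levels carry the factor `R`, each of them costing `O(n ^ 3)` since `N
≤ 2 * n`. All other phases are cubic at most. -/
theorem fault_cost_le {n L R N : ℕ} (hn : 0 < n) (hL : L ≤ n) (hN : N ≤ 2 * n) :
    (2 + (n * (13 + 7) + 5)) + ((3 + (n * (n * (40 + (n * (100 + 7) + 5) + 7) + 5 + 7) + 5)) +
      ((7 + (n * ((4 + ((2 + ((n * (100 + 7) + 5) + 60)) + 20)) + 7) + 5)) +
      ((L * (40 + 7) + 5) + (14 + ((n * (n * (150 + 7) + 5 + 7) + 5) +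
      ((R * (n * (n * (n * (300 + 7) + 5 + 7) + 5 + 7) + 5 + 7) + 5) +
      ((R * (1000200 * N ^ 3 + 7) + 5) +
      (L * (L * (L * (150 + 7) + 5 + 7) + 5 + 7) + 5)))))))) ≤ 10000000 * n ^ 3 * (R + 1) := by
  have h1 : n ≤ n ^ 3 := Nat.le_self_pow (by norm_num) n
  have h0 : 1 ≤ n ^ 3 := Nat.one_le_pow _ _ hn
  have h2 : n ^ 2 ≤ n ^ 3 := Nat.pow_le_pow_right hn (by norm_num)
  have hN3 : N ^ 3 ≤ 8 * n ^ 3 := by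
    calc N ^ 3 ≤ (2 * n) ^ 3 := Nat.pow_le_pow_left hN 3
      _ = _ := by ring
  have hLL : L * (L * (L * (150 + 7) + 5 + 7) + 5 + 7) ≤
      n * (n * (n * (150 + 7) + 5 + 7) + 5 + 7) := by gcongr
  have sq : n * (n * (n * (300 + 7) + 5 + 7) + 5 + 7) + 5 + 7 ≤ 400 * n ^ 3 := by
    have : n * (n * (n * (300 + 7) + 5 + 7) + 5 + 7) + 5 + 7 =
      307 * n ^ 3 + 12 * n ^ 2 + 12 * n + 12 := by ring
    omega
  have lev : 1000200 * N ^ 3 + 7 ≤ 9000000 * n ^ 3 := by omega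
  have hR1 := Nat.mul_le_mul_left R sq
  have hR2 := Nat.mul_le_mul_left R lev
  have e1 : R * (400 * n ^ 3) = 400 * (n ^ 3 * R) := by ring
  have e2 : R * (9000000 * n ^ 3) = 9000000 * (n ^ 3 * R) := by ring
  have e3 : 10000000 * n ^ 3 * (R + 1) = 10000000 * (n ^ 3 * R) + 10000000 * n ^ 3 := by ring
  have e4 : n * (n * (n * (150 + 7) + 5 + 7) + 5 + 7) = 157 * n ^ 3 + 12 * n ^ 2 + 12 * n := by
    ring
  have e5 : n * (n * (40 + (n * (100 + 7) + 5) + 7) + 5 + 7) =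
      107 * n ^ 3 + 52 * n ^ 2 + 12 * n := by ring
  have e6 : n * ((4 + ((2 + ((n * (100 + 7) + 5) + 60)) + 20)) + 7) = 107 * n ^ 2 + 98 * n := by
    ring
  have e7 : n * (n * (150 + 7) + 5 + 7) = 157 * n ^ 2 + 12 * n := by ring
  rw [e1] at hR1
  rw [e2] at hR2
  rw [e3, e5, e6, e7]
  rw [e4] at hLL
  omega

theorem runs_faultCmd (hX : Wide W X) (hnX : 12 * n + 2 ≤ X) (hw : ∀ e ∈ G.edgeSet, 0 ≤ w e)
    (hst : G.Reachable s t) (hσ : (inputState G w s t).Bounded X) :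
    Runs W X faultCmd (inputState G w s t) (10000000 * n ^ 3 * (Nat.log 2 n + 1 + 1))
      (IsOutput G w s t) := by
  have hn : 0 < n := s.pos
  set l := Nat.log 2 n + 1 with hl
  refine (Runs.seq (runs_sizeCmd hX (by omega) hn hσ rfl rfl)
    (T₂ := (3 + (n * (n * (40 + (n * (100 + 7) + 5) + 7) + 5 + 7) + 5)) +
      ((7 + (n * ((4 + ((2 + ((n * (100 + 7) + 5) + 60)) + 20)) + 7) + 5)) +
      ((n * (40 + 7) + 5) + (14 + ((n * (n * (150 + 7) + 5 + 7) + 5) +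
      ((l * (n * (n * (n * (300 + 7) + 5 + 7) + 5 + 7) + 5 + 7) + 5) +
      ((l * (1000200 * (2 * n) ^ 3 + 7) + 5) +
      (n * (n * (n * (150 + 7) + 5 + 7) + 5 + 7) + 5))))))))
    fun τ₁ b₁ A₁ ⟨hpow, hnN, hN2⟩ => ?_).mono
    (fault_cost_le hn le_rfl le_rfl) fun _ _ _ h => h
  -- From `2 ^ R < 2 * n` and `n < 2 ^ l` it follows that `R ≤ l`.
  have hRl : τ₁.wvar 5 ≤ l := by
    rw [hpow] at hN2
    by_contra! h
    have h1 : n < 2 ^ l := Nat.lt_pow_succ_log_self (by norm_num) n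
    have h2 : 2 ^ (l + 1) ≤ 2 ^ τ₁.wvar 5 := Nat.pow_le_pow_right (by norm_num) h
    rw [pow_succ] at h2
    omega
  have I₁ := (input_inputState (G := G) (w := w) (s := s) (t := t)).agree A₁ (by decide)
  have z₁ : ∀ a ≠ 0, ∀ m, τ₁.warr a m = 0 ∧ τ₁.rarr a m = 0 := fun a ha m => by
    rw [A₁.wa a (by simp [sizeCmd, forLoop, Cmd.was]),
      A₁.ra a (by simp [sizeCmd, forLoop, Cmd.ras])]
    simp [inputState, ha]
  refine Runs.seq (runs_hopCmd hX b₁ I₁ (fun m => (z₁ 4 (by decide) m).1)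
    fun m => (z₁ 4 (by decide) m).2) fun τ₂ b₂ A₂ D₂ => ?_
  have I₂ := I₁.agree A₂ (by decide)
  have h3 : τ₂.wvar 3 = 0 := (A₂.wv 3 (by decide)).trans (A₁.wv 3 (by decide))
  refine Runs.seq (runs_pathCmd hX (by omega) hw hst b₂ I₂ D₂ h3 fun m => by
    rw [A₂.wa 1 (by decide)]; exact (z₁ 1 (by decide) m).1) fun τ₃ b₃ A₃ ⟨p, hp, h3, hv, hlt⟩ => ?_
  have I₃ := I₂.agree A₃ (by decide)
  have keep : ∀ i, i = 4 ∨ i = 5 → τ₃.wvar i = τ₁.wvar i := by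
    rintro i (rfl | rfl)
    · exact (A₃.wv 4 (by decide)).trans (A₂.wv 4 (by decide))
    · exact (A₃.wv 5 (by decide)).trans (A₂.wv 5 (by decide))
  -- Beyond the end of the path the values of `P` are irrelevant. They only need to be vertices,
  -- since the padding positions also list terminals.
  set P : ℕ → Fin n := fun i => ⟨τ₃.warr 1 i, hlt i⟩ with hPdef
  have hPv : ∀ i ≤ p.length, P i = p.getVert i := fun i hi => Fin.ext (hv i hi)
  have hP : ∀ i < p.length, G.Adj (P i) (P (i + 1)) := fun i hi => by
    rw [hPv i hi.le, hPv (i + 1) hi]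
    exact p.adj_getVert_succ hi
  have hL : p.length < n := by simpa using hp.1.length_lt
  refine (runs_afterPathCmd hX hw hP hL hnN (by omega) b₃ I₃ ⟨h3, fun _ => rfl⟩ hpow.symm
    (keep 4 (.inl rfl)) (keep 5 (.inr rfl))).mono (by gcongr) fun τ _ A h => ?_
  refine ⟨p, hp, (A.wv 3 (by decide)).trans h3, fun i hi => ?_, fun i hi j hj k hk => ?_⟩
  · rw [A.wa 1 (by decide)]
    exact hv i hi
  · refine isDist_answer (fun e he => hw e (SimpleGraph.edgeSet_mono
      (SimpleGraph.deleteEdges_le _) he)) ?_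
    rw [h i hi j hj k hk, switch_eq_deleteEdges p hp.1 hPv, Set.image_insert_eq,
      Set.image_insert_eq, Set.image_singleton]
    rintro _ (rfl | rfl | rfl) <;> assumption

theorem bounded_inputState (hX : 1 ≤ X) (hn : n ≤ X) : (inputState G w s t).Bounded X := by
  refine ⟨fun x => ?_, fun a m => ?_⟩
  · simp only [inputState]
    split_ifs <;> omega
  · simp only [inputState]
    split_ifs
    · unfold rowMajor
      dsimp only
      split_ifs <;> omega
    · exact Nat.zero_le _

/-- The value `12 * n + 20` leaves room for the up to `6 * N + 2` terminals with `N < 2 * n` and for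
the literals up to `20`. It is at most `(n + 1) ^ 6`, so its 24th power is at most `(n + 1) ^ 144`,
and one more factor makes the bound strict. -/
theorem wide_input (hn : 0 < n) : Wide ((n + 1) ^ 145) (12 * n + 20) := by
  have h : 12 * n + 20 ≤ (n + 1) ^ 6 := by
    obtain ⟨m, rfl⟩ : ∃ m, n = m + 1 := ⟨n - 1, by omega⟩
    have e : (m + 1 + 1) ^ 6 = m ^ 6 + 12 * m ^ 5 + 60 * m ^ 4 + 160 * m ^ 3 + 240 * m ^ 2 +
        192 * m + 64 := by ring
    rw [e]
    omega
  refine ⟨by omega, ?_⟩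
  calc (12 * n + 20) ^ 24 ≤ ((n + 1) ^ 6) ^ 24 := Nat.pow_le_pow_left h 24
    _ = (n + 1) ^ 144 := by rw [← pow_mul]
    _ < (n + 1) ^ 145 := Nat.pow_lt_pow_right (by omega) (by norm_num)

end Algorithm

end WeightedGraph

theorem mainTheorem5 :
    ∃ (prog : RealRAM.Cmd) (c C k : ℕ),
      ∀ (n : ℕ) (G : SimpleGraph (Fin n)) (w : Sym2 (Fin n) → ℝ) (s t : Fin n),
        (∀ e ∈ G.edgeSet, 0 ≤ w e) → G.Reachable s t →
        ∃ (T : ℕ) (σ : RealRAM.State),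
          RealRAM.Exec ((n + 1) ^ c) prog (WeightedGraph.inputState G w s t) T σ ∧
          T ≤ C * n ^ 3 * (Nat.log 2 n + 1) ^ k ∧
          ∃ p : G.Walk s t, WeightedGraph.IsShortestPath w p ∧
            σ.wvar 3 = p.length ∧
            (∀ i ≤ p.length, σ.warr 1 i = p.getVert i) ∧
            ∀ i < p.length, ∀ j < p.length, ∀ l < p.length,
              WeightedGraph.IsDist
                (G.deleteEdges {WeightedGraph.stepEdge p i, WeightedGraph.stepEdge p j,
                  WeightedGraph.stepEdge p l})
                w s t (WeightedGraph.answer n σ i j l) := by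
  -- The exponent is that of `wide_input`. The constant is twice that of `runs_faultCmd`, because
  -- `log n + 2 ≤ 2 * (log n + 1)`.
  refine ⟨WeightedGraph.faultCmd, 145, 20000000, 1, fun n G w s t hw hst => ?_⟩
  have hn : 0 < n := s.pos
  obtain ⟨T, σ, h1, h2, -, h3⟩ := WeightedGraph.runs_faultCmd (WeightedGraph.wide_input hn)
    (by omega) hw hst (WeightedGraph.bounded_inputState (X := 12 * n + 20) (by omega) (by omega))
  refine ⟨T, σ, h1, h2.trans ?_, h3⟩
  rw [pow_one]
  calc 10000000 * n ^ 3 * (Nat.log 2 n + 1 + 1)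
      ≤ 10000000 * n ^ 3 * (2 * (Nat.log 2 n + 1)) := Nat.mul_le_mul_left _ (by omega)
    _ = _ := by ring
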